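/- **Setting.** Let $\Sigma$ be a connected, paracompact, Hausdorff real-analytic $d$-manifold without boundary and $G$ a compact connected Lie group with normalized Haar measure $\mu_H$. A *curve* in $\Sigma$ is a continuous map $c:[0,1]\to\Sigma$ with a partition $0=t_0<\dots<t_n=1$ such that on each $[t_k,t_{k+1}]$ either $c$ is constant, or $c$ is analytic on $[t_k,t_{k+1}]$ (end points included) and restricts to an analytic embedding (an immersion that is a homeomorphism onto its image) of $(t_k,t_{k+1})$. Curves are composed by concatenation; $c^{-1}(t)=c(1-t)$. Two curves with the same end points are equivalent if they coincide up to finitely many retracings (insertions or deletions of $b^{-1}b$ with $b$ a curve) and a reparametrization by an increasing homeomorphism of $[0,1]$ that off a finite set is analytic with non-zero derivative. The equivalence classes are the arrows of a groupoid $\mathcal P$ with object set $\Sigma$ (a class $p$ goes from its source $s(p)$ to its range $r(p)$, and $p'p$ means first $p$, then $p'$). An *edge* $e$ is the class of a curve $c$ that is analytic on $[0,1]$ and embeds $(0,1)$; its image is $\sigma(e)=c([0,1])$. Edges $e_1,\dots,e_n$ ($n\ge 0$) are *independent* if for $i\neq j$ every point of $\sigma(e_i)\cap\sigma(e_j)$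 is an end point of both $e_i$ and $e_j$. Let $\mathcal L$ be the set, ordered by inclusion, of the subgroupoids $L$ of $\mathcal P$ that are generated by some finite independent set of edges. Let $\mathcal A_L=\mathrm{Hom}[L,G]$ for $L\in\mathcal L$, and $\bar{\mathcal A}=\mathrm{Hom}[\mathcal P,G]$, be the sets of functors to $G$ (so $A(p'p)=A(p')A(p)$ and $A(p^{-1})=A(p)^{-1}$), each with the weakest topology for which all evaluations $A\mapsto A(p)$ are continuous; let $p_L:\bar{\mathcal A}\to\mathcal A_L$ and $p_{L,L'}:\mathcal A_{L'}\to\mathcal A_L$ ($L\le L'$) be the restriction maps. **Theorem.** 1. For all independent generators $(e_1,\dots,e_n)$ of $L\in\mathcal L$, the map $\rho_{e_1,\dots,e_n}:\mathcal A_L\to G^n$, $A\mapsto(A(e_1),\dots,A(e_n))$, is a homeomorphism. 2. The measure $\mu_{0L}:=(\rho_{e_1,\dots,e_n}^{-1})_*\mu_H^n$ on $\mathcal A_L$ does not depend on the choice (or the order) of the independent generators of $L$; it is a regular Borel probability measure. 3. The family is consistent: $(p_{L,L'})_*\mu_{0L'}=\mu_{0L}$ whenever $L\le L'$. 4. There is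 a unique regular Borel probability measure $\mu_0$ on $\bar{\mathcal A}$ with $(p_L)_*\mu_0=\mu_{0L}$ for all $L\in\mathcal L$. 5. $\mu_0$ is invariant under the action $(\varphi A)(p)=A(\varphi^{-1}p)$ of every analytic diffeomorphism $\varphi$ of $\Sigma$, and under the action $A_{\mathtt g}(p)=\mathtt g(r(p))\,A(p)\,\mathtt g(s(p))^{-1}$ of every map $\mathtt g:\Sigma\to G$. -/

import Mathlib

open Set MeasureTheory CategoryTheory
open scoped Manifold ContDiff Topology unitInterval

namespace GenConn

universe u v

section Curves

variable {d : ℕ} {M : Type u} [TopologicalSpace M] [ChartedSpace (EuclideanSpace ℝ (Fin d)) M]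

/-- `γ` is analytic on the closed interval `[a, b]` (end points included) and restricts to an
analytic embedding of the open interval `(a, b)`, i.e. to an immersion which is a homeomorphism
onto its image. -/
structure IsRegularPiece (d : ℕ) {M : Type u} [TopologicalSpace M]
    [ChartedSpace (EuclideanSpace ℝ (Fin d)) M] (γ : ℝ → M) (a b : ℝ) : Prop where
  analytic : ContMDiffOn 𝓘(ℝ, ℝ) (𝓡 d) ω γ (Icc a b)
  immersion : ∀ t ∈ Ioo a b, mfderiv 𝓘(ℝ, ℝ) (𝓡 d) γ t ≠ 0
  embedding : Topology.IsEmbedding ((Ioo a b).domRestrict γ)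

/-- A piece of a curve on `[a, b]`: analytic, with the open interval either embedded as a
one-dimensional submanifold, or mapped to a point (a zero-dimensional one). -/
def IsPiece (d : ℕ) {M : Type u} [TopologicalSpace M]
    [ChartedSpace (EuclideanSpace ℝ (Fin d)) M] (γ : ℝ → M) (a b : ℝ) : Prop :=
  IsRegularPiece d γ a b ∨ ∀ t ∈ Icc a b, γ t = γ a

/-- A continuous path `[0,1] → M` is piecewise analytic if there is a partition
`0 = t 0 < t 1 < ⋯ < t n = 1` such that each `[t k, t (k+1)]` carries a piece. -/
def IsPiecewiseAnalytic (d : ℕ) {M : Type u} [TopologicalSpace M]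
    [ChartedSpace (EuclideanSpace ℝ (Fin d)) M] {x y : M} (c : Path x y) : Prop :=
  ∃ (n : ℕ) (t : ℕ → ℝ), t 0 = 0 ∧ t n = 1 ∧
    ∀ k < n, t k < t (k + 1) ∧ IsPiece d c.extend (t k) (t (k + 1))

lemma IsPiece.affine {γ γ' : ℝ → M} {a b a' b' α β : ℝ} (h : IsPiece d γ a b) (hα : α ≠ 0)
    (h1 : ∀ t ∈ Icc a' b', α * t + β ∈ Icc a b) (h2 : ∀ t ∈ Ioo a' b', α * t + β ∈ Ioo a b)
    (h3 : ∀ t ∈ Icc a' b', γ' t = γ (α * t + β)) : IsPiece d γ' a' b' := by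
  rcases h with h | h
  · left
    have hcd : ContMDiff 𝓘(ℝ, ℝ) 𝓘(ℝ, ℝ) ω (fun t : ℝ => α * t + β) := by
      apply ContDiff.contMDiff
      fun_prop
    refine ⟨?_, ?_, ?_⟩
    · exact (h.analytic.comp hcd.contMDiffOn h1).congr h3
    · intro t ht h0
      have hev : γ' =ᶠ[𝓝 t] γ ∘ (fun t : ℝ => α * t + β) := by
        filter_upwards [Icc_mem_nhds ht.1 ht.2] with s hs using h3 s hs
      have hm := h2 t ht
      have hd : MDifferentiableAt 𝓘(ℝ, ℝ) (𝓡 d) γ (α * t + β) :=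
        (h.analytic.contMDiffAt (Icc_mem_nhds hm.1 hm.2)).mdifferentiableAt (by simp)
      have hda : HasDerivAt (fun t : ℝ => α * t + β) α t := by
        simpa using ((hasDerivAt_id t).const_mul α).add_const β
      have hda' : HasMFDerivAt 𝓘(ℝ, ℝ) 𝓘(ℝ, ℝ) (fun t : ℝ => α * t + β) t _ :=
        hda.hasFDerivAt.hasMFDerivAt
      have hc := (hd.hasMFDerivAt.comp t hda').mfderiv
      rw [hev.mfderiv_eq, hc] at h0
      apply h.immersion _ hm
      have e1 : (mfderiv 𝓘(ℝ, ℝ) (𝓡 d) γ (α * t + β)) ((α⁻¹ : ℝ) * α : ℝ) = 0 := by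
        have := congrArg (fun L => L (α⁻¹ : ℝ)) h0
        exact this
      rw [inv_mul_cancel₀ hα] at e1
      exact ContinuousLinearMap.ext_ring e1
    · have haff : Topology.IsEmbedding (fun t : ℝ => α * t + β) := by
        have := ((Homeomorph.mulLeft₀ α hα).trans (Homeomorph.addRight β)).isEmbedding
        exact this
      have hr : Topology.IsEmbedding
          (fun t : Ioo a' b' => (⟨α * t + β, h2 t t.2⟩ : Ioo a b)) := by
        have := haff.comp (Topology.IsEmbedding.subtypeVal (p := fun t => t ∈ Ioo a' b'))
        exact this.codRestrict (Ioo a b) (fun t => h2 t t.2)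
      have := h.embedding.comp hr
      convert this using 1
      funext t
      exact h3 t (Ioo_subset_Icc_self t.2)
  · right
    intro t ht
    have ha : a' ∈ Icc a' b' := ⟨le_rfl, ht.1.trans ht.2⟩
    rw [h3 t ht, h3 a' ha, h _ (h1 t ht), h _ (h1 a' ha)]

lemma IsPiecewiseAnalytic.refl (x : M) : IsPiecewiseAnalytic d (Path.refl x) :=
  ⟨1, fun k => k, by simp, by simp, fun k hk => ⟨by simp, Or.inr (by simp)⟩⟩

lemma IsPiecewiseAnalytic.symm {x y : M} {c : Path x y} (h : IsPiecewiseAnalytic d c) :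
    IsPiecewiseAnalytic d c.symm := by
  obtain ⟨n, t, h0, h1, hp⟩ := h
  refine ⟨n, fun k => 1 - t (n - k), by simp [h1], by simp [h0], fun k hk => ?_⟩
  have hk' : n - k = (n - (k + 1)) + 1 := by omega
  obtain ⟨hlt, hpc⟩ := hp (n - (k + 1)) (by omega)
  rw [← hk'] at hlt hpc
  refine ⟨by linarith, hpc.affine (α := -1) (β := 1) (by norm_num) ?_ ?_ ?_⟩
  · rintro s ⟨hs1, hs2⟩
    constructor <;> linarith
  · rintro s ⟨hs1, hs2⟩
    constructor <;> linarith
  · intro s _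
    rw [Path.extend_symm_apply]
    congr 1
    ring

lemma IsPiecewiseAnalytic.trans {x y z : M} {c : Path x y} {c' : Path y z}
    (h : IsPiecewiseAnalytic d c) (h' : IsPiecewiseAnalytic d c') :
    IsPiecewiseAnalytic d (c.trans c') := by
  obtain ⟨n, t, h0, h1, hp⟩ := h
  obtain ⟨m, s, g0, g1, gp⟩ := h'
  have ht1 : ∀ j, ∀ i, i + j = n → t i ≤ 1 := by
    intro j
    induction j with
    | zero => intro i hi; simp at hi; rw [hi, h1]
    | succ j ih => intro i hi; exact ((hp i (by omega)).1.le).trans (ih (i + 1) (by omega))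
  have hs0 : ∀ i, i ≤ m → 0 ≤ s i := by
    intro i
    induction i with
    | zero => intro _; rw [g0]
    | succ i ih => intro hi; exact (ih (by omega)).trans (gp i (by omega)).1.le
  refine ⟨n + m, fun k => if k ≤ n then t k / 2 else 1 / 2 + s (k - n) / 2, by simp [h0], ?_, ?_⟩
  · rcases Nat.eq_zero_or_pos m with rfl | hm
    · rw [g0] at g1
      norm_num at g1
    · have hnm : ¬ n + m ≤ n := by omega
      simp only [if_neg hnm, Nat.add_sub_cancel_left, g1]
      norm_num
  · intro k hk
    beta_reduce
    by_cases hkn : k < n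
    · obtain ⟨hlt, hpc⟩ := hp k hkn
      have hle : t (k + 1) ≤ 1 := ht1 (n - (k + 1)) _ (by omega)
      rw [if_pos hkn.le, if_pos (by omega)]
      refine ⟨by linarith, hpc.affine (α := 2) (β := 0) (by norm_num) ?_ ?_ ?_⟩
      · rintro r ⟨hs1, hs2⟩
        constructor <;> linarith
      · rintro r ⟨hs1, hs2⟩
        constructor <;> linarith
      · rintro r ⟨hs1, hs2⟩
        rw [Path.extend_trans_of_le_half _ _ (by linarith)]
        simp
    · obtain ⟨hlt, hpc⟩ := gp (k - n) (by omega)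
      have hge := hs0 (k - n) (by omega)
      have e1 : (if k ≤ n then t k / 2 else 1 / 2 + s (k - n) / 2) = 1 / 2 + s (k - n) / 2 := by
        split_ifs with hkk
        · have : k = n := by omega
          subst this
          simp [h1, g0]
        · rfl
      have e2 : k + 1 - n = k - n + 1 := by omega
      rw [e1, if_neg (by omega), e2]
      refine ⟨by linarith, hpc.affine (α := 2) (β := -1) (by norm_num) ?_ ?_ ?_⟩
      · rintro r ⟨hs1, hs2⟩
        constructor <;> linarith
      · rintro r ⟨hs1, hs2⟩
        constructor <;> linarith
      · rintro r ⟨hs1, hs2⟩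
        rw [Path.extend_trans_of_half_le _ _ (by linarith)]
        congr 1

/-- The piecewise analytic parametrized curves from `x` to `y`. -/
structure Curve (d : ℕ) {M : Type u} [TopologicalSpace M]
    [ChartedSpace (EuclideanSpace ℝ (Fin d)) M] (x y : M) where
  path : Path x y
  piecewiseAnalytic : IsPiecewiseAnalytic d path

namespace Curve

/-- The image `σ(c)` of a curve. -/
def image {x y : M} (c : Curve d x y) : Set M := range c.path

/-- The constant curve. -/
def const (d : ℕ) {M : Type u} [TopologicalSpace M]
    [ChartedSpace (EuclideanSpace ℝ (Fin d)) M] (x : M) : Curve d x x :=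
  ⟨Path.refl x, .refl x⟩

/-- The curve that runs first through `c` and then through `c'`, each at double speed. -/
noncomputable def comp {x y z : M} (c : Curve d x y) (c' : Curve d y z) : Curve d x z :=
  ⟨c.path.trans c'.path, c.piecewiseAnalytic.trans c'.piecewiseAnalytic⟩

/-- The reversed curve `t ↦ c (1 - t)`. -/
def rev {x y : M} (c : Curve d x y) : Curve d y x :=
  ⟨c.path.symm, c.piecewiseAnalytic.symm⟩

lemma ext_path {x y : M} {c c' : Curve d x y} (h : c.path = c'.path) : c = c' := by
  cases c; cases c'; congr

lemma rev_comp {x y z : M} (c : Curve d x y) (c' : Curve d y z) :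
    (c.comp c').rev = c'.rev.comp c.rev :=
  ext_path (Path.trans_symm _ _)

lemma rev_rev {x y : M} (c : Curve d x y) : c.rev.rev = c :=
  ext_path (Path.symm_symm _)

end Curve

/-- `ψ` restricts to an orientation preserving, piecewise analytic diffeomorphism of `[0,1]`: an
increasing homeomorphism which is a local analytic diffeomorphism off a finite set. -/
structure IsReparam (ψ : ℝ → ℝ) : Prop where
  zero : ψ 0 = 0
  one : ψ 1 = 1
  cont : ContinuousOn ψ (Icc 0 1)
  mono : StrictMonoOn ψ (Icc 0 1)
  analytic : ∃ F : Set ℝ, F.Finite ∧ ∀ t ∈ Ioo (0 : ℝ) 1 \ F, AnalyticAt ℝ ψ t ∧ deriv ψ t ≠ 0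

/-- Two curves with the same end points are equivalent if they coincide up to finitely many
retracings `b⁻¹ b` and a reparametrization: the smallest equivalence relation compatible with
composition of curves for which reparametrized curves are equivalent and retracings can be
removed. -/
inductive CurveEquiv {d : ℕ} {M : Type u} [TopologicalSpace M]
    [ChartedSpace (EuclideanSpace ℝ (Fin d)) M] :
    ∀ {x y : M}, Curve d x y → Curve d x y → Prop
  | refl {x y : M} (c : Curve d x y) : CurveEquiv c c
  | symm {x y : M} {c c' : Curve d x y} : CurveEquiv c c' → CurveEquiv c' c
  | trans {x y : M} {c c' c'' : Curve d x y} :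
      CurveEquiv c c' → CurveEquiv c' c'' → CurveEquiv c c''
  | comp {x y z : M} {c c' : Curve d x y} {b b' : Curve d y z} :
      CurveEquiv c c' → CurveEquiv b b' → CurveEquiv (c.comp b) (c'.comp b')
  | reparam {x y : M} (c c' : Curve d x y) (ψ : ℝ → ℝ) : IsReparam ψ →
      (∀ t ∈ Icc (0 : ℝ) 1, c'.path.extend t = c.path.extend (ψ t)) → CurveEquiv c' c
  | retrace_left {x y z : M} (b : Curve d x z) (c : Curve d x y) :
      CurveEquiv ((b.comp b.rev).comp c) c
  | retrace_right {x y z : M} (c : Curve d x y) (b : Curve d y z) :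
      CurveEquiv (c.comp (b.comp b.rev)) c

lemma IsReparam.flip {ψ : ℝ → ℝ} (h : IsReparam ψ) : IsReparam (fun t => 1 - ψ (1 - t)) := by
  have hm : ∀ t ∈ Icc (0 : ℝ) 1, 1 - t ∈ Icc (0 : ℝ) 1 := fun t ht =>
    ⟨by linarith [ht.2], by linarith [ht.1]⟩
  refine ⟨by simp [h.one], by simp [h.zero], ?_, ?_, ?_⟩
  · exact continuousOn_const.sub (h.cont.comp (by fun_prop) hm)
  · intro s hs t ht hst
    have := h.mono (hm t ht) (hm s hs) (by linarith)
    simp only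
    linarith
  · obtain ⟨F, hF, hA⟩ := h.analytic
    refine ⟨(fun t => 1 - t) '' F, hF.image _, fun t ht => ?_⟩
    obtain ⟨a1, a2⟩ := hA (1 - t) ⟨⟨by linarith [ht.1.2], by linarith [ht.1.1]⟩,
      fun hf => ht.2 ⟨1 - t, hf, by ring⟩⟩
    refine ⟨?_, ?_⟩
    · have h1 : AnalyticAt ℝ (fun t : ℝ => 1 - t) t := by fun_prop
      exact analyticAt_const.sub (AnalyticAt.comp (f := fun t : ℝ => 1 - t) a1 h1)
    · have hd : HasDerivAt (fun t : ℝ => 1 - t) (-1) t := by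
        simpa using (hasDerivAt_id t).const_sub 1
      have h2 := (a1.differentiableAt.hasDerivAt.comp t hd).const_sub 1
      have h3 : deriv (fun t => 1 - ψ (1 - t)) t = -(deriv ψ (1 - t) * -1) := h2.deriv
      rw [h3]
      simpa using a2

lemma CurveEquiv.rev {x y : M} {c c' : Curve d x y} (h : CurveEquiv c c') :
    CurveEquiv c.rev c'.rev := by
  induction h with
  | refl c => exact .refl _
  | symm _ ih => exact .symm ih
  | trans _ _ ih ih' => exact .trans ih ih'
  | comp _ _ ih ih' => rw [Curve.rev_comp, Curve.rev_comp]; exact .comp ih' ih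
  | reparam c c' ψ hψ h =>
    refine .reparam _ _ _ hψ.flip fun t ht => ?_
    simp only [Curve.rev, Path.extend_symm_apply]
    rw [h (1 - t) ⟨by linarith [ht.2], by linarith [ht.1]⟩]
    congr 1
    ring
  | retrace_left b c =>
    rw [Curve.rev_comp, Curve.rev_comp, Curve.rev_rev]; exact .retrace_right _ _
  | retrace_right c b =>
    rw [Curve.rev_comp, Curve.rev_comp, Curve.rev_rev]; exact .retrace_left _ _

lemma Curve.const_comp_rev (x : M) :
    (Curve.const d x).comp (Curve.const d x).rev = Curve.const d x :=
  Curve.ext_path (by simp [Curve.comp, Curve.rev, Curve.const])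

lemma CurveEquiv.const_comp {x y : M} (c : Curve d x y) :
    CurveEquiv ((Curve.const d x).comp c) c := by
  have := CurveEquiv.retrace_left (Curve.const d x) c
  rwa [Curve.const_comp_rev] at this

lemma CurveEquiv.comp_const {x y : M} (c : Curve d x y) :
    CurveEquiv (c.comp (Curve.const d y)) c := by
  have := CurveEquiv.retrace_right c (Curve.const d y)
  rwa [Curve.const_comp_rev] at this

lemma CurveEquiv.comp_rev {x y : M} (c : Curve d x y) :
    CurveEquiv (c.comp c.rev) (Curve.const d x) :=
  .trans (.symm (.const_comp _)) (.retrace_right _ _)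

lemma CurveEquiv.rev_comp_self {x y : M} (c : Curve d x y) :
    CurveEquiv (c.rev.comp c) (Curve.const d y) := by
  have h := CurveEquiv.comp_rev c.rev
  rwa [Curve.rev_rev] at h

lemma isReparam_assoc :
    IsReparam (fun t => if t ≤ 1 / 4 then 2 * t else if t ≤ 1 / 2 then t + 1 / 4
      else (t + 1) / 2) := by
  refine ⟨by norm_num, by norm_num, ?_, ?_, {1 / 4, 1 / 2}, by simp, ?_⟩
  · apply Continuous.continuousOn
    refine Continuous.if_le (by fun_prop) (Continuous.if_le (by fun_prop) (by fun_prop)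
      continuous_id continuous_const ?_) continuous_id continuous_const ?_
    · intro t ht; subst ht; norm_num
    · intro t ht; subst ht; norm_num
  · intro s _ t _ hst
    simp only
    split_ifs <;> linarith
  · rintro t ⟨_, htF⟩
    simp only [mem_insert_iff, mem_singleton_iff, not_or] at htF
    have key : ∀ (f : ℝ → ℝ) (m : ℝ), m ≠ 0 → AnalyticAt ℝ f t → HasDerivAt f m t →
        (fun t : ℝ => if t ≤ 1 / 4 then 2 * t else if t ≤ 1 / 2 then t + 1 / 4
          else (t + 1) / 2) =ᶠ[𝓝 t] f →
        AnalyticAt ℝ (fun t : ℝ => if t ≤ 1 / 4 then 2 * t else if t ≤ 1 / 2 then t + 1 / 4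
          else (t + 1) / 2) t ∧
        deriv (fun t : ℝ => if t ≤ 1 / 4 then 2 * t else if t ≤ 1 / 2 then t + 1 / 4
          else (t + 1) / 2) t ≠ 0 := by
      intro f m hm hf hd he
      exact ⟨hf.congr he.symm, by rw [he.deriv_eq, hd.deriv]; exact hm⟩
    rcases lt_or_gt_of_ne htF.1 with h | h
    · refine key (fun t => 2 * t) 2 (by norm_num) (by fun_prop)
        (by simpa using (hasDerivAt_id t).const_mul 2) ?_
      filter_upwards [Iio_mem_nhds h] with r hr
      rw [if_pos (le_of_lt hr)]
    · rcases lt_or_gt_of_ne htF.2 with h' | h'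
      · refine key (fun t => t + 1 / 4) 1 (by norm_num) (by fun_prop)
          (by simpa using (hasDerivAt_id t).add_const (1 / 4)) ?_
        filter_upwards [Iio_mem_nhds h', Ioi_mem_nhds h] with r hr hr'
        rw [if_neg (not_le.mpr hr'), if_pos (le_of_lt hr)]
      · refine key (fun t => (t + 1) / 2) (1 / 2) (by norm_num) (by fun_prop)
          (((hasDerivAt_id t).add_const 1).div_const 2) ?_
        filter_upwards [Ioi_mem_nhds h'] with r hr
        have hr2 : (1 : ℝ) / 2 < r := hr
        rw [if_neg (by linarith), if_neg (by linarith)]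

lemma CurveEquiv.assoc {w x y z : M} (a : Curve d w x) (b : Curve d x y) (c : Curve d y z) :
    CurveEquiv ((a.comp b).comp c) (a.comp (b.comp c)) := by
  refine .reparam _ _ _ isReparam_assoc fun t _ => ?_
  simp only [Curve.comp]
  split_ifs with h1 h2
  · rw [Path.extend_trans_of_le_half _ _ (by linarith),
      Path.extend_trans_of_le_half _ _ (by linarith),
      Path.extend_trans_of_le_half _ _ (by linarith)]
  · rw [Path.extend_trans_of_le_half _ _ (by linarith),
      Path.extend_trans_of_half_le _ _ (by linarith),
      Path.extend_trans_of_half_le _ _ (by linarith),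
      Path.extend_trans_of_le_half _ _ (by linarith)]
    congr 1
    ring
  · rw [Path.extend_trans_of_half_le _ _ (by linarith),
      Path.extend_trans_of_half_le _ _ (by linarith),
      Path.extend_trans_of_half_le _ _ (by linarith)]
    congr 1
    ring

/-- Equivalence of curves as a setoid. -/
def curveSetoid (d : ℕ) {M : Type u} [TopologicalSpace M]
    [ChartedSpace (EuclideanSpace ℝ (Fin d)) M] (x y : M) : Setoid (Curve d x y) :=
  ⟨CurveEquiv, .refl, .symm, .trans⟩

end Curves

/-! ### The groupoid of paths -/

/-- The objects of the groupoid of paths: the points of the manifold. -/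
def PathGroupoid (_d : ℕ) (M : Type u) : Type u := M

section Groupoids

variable {d : ℕ} {M : Type u} [TopologicalSpace M] [ChartedSpace (EuclideanSpace ℝ (Fin d)) M]

/-- Arrows are equivalence classes of curves; `p ≫ q` is `p` followed by `q`. -/
noncomputable instance instGroupoid : Groupoid (PathGroupoid d M) where
  Hom x y := _root_.Quotient (curveSetoid d (M := M) x y)
  id x := _root_.Quotient.mk _ (Curve.const d (M := M) x)
  comp := _root_.Quotient.map₂ Curve.comp fun _ _ h _ _ h' => CurveEquiv.comp h h'
  inv := _root_.Quotient.map Curve.rev fun _ _ h => CurveEquiv.rev h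
  id_comp := by rintro x y ⟨c⟩; exact _root_.Quotient.sound (CurveEquiv.const_comp c)
  comp_id := by rintro x y ⟨c⟩; exact _root_.Quotient.sound (CurveEquiv.comp_const c)
  assoc := by rintro w x y z ⟨a⟩ ⟨b⟩ ⟨c⟩; exact _root_.Quotient.sound (CurveEquiv.assoc a b c)
  inv_comp := by
    rintro x y ⟨c⟩
    exact _root_.Quotient.sound (CurveEquiv.rev_comp_self c)
  comp_inv := by rintro x y ⟨c⟩; exact _root_.Quotient.sound (CurveEquiv.comp_rev c)

/-- The class of a curve. -/
noncomputable def Curve.toHom {x y : M} (c : Curve d x y) : @Quiver.Hom (PathGroupoid d M) _ x y :=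
  _root_.Quotient.mk (curveSetoid d x y) c

/-- Curves that are analytic on all of `[0,1]` and embed `(0,1)`. -/
def Curve.IsAnalytic {x y : M} (c : Curve d x y) : Prop :=
  IsRegularPiece d c.path.extend 0 1

/-- An edge: an arrow of the groupoid of paths which is the class of an analytic curve. -/
structure Edge (d : ℕ) (M : Type u) [TopologicalSpace M]
    [ChartedSpace (EuclideanSpace ℝ (Fin d)) M] where
  src : PathGroupoid d M
  tgt : PathGroupoid d M
  hom : src ⟶ tgt
  isEdge : ∃ c : Curve d (M := M) src tgt, c.IsAnalytic ∧ c.toHom = hom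

/-- The image `σ(e)` of an edge: the points on the analytic curves in its class (which all have
the same image). -/
def Edge.image (e : Edge d M) : Set M :=
  {z | ∃ c : Curve d (M := M) e.src e.tgt, c.IsAnalytic ∧ c.toHom = e.hom ∧ z ∈ c.image}

/-- Edges are independent if they meet each other only at their end points. -/
def Independent {n : ℕ} (e : Fin n → Edge d M) : Prop :=
  ∀ i j, i ≠ j → (e i).image ∩ (e j).image ⊆ {((e i).src : M), ((e i).tgt : M)}

/-- The smallest subgroupoid containing the given edges. -/
noncomputable def generated {n : ℕ} (e : Fin n → Edge d M) : Subgroupoid (PathGroupoid d M) :=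
  sInf {L | ∀ i, (e i).hom ∈ L.arrows (e i).src (e i).tgt}

/-- `e` is an (ordered) independent set of edges that generates `L`. -/
structure IsGeneratedBy (L : Subgroupoid (PathGroupoid d M)) {n : ℕ} (e : Fin n → Edge d M) :
    Prop where
  independent : Independent e
  eq_generated : L = generated e

lemma IsGeneratedBy.mem {L : Subgroupoid (PathGroupoid d M)} {n : ℕ} {e : Fin n → Edge d M}
    (h : IsGeneratedBy L e) (i : Fin n) : (e i).hom ∈ L.arrows (e i).src (e i).tgt := by
  rw [h.eq_generated, generated, Subgroupoid.mem_sInf_arrows]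
  exact fun S hS => hS i

/-- The tame subgroupoids, ordered by inclusion. -/
abbrev Tame (d : ℕ) (M : Type u) [TopologicalSpace M]
    [ChartedSpace (EuclideanSpace ℝ (Fin d)) M] : Type u :=
  {L : Subgroupoid (PathGroupoid d M) // ∃ (n : ℕ) (e : Fin n → Edge d M), IsGeneratedBy L e}

end Groupoids

/-! ### Spaces of morphisms into the gauge group -/

section Morphisms

/-- `Hom[C, G]`: the functors from the groupoid `C` to the group `G`, i.e. the maps `A` from
arrows to `G` with `A (p ≫ q) = A q * A p` and `A (p⁻¹) = (A p)⁻¹`. -/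
def HomTo (C : Type u) [Groupoid.{u} C] (G : Type v) [Group G] := C ⥤ SingleObj G

variable {C : Type u} [Groupoid.{u} C] {D : Type u} [Groupoid.{u} D] {G : Type v} [Group G]

/-- The value of a morphism on an arrow. -/
def HomTo.eval (A : HomTo C G) {x y : C} (p : x ⟶ y) : G := CategoryTheory.Functor.map A p

/-- The pull-back of a morphism along a functor. -/
def HomTo.pull (F : D ⥤ C) (A : HomTo C G) : HomTo D G := CategoryTheory.Functor.comp F A

/-- The weakest topology that makes all evaluations continuous. -/
instance HomTo.instTopologicalSpace [TopologicalSpace G] : TopologicalSpace (HomTo C G) :=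
  ⨅ (x : C) (y : C) (p : x ⟶ y), TopologicalSpace.induced (fun A => A.eval p) inferInstance

instance HomTo.instMeasurableSpace [TopologicalSpace G] : MeasurableSpace (HomTo C G) := borel _

instance HomTo.instBorelSpace [TopologicalSpace G] : BorelSpace (HomTo C G) := ⟨rfl⟩

instance HomTo.instInhabited : Inhabited (HomTo C G) := ⟨(CategoryTheory.Functor.const C).obj (SingleObj.star G)⟩

/-- The gauge transform `A_g (p) = g (r p) * A p * (g (s p))⁻¹`. -/
def HomTo.gauge (g : C → G) (A : HomTo C G) : HomTo C G :=
  { obj := fun _ => SingleObj.star G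
    map := fun {x y} p => (g y * A.eval p * (g x)⁻¹ : G)
    map_id := fun x => by
      have h : A.eval (𝟙 x) = 1 := CategoryTheory.Functor.map_id A x
      change g x * A.eval (𝟙 x) * (g x)⁻¹ = 1
      rw [h]; group
    map_comp := fun {x y z} p q => by
      have h : A.eval (p ≫ q) = A.eval q * A.eval p := CategoryTheory.Functor.map_comp A p q
      change g z * A.eval (p ≫ q) * (g x)⁻¹ =
        (g z * A.eval q * (g y)⁻¹) * (g y * A.eval p * (g x)⁻¹)
      rw [h]; group : C ⥤ SingleObj G }

/-- The restriction `p_L` of morphisms to a subgroupoid `L`. -/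
def restr (G : Type v) [Group G] (L : Subgroupoid C) (A : HomTo C G) : HomTo L.objs G :=
  HomTo.pull L.hom A

/-- The restriction `p_{L,L'}` of morphisms on `L'` to a subgroupoid `L` of `L'`. -/
def restrOfLE (G : Type v) [Group G] {L L' : Subgroupoid C} (h : L ≤ L') (A : HomTo L'.objs G) :
    HomTo L.objs G :=
  HomTo.pull (Subgroupoid.inclusion h) A

end Morphisms

section Measures

variable {d : ℕ} {M : Type u} [TopologicalSpace M] [ChartedSpace (EuclideanSpace ℝ (Fin d)) M]
  {G : Type v} [Group G]

/-- The map `ρ_{e_1,…,e_n} : Hom[L, G] → Gⁿ`, `A ↦ (A(e_1), …, A(e_n))`. -/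
noncomputable def rho (G : Type v) [Group G] {L : Subgroupoid (PathGroupoid d M)} {n : ℕ}
    {e : Fin n → Edge d M} (h : IsGeneratedBy L e) (A : HomTo L.objs G) : Fin n → G :=
  fun i => HomTo.eval A (x := ⟨(e i).src, L.mem_objs_of_src (h.mem i)⟩)
    (y := ⟨(e i).tgt, L.mem_objs_of_tgt (h.mem i)⟩) ⟨(e i).hom, h.mem i⟩

/-- The Haar measure of a compact group, normalized to total mass one. -/
noncomputable def haar (G : Type v) [Group G] [TopologicalSpace G] [IsTopologicalGroup G]
    [CompactSpace G] [MeasurableSpace G] [BorelSpace G] : Measure G :=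
  Measure.haarMeasure ⊤

/-- The push-forward of the product Haar measure on `Gⁿ` to `Hom[L, G]` by the inverse of
`ρ_{e_1,…,e_n}`. -/
noncomputable def haarPush (G : Type v) [Group G] [TopologicalSpace G] [IsTopologicalGroup G]
    [CompactSpace G] [MeasurableSpace G] [BorelSpace G] {L : Subgroupoid (PathGroupoid d M)}
    {n : ℕ} {e : Fin n → Edge d M} (h : IsGeneratedBy L e) : Measure (HomTo L.objs G) :=
  Measure.map (Function.invFun (rho G h)) (Measure.pi fun _ : Fin n => haar G)

end Measures

/-! ### The action of analytic diffeomorphisms -/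

section Diffeomorphisms

variable {d : ℕ} {M : Type u} [TopologicalSpace M] [ChartedSpace (EuclideanSpace ℝ (Fin d)) M]

lemma IsPiece.diffeo {γ : ℝ → M} {a b : ℝ} (φ : M ≃ₘ^ω⟮𝓡 d, 𝓡 d⟯ M) (h : IsPiece d γ a b) :
    IsPiece d (φ ∘ γ) a b := by
  rcases h with h | h
  · left
    refine ⟨φ.contMDiff.comp_contMDiffOn h.analytic, ?_, ?_⟩
    · intro t ht h0
      have hd : MDifferentiableAt 𝓘(ℝ, ℝ) (𝓡 d) γ t :=
        (h.analytic.contMDiffAt (Icc_mem_nhds ht.1 ht.2)).mdifferentiableAt (by simp)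
      have hφ : MDifferentiableAt (𝓡 d) (𝓡 d) φ (γ t) :=
        φ.contMDiff.contMDiffAt.mdifferentiableAt (by simp)
      rw [mfderiv_comp t hφ hd] at h0
      apply h.immersion t ht
      refine ContinuousLinearMap.ext fun v => ?_
      have h1 := congrArg (fun L => L v) h0
      have h2 : (φ.mfderivToContinuousLinearEquiv (by simp) (γ t))
          (mfderiv 𝓘(ℝ, ℝ) (𝓡 d) γ t v) = 0 := h1
      exact (ContinuousLinearEquiv.map_eq_zero_iff _).mp h2
    · exact φ.toHomeomorph.isEmbedding.comp h.embedding
  · right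
    intro t ht
    simp [h t ht]

/-- The image of a curve under an analytic diffeomorphism. -/
noncomputable def Curve.map (φ : M ≃ₘ^ω⟮𝓡 d, 𝓡 d⟯ M) {x y : M} (c : Curve d x y) : Curve d (φ x) (φ y) :=
  ⟨c.path.map φ.continuous, by
    obtain ⟨n, t, h0, h1, hp⟩ := c.piecewiseAnalytic
    exact ⟨n, t, h0, h1, fun k hk => ⟨(hp k hk).1, (hp k hk).2.diffeo φ⟩⟩⟩

lemma Curve.map_comp (φ : M ≃ₘ^ω⟮𝓡 d, 𝓡 d⟯ M) {x y z : M} (c : Curve d x y) (b : Curve d y z) :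
    (c.comp b).map φ = (c.map φ).comp (b.map φ) :=
  Curve.ext_path (Path.map_trans _ _ φ.continuous)

lemma Curve.map_rev (φ : M ≃ₘ^ω⟮𝓡 d, 𝓡 d⟯ M) {x y : M} (c : Curve d x y) :
    c.rev.map φ = (c.map φ).rev :=
  Curve.ext_path (Path.map_symm _ φ.continuous)

lemma CurveEquiv.map (φ : M ≃ₘ^ω⟮𝓡 d, 𝓡 d⟯ M) {x y : M} {c c' : Curve d x y}
    (h : CurveEquiv c c') : CurveEquiv (c.map φ) (c'.map φ) := by
  induction h with
  | refl c => exact .refl _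
  | symm _ ih => exact .symm ih
  | trans _ _ ih ih' => exact .trans ih ih'
  | comp _ _ ih ih' => rw [Curve.map_comp, Curve.map_comp]; exact .comp ih ih'
  | reparam c c' ψ hψ h =>
    exact .reparam _ _ ψ hψ fun t ht => congrArg φ (h t ht)
  | retrace_left b c =>
    rw [Curve.map_comp, Curve.map_comp, Curve.map_rev]; exact .retrace_left _ _
  | retrace_right c b =>
    rw [Curve.map_comp, Curve.map_comp, Curve.map_rev]; exact .retrace_right _ _

/-- The automorphism of the groupoid of paths induced by an analytic diffeomorphism. -/
noncomputable def diffeoFunctor (φ : M ≃ₘ^ω⟮𝓡 d, 𝓡 d⟯ M) : PathGroupoid d M ⥤ PathGroupoid d M where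
  obj x := φ (x : M)
  map := _root_.Quotient.map (Curve.map φ) fun _ _ h => CurveEquiv.map φ h
  map_id _ := rfl
  map_comp := by
    rintro x y z ⟨c⟩ ⟨b⟩
    exact congrArg (_root_.Quotient.mk _) (Curve.map_comp φ c b)

/-- The action `(φ A)(p) = A (φ⁻¹ p)` of analytic diffeomorphisms on generalized connections. -/
noncomputable def diffeoAct {G : Type v} [Group G] (φ : M ≃ₘ^ω⟮𝓡 d, 𝓡 d⟯ M) (A : HomTo (PathGroupoid d M) G) :
    HomTo (PathGroupoid d M) G :=
  HomTo.pull (diffeoFunctor φ.symm) A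

end Diffeomorphisms

end GenConn

open GenConn

/-! The core is a supply of functors on the whole path groupoid with prescribed values on
independent edges. Fix finitely many points, each with a direction of departure and a group element
`g i`. A curve collects `g i` whenever it leaves the `i`-th point in the `i`-th direction and `(g
i)⁻¹` whenever it arrives along that direction. The time-ordered product of these factors
(`Directions.hol`) is multiplicative under concatenation, is inverted by reversal and ignores
reparametrization, so it descends to a functor (`Directions.jumpHom`). With the midpoints of
independent edges as points and the forward directions there, the functor takes the value `g i` on
the `i`-th edge (`Independent.eval_sec`). This makes `rho` surjective. It is injective because the
edges generate, and its inverse `g ↦ restr G L (h.sec g)` is continuous.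

Consistency needs no decomposition of edges into smaller ones. Let independent edges `e` lie in the
groupoid generated by independent edges `e'`, and let `g` be Haar distributed on the values at `e'`.
Jumps at the targets of the `e i` multiply the value on `e i` by `f i` from the left. On the
generators `e'` they only produce translations `g ↦ b * g * a` with `a`, `b` independent of `g`
(`Independent.exists_shift`). Haar measure is invariant under such translations, so the law of the
values on `e` is left invariant, hence is Haar measure by uniqueness (`map_evalEdges_sec`). Equal
groupoids give the independence of the generators, nested ones the consistency.

Analyticity enters through directedness (`exists_independent_generating`): finitely many edges
always lie in a groupoid with finitely many independent generators. One-sided analytic branches that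
meet arbitrarily near their starting point coincide (`exists_reparam_of_frequently_meet`), so
finitely many cuts decompose the edges into segments whose open images are equal or disjoint.
Segments with equal open images agree up to reparametrization and orientation.

The measure `μ₀` is a regularized ultrafilter limit of the laws of `sec` along growing finite sets
of edges, on a compact Hausdorff space. Its marginals condition is the same as having product Haar
laws on all independent families (`HasHaarLaws`). Functions of finitely many edge values are dense
by Stone-Weierstrass and have integrals fixed by these laws, which gives uniqueness. Diffeomorphisms
permute independent families and gauge transformations translate edge values on both sides, so both
preserve the laws, and invariance follows from uniqueness. -/

namespace GenConn

universe u v w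

/-! ### Ordered products over finite sets of times -/

section OrderedProducts

variable {G : Type v} [Group G]

/-- The product of `f` over a finite set of times, later times standing on the left. -/
noncomputable def oprod (s : Finset ℝ) (f : ℝ → G) : G := ((s.sort (· ≥ ·)).map f).prod

@[simp] lemma oprod_empty (f : ℝ → G) : oprod ∅ f = 1 := by simp [oprod]

@[simp] lemma oprod_singleton (a : ℝ) (f : ℝ → G) : oprod {a} f = f a := by simp [oprod]

lemma oprod_insert_max {s : Finset ℝ} {a : ℝ} (h : ∀ x ∈ s, x < a) (f : ℝ → G) :
    oprod (insert a s) f = f a * oprod s f := by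
  rw [oprod, Finset.sort_insert (r := (· ≥ ·)) (fun b hb => (h b hb).le)
    (fun ha => lt_irrefl _ (h a ha))]
  simp [oprod]

lemma oprod_congr {s : Finset ℝ} {f f' : ℝ → G} (h : ∀ t ∈ s, f t = f' t) :
    oprod s f = oprod s f' := by
  rw [oprod, oprod, List.map_congr_left fun t ht => h t ((Finset.mem_sort _).1 ht)]

/-- Trivial factors may be dropped, so products over different finite sets of times can be compared
on a common superset. -/
lemma oprod_eq_of_subset {s t : Finset ℝ} {f : ℝ → G} (hst : s ⊆ t)
    (h : ∀ x ∈ t, x ∉ s → f x = 1) : oprod t f = oprod s f := by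
  induction t using Finset.induction_on_max generalizing s with
  | empty => rw [Finset.subset_empty.1 hst]
  | insert a t hmax ih =>
    rw [oprod_insert_max hmax]
    by_cases ha : a ∈ s
    · have hs : s.erase a ⊆ t := fun x hx =>
        (Finset.mem_insert.1 (hst (Finset.mem_of_mem_erase hx))).resolve_left
          (Finset.ne_of_mem_erase hx)
      conv_rhs => rw [← Finset.insert_erase ha]
      rw [oprod_insert_max (fun x hx => hmax x (hs hx)), ih hs]
      intro x hx hxs
      refine h x (Finset.mem_insert_of_mem hx) fun hx' => hxs ?_
      exact Finset.mem_erase.2 ⟨(hmax x hx).ne, hx'⟩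
    · rw [h a (Finset.mem_insert_self _ _) ha, one_mul]
      refine ih (fun x hx => (Finset.mem_insert.1 (hst hx)).resolve_left ?_)
        fun x hx => h x (Finset.mem_insert_of_mem hx)
      rintro rfl
      exact ha hx

lemma oprod_union {s t : Finset ℝ} (h : ∀ x ∈ s, ∀ y ∈ t, y < x) (f : ℝ → G) :
    oprod (s ∪ t) f = oprod s f * oprod t f := by
  induction s using Finset.induction_on_max with
  | empty => simp
  | insert a s hmax ih =>
    rw [Finset.insert_union, oprod_insert_max, oprod_insert_max hmax, ih, mul_assoc]
    · exact fun x hx => h x (Finset.mem_insert_of_mem hx)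
    · intro x hx
      rcases Finset.mem_union.1 hx with hx | hx
      · exact hmax x hx
      · exact h a (Finset.mem_insert_self _ _) x hx

lemma oprod_insert_min {s : Finset ℝ} {a : ℝ} (h : ∀ x ∈ s, a < x) (f : ℝ → G) :
    oprod (insert a s) f = oprod s f * f a := by
  rw [Finset.insert_eq, Finset.union_comm, oprod_union (by simpa using h), oprod_singleton]

lemma oprod_image {ψ : ℝ → ℝ} (hψ : StrictMono ψ) (s : Finset ℝ) (f : ℝ → G) :
    oprod (s.image ψ) f = oprod s (fun t => f (ψ t)) := by
  induction s using Finset.induction_on_max with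
  | empty => simp
  | insert a s hmax ih =>
    rw [Finset.image_insert, oprod_insert_max hmax, oprod_insert_max, ih]
    intro x hx
    obtain ⟨y, hy, rfl⟩ := Finset.mem_image.1 hx
    exact hψ (hmax y hy)

/-- Reversing time reverses the order of the factors, as inversion of a product does. -/
lemma oprod_image_of_strictAnti {ψ : ℝ → ℝ} (hψ : StrictAnti ψ) (s : Finset ℝ) (f : ℝ → G) :
    oprod (s.image ψ) f = (oprod s (fun t => (f (ψ t))⁻¹))⁻¹ := by
  induction s using Finset.induction_on_max with
  | empty => simp
  | insert a s hmax ih =>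
    rw [Finset.image_insert, oprod_insert_max hmax, oprod_insert_min, ih]
    · simp
    · intro x hx
      obtain ⟨y, hy, rfl⟩ := Finset.mem_image.1 hx
      exact hψ (hmax y hy)

lemma continuous_oprod [TopologicalSpace G] [ContinuousMul G] {X : Type*} [TopologicalSpace X]
    (s : Finset ℝ) {f : X → ℝ → G} (hf : ∀ t, Continuous fun x => f x t) :
    Continuous fun x => oprod s (f x) := by
  unfold oprod
  exact continuous_list_prod _ fun t _ => hf t

end OrderedProducts

/-! ### Holonomies that jump where a curve leaves or reaches a point in a given direction -/

/-- A family of points, each with a set that serves to recognize the curves which leave the point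
in a certain direction. -/
structure Directions (ι : Type w) (S : Type u) where
  pt : ι → S
  nb : ι → Set S
  pt_notMem : ∀ i, pt i ∉ nb i
  disj : ∀ i j, i ≠ j → pt i ≠ pt j ∨ Disjoint (nb i) (nb j)

namespace Directions

variable {ι : Type w} {S : Type u} {G : Type v} [Group G] (D : Directions ι S)

/-- The germ `F` of a curve at `p` has the direction with index `i`. -/
def Leaves (i : ι) (p : S) (F : Filter S) : Prop := p = D.pt i ∧ D.nb i ∈ F

open Classical in
/-- The group element attached to a germ. -/
noncomputable def val (g : ι → G) (p : S) (F : Filter S) : G :=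
  if h : ∃ i, D.Leaves i p F then g h.choose else 1

variable {D}

lemma Leaves.unique {i j : ι} {p : S} {F : Filter S} [F.NeBot] (hi : D.Leaves i p F)
    (hj : D.Leaves j p F) : i = j := by
  by_contra hij
  rcases D.disj i j hij with h | h
  · exact h (hi.1.symm.trans hj.1)
  · obtain ⟨x, hx1, hx2⟩ := Filter.nonempty_of_mem (Filter.inter_mem hi.2 hj.2)
    exact Set.disjoint_left.1 h hx1 hx2

lemma val_eq {i : ι} {p : S} {F : Filter S} [F.NeBot] (hi : D.Leaves i p F) (g : ι → G) :
    D.val g p F = g i := by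
  have h : ∃ i, D.Leaves i p F := ⟨i, hi⟩
  rw [val, dif_pos h, h.choose_spec.unique hi]

lemma val_eq_one {p : S} {F : Filter S} (h : ∀ i, ¬ D.Leaves i p F) (g : ι → G) :
    D.val g p F = 1 := by
  rw [val, dif_neg (by simpa using h)]

/-- A resting curve stays at a point that its own recognizing set omits, so constant pieces collect
no factors. -/
lemma not_leaves_of_const {γ : ℝ → S} {t : ℝ} {F : Filter ℝ} [F.NeBot]
    (h : ∀ᶠ s in F, γ s = γ t) (i : ι) : ¬ D.Leaves i (γ t) (F.map γ) := by
  rintro ⟨h1, h2⟩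
  obtain ⟨s, hs1, hs2⟩ := (h.and h2).exists
  rw [hs1, h1] at hs2
  exact D.pt_notMem i hs2

variable (D)

/-- The group element attached to the germ of `γ` in the direction of the future. -/
noncomputable def out (g : ι → G) (γ : ℝ → S) (t : ℝ) : G := D.val g (γ t) ((𝓝[>] t).map γ)

/-- The group element attached to the germ of `γ` in the direction of the past. -/
noncomputable def into (g : ι → G) (γ : ℝ → S) (t : ℝ) : G := D.val g (γ t) ((𝓝[<] t).map γ)

/-- The factor that a curve picks up at the time `t`. -/
noncomputable def jump (g : ι → G) (γ : ℝ → S) (t : ℝ) : G := D.out g γ t * (D.into g γ t)⁻¹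

/-- The times at which a curve may pick up a factor. -/
def active (γ : ℝ → S) : Set ℝ :=
  {t | ∃ i, D.Leaves i (γ t) ((𝓝[>] t).map γ) ∨ D.Leaves i (γ t) ((𝓝[<] t).map γ)}

open Classical in
/-- The ordered product of all factors that a curve picks up. -/
noncomputable def hol (g : ι → G) (γ : ℝ → S) : G :=
  if h : (D.active γ).Finite then oprod h.toFinset (D.jump g γ) else 1

variable {D}

lemma jump_eq_one {γ : ℝ → S} {t : ℝ} (h : t ∉ D.active γ) (g : ι → G) : D.jump g γ t = 1 := by
  have h' : ∀ i, ¬ (D.Leaves i (γ t) ((𝓝[>] t).map γ) ∨ D.Leaves i (γ t) ((𝓝[<] t).map γ)) :=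
    fun i hi => h ⟨i, hi⟩
  rw [jump, out, into, val_eq_one fun i hi => h' i (.inl hi),
    val_eq_one fun i hi => h' i (.inr hi)]
  simp

/-- Removes the case distinction in `hol`: any finite set that contains the active times may serve
as index set. -/
lemma hol_eq {γ : ℝ → S} {s : Finset ℝ} (h : D.active γ ⊆ s) (g : ι → G) :
    D.hol g γ = oprod s (D.jump g γ) := by
  have hf : (D.active γ).Finite := s.finite_toSet.subset h
  rw [hol, dif_pos hf]
  refine (oprod_eq_of_subset (fun x hx => h (by simpa using hx)) fun x _ hx => ?_).symm
  exact jump_eq_one (by simpa using hx) g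

lemma germ_congr {γ γ' : ℝ → S} {t : ℝ} {F : Filter ℝ} (h : γ =ᶠ[𝓝 t] γ') (hF : F ≤ 𝓝 t) :
    F.map γ = F.map γ' :=
  Filter.map_congr (hF h)

lemma jump_congr {γ γ' : ℝ → S} {t : ℝ} (h : γ =ᶠ[𝓝 t] γ') (g : ι → G) :
    D.jump g γ t = D.jump g γ' t := by
  rw [jump, jump, out, out, into, into, germ_congr h nhdsWithin_le_nhds,
    germ_congr h nhdsWithin_le_nhds, h.self_of_nhds]

lemma active_congr {γ γ' : ℝ → S} {t : ℝ} (h : γ =ᶠ[𝓝 t] γ') :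
    t ∈ D.active γ ↔ t ∈ D.active γ' := by
  simp only [active, Set.mem_ofPred_eq, germ_congr h nhdsWithin_le_nhds,
    h.self_of_nhds]

lemma map_orderIso_nhdsGT (e : ℝ ≃o ℝ) (t : ℝ) : (𝓝[>] t).map e = 𝓝[>] (e t) := by
  have := e.toHomeomorph.isEmbedding.map_nhdsWithin_eq (Ioi t) t
  simpa using this

lemma map_orderIso_nhdsLT (e : ℝ ≃o ℝ) (t : ℝ) : (𝓝[<] t).map e = 𝓝[<] (e t) := by
  have := e.toHomeomorph.isEmbedding.map_nhdsWithin_eq (Iio t) t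
  simpa using this

lemma out_comp (γ : ℝ → S) (e : ℝ ≃o ℝ) (t : ℝ) (g : ι → G) :
    D.out g (γ ∘ e) t = D.out g γ (e t) := by
  rw [out, out, ← Filter.map_map, map_orderIso_nhdsGT, Function.comp]

lemma into_comp (γ : ℝ → S) (e : ℝ ≃o ℝ) (t : ℝ) (g : ι → G) :
    D.into g (γ ∘ e) t = D.into g γ (e t) := by
  rw [into, into, ← Filter.map_map, map_orderIso_nhdsLT, Function.comp]

lemma jump_comp (γ : ℝ → S) (e : ℝ ≃o ℝ) (t : ℝ) (g : ι → G) :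
    D.jump g (γ ∘ e) t = D.jump g γ (e t) := by
  rw [jump, jump, out_comp, into_comp]

lemma active_comp (γ : ℝ → S) (e : ℝ ≃o ℝ) (t : ℝ) :
    t ∈ D.active (γ ∘ e) ↔ e t ∈ D.active γ := by
  simp only [active, Set.mem_ofPred_eq, ← Filter.map_map, map_orderIso_nhdsGT,
    map_orderIso_nhdsLT, Function.comp]

lemma map_sub_nhdsGT (t : ℝ) : (𝓝[>] t).map (fun s => 1 - s) = 𝓝[<] (1 - t) := by
  simp

lemma map_sub_nhdsLT (t : ℝ) : (𝓝[<] t).map (fun s => 1 - s) = 𝓝[>] (1 - t) := by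
  simp

lemma jump_rev (γ : ℝ → S) (t : ℝ) (g : ι → G) :
    D.jump g (γ ∘ fun s => 1 - s) t = (D.jump g γ (1 - t))⁻¹ := by
  rw [jump, jump, out, out, into, into, ← Filter.map_map, ← Filter.map_map, map_sub_nhdsLT,
    map_sub_nhdsGT]
  simp

lemma active_rev (γ : ℝ → S) (t : ℝ) :
    t ∈ D.active (γ ∘ fun s => 1 - s) ↔ 1 - t ∈ D.active γ := by
  simp only [active, Set.mem_ofPred_eq, ← Filter.map_map, map_sub_nhdsGT,
    map_sub_nhdsLT, Function.comp, or_comm]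

lemma hol_comp (γ : ℝ → S) (e : ℝ ≃o ℝ) (hf : (D.active γ).Finite) (g : ι → G) :
    D.hol g (γ ∘ e) = D.hol g γ := by
  have h1 : D.active (γ ∘ e) ⊆ (hf.toFinset.image e.symm : Finset ℝ) := by
    intro t ht
    rw [active_comp] at ht
    simpa using ⟨e t, ht, by simp⟩
  rw [hol_eq h1, hol_eq (s := hf.toFinset) (by simp), oprod_image e.symm.strictMono]
  exact oprod_congr fun t _ => by rw [jump_comp]; simp

lemma hol_rev (γ : ℝ → S) (hf : (D.active γ).Finite) (g : ι → G) :
    D.hol g (γ ∘ fun s => 1 - s) = (D.hol g γ)⁻¹ := by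
  have h1 : D.active (γ ∘ fun s => 1 - s) ⊆
      (hf.toFinset.image (fun s => 1 - s) : Finset ℝ) := by
    intro t ht
    rw [active_rev] at ht
    simpa using ⟨1 - t, ht, by simp⟩
  rw [hol_eq h1, hol_eq (s := hf.toFinset) (by simp),
    oprod_image_of_strictAnti (fun a b h => by simpa using h)]
  congr 1
  exact oprod_congr fun t _ => by rw [jump_rev]; simp

lemma active_subset_Icc {γ : ℝ → S} (h0 : ∀ t ≤ 0, γ t = γ 0) (h1 : ∀ t, 1 ≤ t → γ t = γ 1) :
    D.active γ ⊆ Icc 0 1 := by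
  rintro t ⟨i, ht⟩
  by_contra hc
  have hev : ∀ᶠ s in 𝓝 t, γ s = γ t := by
    rcases not_and_or.1 hc with hc | hc
    · filter_upwards [Iio_mem_nhds (not_le.1 hc)] with s hs
      rw [h0 s (le_of_lt hs), h0 t (not_le.1 hc).le]
    · filter_upwards [Ioi_mem_nhds (not_le.1 hc)] with s hs
      rw [h1 s (le_of_lt hs), h1 t (not_le.1 hc).le]
  rcases ht with ht | ht
  · exact not_leaves_of_const (hev.filter_mono nhdsWithin_le_nhds) i ht
  · exact not_leaves_of_const (hev.filter_mono nhdsWithin_le_nhds) i ht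

lemma into_zero {γ : ℝ → S} (h0 : ∀ t ≤ 0, γ t = γ 0) (g : ι → G) : D.into g γ 0 = 1 :=
  val_eq_one (fun i => not_leaves_of_const (by
    filter_upwards [self_mem_nhdsWithin] with s hs using h0 s (le_of_lt hs)) i) g

lemma out_one {γ : ℝ → S} (h1 : ∀ t, 1 ≤ t → γ t = γ 1) (g : ι → G) : D.out g γ 1 = 1 :=
  val_eq_one (fun i => not_leaves_of_const (by
    filter_upwards [self_mem_nhdsWithin] with s hs using h1 s (le_of_lt hs)) i) g

/-- The active times of `Γ` are those of `γ` squeezed into the first half and those of `γ'` squeezed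
into the second half; only the junction `1 / 2` needs a separate argument. -/
lemma hol_trans {γ γ' Γ : ℝ → S} (hf : (D.active γ).Finite) (hf' : (D.active γ').Finite)
    (h1 : ∀ t ≤ 1 / 2, Γ t = γ (2 * t)) (h2 : ∀ t, 1 / 2 ≤ t → Γ t = γ' (2 * t - 1))
    (hγ0 : ∀ t ≤ 0, γ t = γ 0) (hγ1 : ∀ t, 1 ≤ t → γ t = γ 1)
    (hγ'0 : ∀ t ≤ 0, γ' t = γ' 0) (hγ'1 : ∀ t, 1 ≤ t → γ' t = γ' 1) (g : ι → G) :
    D.hol g Γ = D.hol g γ' * D.hol g γ := by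
  let e : ℝ ≃o ℝ := OrderIso.mulLeft₀ 2 (by norm_num)
  let e' : ℝ ≃o ℝ := e.trans (OrderIso.addRight (-1))
  have he : ∀ t, e t = 2 * t := fun t => rfl
  have he' : ∀ t, e' t = 2 * t - 1 := fun t => by simp [e', he, sub_eq_add_neg]
  have g1 : ∀ t < 1 / 2, Γ =ᶠ[𝓝 t] γ ∘ e := fun t ht => by
    filter_upwards [Iio_mem_nhds ht] with s hs using h1 s (le_of_lt hs)
  have g2 : ∀ t > 1 / 2, Γ =ᶠ[𝓝 t] γ' ∘ e' := fun t ht => by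
    filter_upwards [Ioi_mem_nhds ht] with s hs
    rw [h2 s (le_of_lt hs), Function.comp, he']
  -- At the junction `Γ` arrives like `γ` at `1` and departs like `γ'` at `0`. The two missing
  -- germs, of `γ` after `1` and of `γ'` before `0`, are constant and contribute `1`.
  have g3 : D.jump g Γ (1 / 2) = D.jump g γ' 0 * D.jump g γ 1 := by
    have a1 : D.out g Γ (1 / 2) = D.out g γ' 0 := by
      have : D.out g Γ (1 / 2) = D.out g (γ' ∘ e') (1 / 2) := by
        rw [out, out, h2 _ le_rfl, Function.comp, he']
        congr 1
        apply Filter.map_congr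
        filter_upwards [self_mem_nhdsWithin] with s hs
        rw [h2 s (le_of_lt hs), Function.comp, he']
      rw [this, out_comp, he']; norm_num
    have a2 : D.into g Γ (1 / 2) = D.into g γ 1 := by
      have : D.into g Γ (1 / 2) = D.into g (γ ∘ e) (1 / 2) := by
        rw [into, into, h1 _ le_rfl, Function.comp, he]
        congr 1
        apply Filter.map_congr
        filter_upwards [self_mem_nhdsWithin] with s hs
        rw [h1 s (le_of_lt hs), Function.comp, he]
      rw [this, into_comp, he]; norm_num
    rw [jump, a1, a2, jump, jump, into_zero hγ'0, out_one hγ1]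
    simp
  let s := hf.toFinset
  let s' := hf'.toFinset
  let A := (s.filter (· < 1)).image e.symm
  let B := (s'.filter (0 < ·)).image e'.symm
  have hA : ∀ x ∈ A, x < 1 / 2 := by
    intro x hx
    obtain ⟨y, hy, rfl⟩ := Finset.mem_image.1 hx
    have hy1 := (Finset.mem_filter.1 hy).2
    have := he (e.symm y)
    rw [OrderIso.apply_symm_apply] at this
    linarith
  have hB : ∀ x ∈ B, 1 / 2 < x := by
    intro x hx
    obtain ⟨y, hy, rfl⟩ := Finset.mem_image.1 hx
    have hy1 := (Finset.mem_filter.1 hy).2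
    have := he' (e'.symm y)
    rw [OrderIso.apply_symm_apply] at this
    linarith
  have hact : D.active Γ ⊆ (B ∪ insert (1 / 2) A : Finset ℝ) := by
    intro t ht
    simp only [Finset.coe_union, Finset.coe_insert, Set.mem_union, Set.mem_insert_iff,
      Finset.mem_coe]
    rcases lt_trichotomy t (1 / 2) with h | h | h
    · right; right
      rw [active_congr (g1 t h), active_comp] at ht
      refine Finset.mem_image.2 ⟨e t, Finset.mem_filter.2 ⟨by simpa [s] using ht, ?_⟩, by simp⟩
      rw [he]; linarith
    · right; left; exact h
    · left
      rw [active_congr (g2 t h), active_comp] at ht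
      refine Finset.mem_image.2 ⟨e' t, Finset.mem_filter.2 ⟨by simpa [s'] using ht, ?_⟩, by simp⟩
      rw [he']; linarith
  have i1 : D.hol g γ = D.jump g γ 1 * oprod (s.filter (· < 1)) (D.jump g γ) := by
    rw [← oprod_insert_max (by simp)]
    refine hol_eq (fun t ht => ?_) g
    have := (active_subset_Icc hγ0 hγ1 ht).2
    rcases this.lt_or_eq with h | h
    · simp [s, ht, h]
    · simp [h]
  have i2 : D.hol g γ' = oprod (s'.filter (0 < ·)) (D.jump g γ') * D.jump g γ' 0 := by
    rw [← oprod_insert_min (by simp)]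
    refine hol_eq (fun t ht => ?_) g
    have := (active_subset_Icc hγ'0 hγ'1 ht).1
    rcases this.lt_or_eq with h | h
    · simp [s', ht, h]
    · simp [← h]
  rw [hol_eq hact, oprod_union, oprod_insert_max hA, g3, i1, i2, oprod_image e.symm.strictMono,
    oprod_image e'.symm.strictMono]
  · have j1 : oprod (s.filter (· < 1)) (fun t => D.jump g Γ (e.symm t)) =
        oprod (s.filter (· < 1)) (D.jump g γ) := by
      refine oprod_congr fun t ht => ?_
      rw [jump_congr (g1 _ (hA _ (Finset.mem_image_of_mem _ ht))), jump_comp]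
      simp
    have j2 : oprod (s'.filter (0 < ·)) (fun t => D.jump g Γ (e'.symm t)) =
        oprod (s'.filter (0 < ·)) (D.jump g γ') := by
      refine oprod_congr fun t ht => ?_
      rw [jump_congr (g2 _ (hB _ (Finset.mem_image_of_mem _ ht))), jump_comp]
      simp
    rw [j1, j2]
    simp only [mul_assoc]
  · intro x hx y hy
    rcases Finset.mem_insert.1 hy with rfl | hy
    · exact hB x hx
    · exact (hA y hy).trans (hB x hx)

lemma continuous_hol [TopologicalSpace G] [IsTopologicalGroup G] (γ : ℝ → S) :
    Continuous fun g : ι → G => D.hol g γ := by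
  have hv : ∀ p F, Continuous fun g : ι → G => D.val g p F := by
    intro p F
    unfold val
    split_ifs with h
    · exact continuous_apply _
    · exact continuous_const
  unfold hol
  split_ifs with h
  · exact continuous_oprod _ fun t => (hv _ _).mul (hv _ _).inv
  · exact continuous_const

end Directions

/-! ### The jump functor on the groupoid of paths -/

section JumpHom

variable {d : ℕ} {M : Type u} [TopologicalSpace M] [ChartedSpace (EuclideanSpace ℝ (Fin d)) M]
  {ι : Type w} {G : Type v} [Group G]

lemma IsRegularPiece.injOn {γ : ℝ → M} {a b : ℝ} (h : IsRegularPiece d γ a b) :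
    InjOn γ (Ioo a b) :=
  injOn_iff_injective.2 h.embedding.injective

/-- Continuing `ψ` by the identity gives a global order isomorphism, so that one-sided germs are
transported also at `0` and `1`. -/
lemma IsReparam.exists_orderIso {ψ : ℝ → ℝ} (h : IsReparam ψ) :
    ∃ e : ℝ ≃o ℝ, (∀ t ∈ Icc (0 : ℝ) 1, e t = ψ t) ∧ ∀ t ∉ Icc (0 : ℝ) 1, e t = t := by
  classical
  let f : ℝ → ℝ := fun t => if t ∈ Icc (0 : ℝ) 1 then ψ t else t
  have h0 : ∀ t ∈ Icc (0 : ℝ) 1, ψ t ∈ Icc (0 : ℝ) 1 := by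
    intro t ht
    refine ⟨?_, ?_⟩
    · rw [← h.zero]; exact h.mono.monotoneOn ⟨le_rfl, zero_le_one⟩ ht ht.1
    · rw [← h.one]; exact h.mono.monotoneOn ht ⟨zero_le_one, le_rfl⟩ ht.2
  have hf : StrictMono f := by
    intro s t hst
    simp only [f]
    split_ifs with hs ht ht
    · exact h.mono hs ht hst
    · have := (h0 s hs).2
      by_contra hc
      exact ht ⟨hs.1.trans hst.le, by linarith⟩
    · have := (h0 t ht).1
      by_contra hc
      exact hs ⟨by linarith, hst.le.trans ht.2⟩
    · exact hst
  have hsurj : Function.Surjective f := by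
    intro y
    by_cases hy : y ∈ Icc (0 : ℝ) 1
    · have := intermediate_value_Icc (zero_le_one (α := ℝ)) h.cont
      rw [h.zero, h.one] at this
      obtain ⟨t, ht, rfl⟩ := this hy
      exact ⟨t, if_pos ht⟩
    · exact ⟨y, if_neg hy⟩
  exact ⟨hf.orderIsoOfSurjective f hsurj, fun t ht => if_pos ht, fun t ht => if_neg ht⟩

lemma extend_nonpos {x y : M} (p : Path x y) : ∀ t ≤ 0, p.extend t = p.extend 0 := fun t ht => by
  rw [Path.extend_of_le_zero _ ht, Path.extend_zero]

lemma extend_one_le {x y : M} (p : Path x y) : ∀ t, 1 ≤ t → p.extend t = p.extend 1 :=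
  fun t ht => by rw [Path.extend_of_one_le _ ht, Path.extend_one]

lemma extend_reparam {x y : M} {c c' : Path x y} {ψ : ℝ → ℝ} (hψ : IsReparam ψ)
    (h : ∀ t ∈ Icc (0 : ℝ) 1, c'.extend t = c.extend (ψ t)) :
    ∃ e : ℝ ≃o ℝ, c'.extend = c.extend ∘ e := by
  obtain ⟨e, he, he'⟩ := hψ.exists_orderIso
  refine ⟨e, funext fun t => ?_⟩
  by_cases ht : t ∈ Icc (0 : ℝ) 1
  · rw [Function.comp, he t ht, h t ht]
  · rw [Function.comp, he' t ht]
    rcases not_and_or.1 ht with ht | ht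
    · rw [Path.extend_of_le_zero _ (not_le.1 ht).le, Path.extend_of_le_zero _ (not_le.1 ht).le]
    · rw [Path.extend_of_one_le _ (not_le.1 ht).le, Path.extend_of_one_le _ (not_le.1 ht).le]

lemma exists_mem_Icc_of_partition {n : ℕ} {t : ℕ → ℝ} {s : ℝ} (h0 : t 0 ≤ s) (h1 : s ≤ t n)
    (hn : t 0 < t n) : ∃ k < n, s ∈ Icc (t k) (t (k + 1)) := by
  induction n with
  | zero => exact absurd hn (lt_irrefl _)
  | succ n ih =>
    by_cases hs : t n ≤ s
    · exact ⟨n, n.lt_succ_self, hs, h1⟩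
    · obtain ⟨k, hk, hk'⟩ := ih (not_le.1 hs).le (h0.trans_lt (not_le.1 hs))
      exact ⟨k, hk.trans n.lt_succ_self, hk'⟩

namespace Directions

variable (D : Directions ι M)

/-- Without finiteness `hol` would take its default value `1` and multiplicativity could fail. -/
lemma finite_active [Finite ι] {x y : M} (c : Curve d x y) : (D.active c.path.extend).Finite := by
  obtain ⟨n, t, h0, h1, hp⟩ := c.piecewiseAnalytic
  have hsub : D.active c.path.extend ⊆ ⋃ k ∈ Set.Iio n, ({t k, t (k + 1)} ∪
      (D.active c.path.extend ∩ Ioo (t k) (t (k + 1)))) := by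
    intro s hs
    obtain ⟨hs0, hs1⟩ := active_subset_Icc (extend_nonpos c.path) (extend_one_le c.path) hs
    obtain ⟨k, hk, hks⟩ := exists_mem_Icc_of_partition (t := t) (n := n) (s := s)
      (by rwa [h0]) (by rwa [h1]) (by rw [h0, h1]; exact zero_lt_one)
    refine mem_biUnion (show k ∈ Set.Iio n from hk) ?_
    rcases hks.1.eq_or_lt with h | h
    · left; left; exact h.symm
    · rcases hks.2.eq_or_lt with h' | h'
      · left; right; exact h'
      · right; exact ⟨hs, h, h'⟩
  refine Set.Finite.subset ((Set.finite_Iio n).biUnion fun k hk => ?_) hsub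
  refine ((Set.finite_singleton _).insert _).union ?_
  rcases (hp k hk).2 with h | h
  -- The open regular piece is injective, so each of the finitely many marked points is visited at
  -- most once inside it.
  · refine Set.Finite.of_finite_image ((Set.finite_range D.pt).subset ?_)
      (h.injOn.mono inter_subset_right)
    rintro _ ⟨s, ⟨⟨i, hi⟩, -⟩, rfl⟩
    rcases hi with hi | hi <;> exact ⟨i, hi.1.symm⟩
  · refine Set.finite_empty.subset ?_
    rintro s ⟨⟨i, hi⟩, hs⟩
    have hev : ∀ᶠ r in 𝓝 s, c.path.extend r = c.path.extend s := by
      filter_upwards [Ioo_mem_nhds hs.1 hs.2] with r hr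
      rw [h r (Ioo_subset_Icc_self hr), h s (Ioo_subset_Icc_self hs)]
    rcases hi with hi | hi <;>
      exact not_leaves_of_const (hev.filter_mono nhdsWithin_le_nhds) i hi

variable [Finite ι] (g : ι → G)

lemma hol_curve_comp {x y z : M} (c : Curve d x y) (c' : Curve d y z) :
    D.hol g (c.comp c').path.extend = D.hol g c'.path.extend * D.hol g c.path.extend :=
  hol_trans (D.finite_active c) (D.finite_active c')
    (fun _ ht => Path.extend_trans_of_le_half _ _ ht)
    (fun _ ht => Path.extend_trans_of_half_le _ _ ht)
    (extend_nonpos _) (extend_one_le _) (extend_nonpos _) (extend_one_le _) g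

lemma hol_curve_rev {x y : M} (c : Curve d x y) :
    D.hol g c.rev.path.extend = (D.hol g c.path.extend)⁻¹ := by
  rw [← hol_rev _ (D.finite_active c)]
  congr 1
  exact funext fun t => Path.extend_symm_apply _ t

/-- Retracings cancel in the group, and a reparametrization merely moves the active times
monotonically. -/
lemma hol_equiv {x y : M} {c c' : Curve d x y} (h : CurveEquiv c c') :
    D.hol g c.path.extend = D.hol g c'.path.extend := by
  induction h with
  | refl c => rfl
  | symm _ ih => exact ih.symm
  | trans _ _ ih ih' => exact ih.trans ih'
  | comp _ _ ih ih' => rw [hol_curve_comp, hol_curve_comp, ih, ih']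
  | reparam c c' ψ hψ h =>
    obtain ⟨e, he⟩ := extend_reparam hψ h
    rw [he, hol_comp _ _ (D.finite_active c)]
  | retrace_left b c => rw [hol_curve_comp, hol_curve_comp, hol_curve_rev]; simp
  | retrace_right c b => rw [hol_curve_comp, hol_curve_comp, hol_curve_rev]; simp

lemma hol_const (x : M) : D.hol g (Curve.const d x).path.extend = 1 := by
  have h := D.hol_equiv g (CurveEquiv.comp_rev (Curve.const d x))
  rw [hol_curve_comp, hol_curve_rev] at h
  rw [← h]; simp

/-- The functor that multiplies all factors which a curve picks up. -/
noncomputable def jumpHom (d : ℕ) {M : Type u} [TopologicalSpace M]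
    [ChartedSpace (EuclideanSpace ℝ (Fin d)) M] (D : Directions ι M) (g : ι → G) :
    HomTo (PathGroupoid d M) G :=
  { obj := fun _ => SingleObj.star G
    map := fun {x y} => _root_.Quotient.lift
      (fun c : Curve d (M := M) x y => (D.hol g c.path.extend : G)) fun _ _ h => D.hol_equiv g h
    map_id := fun x => D.hol_const (d := d) g x
    map_comp := by
      rintro x y z ⟨c⟩ ⟨c'⟩
      exact D.hol_curve_comp g c c' : PathGroupoid d M ⥤ SingleObj G }

end Directions

end JumpHom

/-! ### Functors from a groupoid to a group -/

section Functors

variable {C : Type u} [Groupoid.{u} C] {G : Type v} [Group G]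

lemma HomTo.eval_comp (A : HomTo C G) {x y z : C} (p : x ⟶ y) (q : y ⟶ z) :
    A.eval (p ≫ q) = A.eval q * A.eval p :=
  CategoryTheory.Functor.map_comp A p q

lemma HomTo.eval_id (A : HomTo C G) (x : C) : A.eval (𝟙 x) = 1 :=
  CategoryTheory.Functor.map_id A x

lemma HomTo.eval_inv (A : HomTo C G) {x y : C} (p : x ⟶ y) :
    A.eval (Groupoid.inv p) = (A.eval p)⁻¹ := by
  rw [eq_inv_iff_mul_eq_one, ← HomTo.eval_comp, Groupoid.comp_inv, HomTo.eval_id]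

lemma HomTo.ext_eval {A B : HomTo C G} (h : ∀ (x y : C) (p : x ⟶ y), A.eval p = B.eval p) :
    A = B :=
  CategoryTheory.Functor.ext (fun _ => rfl) fun x y p => by
    simp only [eqToHom_refl, Category.comp_id, Category.id_comp]
    exact h x y p

/-- The arrows of `L` on which two functors on `L` agree. -/
def agree {L : Subgroupoid C} (A B : HomTo L.objs G) : Subgroupoid C where
  arrows x y := {p | ∃ h : p ∈ L.arrows x y,
    A.eval (x := ⟨x, L.mem_objs_of_src h⟩) (y := ⟨y, L.mem_objs_of_tgt h⟩) ⟨p, h⟩ =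
    B.eval (x := ⟨x, L.mem_objs_of_src h⟩) (y := ⟨y, L.mem_objs_of_tgt h⟩) ⟨p, h⟩}
  inv := by
    rintro x y p ⟨h, e⟩
    refine ⟨L.inv h, ?_⟩
    have h1 := A.eval_inv (C := L.objs) (x := ⟨x, L.mem_objs_of_src h⟩)
      (y := ⟨y, L.mem_objs_of_tgt h⟩) ⟨p, h⟩
    have h2 := B.eval_inv (C := L.objs) (x := ⟨x, L.mem_objs_of_src h⟩)
      (y := ⟨y, L.mem_objs_of_tgt h⟩) ⟨p, h⟩
    rw [e, ← h2] at h1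
    exact h1
  mul := by
    rintro x y z p ⟨h, e⟩ q ⟨h', e'⟩
    refine ⟨L.mul h h', ?_⟩
    have h1 := A.eval_comp (C := L.objs) (x := ⟨x, L.mem_objs_of_src h⟩)
      (y := ⟨y, L.mem_objs_of_tgt h⟩) (z := ⟨z, L.mem_objs_of_tgt h'⟩) ⟨p, h⟩ ⟨q, h'⟩
    have h2 := B.eval_comp (C := L.objs) (x := ⟨x, L.mem_objs_of_src h⟩)
      (y := ⟨y, L.mem_objs_of_tgt h⟩) (z := ⟨z, L.mem_objs_of_tgt h'⟩) ⟨p, h⟩ ⟨q, h'⟩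
    rw [e, e', ← h2] at h1
    exact h1

end Functors

/-! ### Subgroupoids generated by edges -/

section Generated

variable {d : ℕ} {M : Type u} [TopologicalSpace M] [ChartedSpace (EuclideanSpace ℝ (Fin d)) M]
  {G : Type v} [Group G] {n : ℕ} {e : Fin n → Edge d M}

lemma generated_le {L : Subgroupoid (PathGroupoid d M)}
    (h : ∀ i, (e i).hom ∈ L.arrows (e i).src (e i).tgt) : generated e ≤ L :=
  sInf_le h

lemma mem_generated (e : Fin n → Edge d M) (i : Fin n) :
    (e i).hom ∈ (generated e).arrows (e i).src (e i).tgt := by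
  rw [generated, Subgroupoid.mem_sInf_arrows]
  exact fun S hS => hS i

lemma isGeneratedBy_generated (h : Independent e) : IsGeneratedBy (generated e) e := ⟨h, rfl⟩

/-- The arrows on which two functors agree form a subgroupoid; if it contains the generators, it
contains `L`. -/
lemma rho_injective {L : Subgroupoid (PathGroupoid d M)} (h : IsGeneratedBy L e) :
    Function.Injective (rho G h) := by
  intro A B hAB
  have hle : L ≤ agree A B := h.eq_generated.le.trans
    (generated_le fun i => ⟨h.mem i, congrFun hAB i⟩)
  refine HomTo.ext_eval fun x y p => ?_
  obtain ⟨_, h1⟩ := (Subgroupoid.le_iff _ _).1 hle p.2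
  exact h1

lemma eval_eq_of_mem_generated {A B : HomTo (PathGroupoid d M) G}
    (h : ∀ i, A.eval (e i).hom = B.eval (e i).hom) {x y : PathGroupoid d M} {p : x ⟶ y}
    (hp : p ∈ (generated e).arrows x y) : A.eval p = B.eval p := by
  let K : Subgroupoid (PathGroupoid d M) :=
    { arrows := fun x y => {p | A.eval p = B.eval p}
      inv := fun {x y p} hp => by
        simp only [mem_ofPred_eq] at hp ⊢
        rw [HomTo.eval_inv, HomTo.eval_inv, hp]
      mul := fun {x y z p} hp q hq => by
        simp only [mem_ofPred_eq] at hp hq ⊢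
        rw [HomTo.eval_comp, HomTo.eval_comp, hp, hq] }
  exact (Subgroupoid.le_iff _ _).1 (generated_le (L := K) h) hp

/-- The end points of a family of edges. -/
def vertices (e : Fin n → Edge d M) : Set M := {x | ∃ i, x = (e i).src ∨ x = (e i).tgt}

/-- Subgroupoids need not contain all identities, so the arrows between vertices already form one.
-/
lemma mem_vertices_of_mem_generated {x y : PathGroupoid d M} {p : x ⟶ y}
    (hp : p ∈ (generated e).arrows x y) : x ∈ vertices e ∧ y ∈ vertices e := by
  let K : Subgroupoid (PathGroupoid d M) :=
    { arrows := fun x y => {_p | x ∈ vertices e ∧ y ∈ vertices e}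
      inv := fun hp => ⟨hp.2, hp.1⟩
      mul := fun hp _ hq => ⟨hp.1, hq.2⟩ }
  have hK : ∀ i, (e i).hom ∈ K.arrows (e i).src (e i).tgt :=
    fun i => ⟨⟨i, .inl rfl⟩, ⟨i, .inr rfl⟩⟩
  exact (Subgroupoid.le_iff _ _).1 (generated_le (L := K) hK) hp

end Generated

/-! ### Injectivity of regular pieces up to their end points -/

section RegularPieces

variable {d : ℕ} {M : Type u} [TopologicalSpace M] [ChartedSpace (EuclideanSpace ℝ (Fin d)) M]

lemma IsRegularPiece.continuousOn {γ : ℝ → M} {a b : ℝ} (h : IsRegularPiece d γ a b) :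
    ContinuousOn γ (Icc a b) := h.analytic.continuousOn

/-- If an end point `s` had the image of an interior `t`, then interior parameters tending to `s`
would have images tending to `γ t`, and the embedding property would make them tend to `t` as well.
-/
lemma IsRegularPiece.eq_of_mem_Ioo {γ : ℝ → M} {a b s t : ℝ} (h : IsRegularPiece d γ a b)
    (hs : s ∈ Icc a b) (ht : t ∈ Ioo a b) (hst : γ s = γ t) : s = t := by
  have hcl : s ∈ closure (Ioo a b) := by
    rwa [closure_Ioo (ht.1.trans ht.2).ne]
  let u : Filter (Ioo a b) := Filter.comap Subtype.val (𝓝 s)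
  have hu : u.NeBot := mem_closure_iff_comap_neBot.1 hcl
  have h1 : Filter.Tendsto (Subtype.val : Ioo a b → ℝ) u (𝓝 s) := Filter.tendsto_comap
  have h2 : Filter.Tendsto (Subtype.val : Ioo a b → ℝ) u (𝓝[Icc a b] s) :=
    tendsto_nhdsWithin_iff.2 ⟨h1, .of_forall fun x => Ioo_subset_Icc_self x.2⟩
  have h3 : Filter.Tendsto ((Ioo a b).domRestrict γ) u (𝓝 (γ s)) :=
    (h.continuousOn s hs).tendsto.comp h2
  rw [hst] at h3
  have h4 : Filter.Tendsto id u (𝓝 (⟨t, ht⟩ : Ioo a b)) :=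
    h.embedding.isInducing.tendsto_nhds_iff.2 h3
  have h5 : Filter.Tendsto (Subtype.val : Ioo a b → ℝ) u (𝓝 t) :=
    (continuous_subtype_val.tendsto _).comp h4
  exact tendsto_nhds_unique h1 h5

end RegularPieces

/-! ### Functors with prescribed values on independent edges -/

section EdgeDirections

variable {d : ℕ} {M : Type u} [TopologicalSpace M] [ChartedSpace (EuclideanSpace ℝ (Fin d)) M]
  {G : Type v} [Group G]

/-- An analytic curve in the class of an edge. -/
noncomputable def Edge.curve (e : Edge d M) : Curve d (M := M) e.src e.tgt := e.isEdge.choose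

lemma Edge.isAnalytic_curve (e : Edge d M) : e.curve.IsAnalytic := e.isEdge.choose_spec.1

lemma Edge.toHom_curve (e : Edge d M) : e.curve.toHom = e.hom := e.isEdge.choose_spec.2

/-- The parametrization of an edge by an analytic curve. -/
noncomputable def Edge.par (e : Edge d M) : ℝ → M := e.curve.path.extend

lemma Edge.isRegularPiece_par (e : Edge d M) : IsRegularPiece d e.par 0 1 := e.isAnalytic_curve

lemma Edge.par_zero (e : Edge d M) : e.par 0 = e.src := Path.extend_zero _

lemma Edge.par_one (e : Edge d M) : e.par 1 = e.tgt := Path.extend_one _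

lemma Edge.par_nonpos (e : Edge d M) : ∀ t ≤ 0, e.par t = e.par 0 := extend_nonpos _

lemma Edge.par_one_le (e : Edge d M) : ∀ t, 1 ≤ t → e.par t = e.par 1 := extend_one_le _

lemma Edge.par_mem_image (e : Edge d M) {t : ℝ} (ht : t ∈ Icc (0 : ℝ) 1) : e.par t ∈ e.image :=
  ⟨e.curve, e.isAnalytic_curve, e.toHom_curve, ⟨t, ht⟩, (Path.extend_apply _ ht).symm⟩

lemma Edge.par_ne_src (e : Edge d M) {t : ℝ} (ht : t ∈ Ioo (0 : ℝ) 1) : e.par t ≠ e.src := by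
  rw [← e.par_zero]
  intro h
  exact ht.1.ne (e.isRegularPiece_par.eq_of_mem_Ioo (by simp) ht h.symm)

lemma Edge.par_ne_tgt (e : Edge d M) {t : ℝ} (ht : t ∈ Ioo (0 : ℝ) 1) : e.par t ≠ e.tgt := by
  rw [← e.par_one]
  intro h
  exact ht.2.ne' (e.isRegularPiece_par.eq_of_mem_Ioo (by simp) ht h.symm)

variable {n m : ℕ} {e : Fin n → Edge d M} {e' : Fin m → Edge d M}

/-- A common point would be an end point of the `i`-th edge, which interior parameters never reach.
-/
lemma Independent.par_notMem_image (h : Independent e) {i j : Fin n} (hij : i ≠ j) {t : ℝ}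
    (ht : t ∈ Ioo (0 : ℝ) 1) : (e i).par t ∉ (e j).image := fun hc => by
  rcases h i j hij ⟨(e i).par_mem_image (Ioo_subset_Icc_self ht), hc⟩ with h' | h'
  · exact (e i).par_ne_src ht h'
  · exact (e i).par_ne_tgt ht h'

lemma Edge.src_mem_image (e : Edge d M) : (e.src : M) ∈ e.image := by
  rw [← e.par_zero]; exact e.par_mem_image (by simp)

lemma Edge.tgt_mem_image (e : Edge d M) : (e.tgt : M) ∈ e.image := by
  rw [← e.par_one]; exact e.par_mem_image (by simp)

lemma Independent.par_notMem_vertices (h : Independent e) (i : Fin n) {t : ℝ}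
    (ht : t ∈ Ioo (0 : ℝ) 1) : (e i).par t ∉ vertices e := by
  rintro ⟨j, hj⟩
  by_cases hij : i = j
  · subst hij
    exact hj.elim ((e i).par_ne_src ht) ((e i).par_ne_tgt ht)
  · refine h.par_notMem_image hij ht ?_
    rcases hj with hj | hj
    · rw [hj]; exact (e j).src_mem_image
    · rw [hj]; exact (e j).tgt_mem_image

lemma half_mem : (1 / 2 : ℝ) ∈ Ioo (0 : ℝ) 1 := by norm_num

lemma half_sub : Ioo (1 / 2 : ℝ) 1 ⊆ Ioo (0 : ℝ) 1 := Ioo_subset_Ioo_left (by norm_num)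

/-- The directions in which independent edges leave their mid points. -/
noncomputable def Independent.mids (h : Independent e) : Directions (Fin n) M where
  pt i := (e i).par (1 / 2)
  nb i := (e i).par '' Ioo (1 / 2) 1
  pt_notMem := by
    rintro i ⟨t, ht, hte⟩
    exact ht.1.ne' ((e i).isRegularPiece_par.injOn (half_sub ht) half_mem hte)
  disj i j hij := .inl fun heq => h.par_notMem_image hij half_mem
    (heq ▸ (e j).par_mem_image (Ioo_subset_Icc_self half_mem))

/-- The directions in which independent edges leave their end points backwards. -/
noncomputable def Independent.ends (h : Independent e) : Directions (Fin n) M where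
  pt i := (e i).tgt
  nb i := (e i).par '' Ioo (1 / 2) 1
  pt_notMem := by
    rintro i ⟨t, ht, hte⟩
    exact (e i).par_ne_tgt (half_sub ht) hte
  -- Different edges may share their target, so here the disjoint final halves have to separate the
  -- directions.
  disj i j hij := .inr <| by
    rw [Set.disjoint_left]
    rintro _ ⟨t, ht, rfl⟩ ⟨s, hs, hst⟩
    exact h.par_notMem_image hij (half_sub ht)
      (hst ▸ (e j).par_mem_image (Ioo_subset_Icc_self (half_sub hs)))

/-- The union of two families of directions at different points. -/
def Directions.sum {ι κ : Type*} {S : Type*} (D : Directions ι S) (D' : Directions κ S)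
    (h : ∀ i j, D.pt i ≠ D'.pt j) : Directions (ι ⊕ κ) S where
  pt := Sum.elim D.pt D'.pt
  nb := Sum.elim D.nb D'.nb
  pt_notMem := by
    rintro (i | i)
    · exact D.pt_notMem i
    · exact D'.pt_notMem i
  disj := by
    rintro (i | i) (j | j) hij
    · exact D.disj i j fun h => hij (h ▸ rfl)
    · exact .inl (h i j)
    · exact .inl (h j i).symm
    · exact D'.disj i j fun h => hij (h ▸ rfl)

namespace Directions

variable {ι κ : Type*} {S : Type*} {D : Directions ι S} {D' : Directions κ S}

lemma val_sum_left (h : ∀ i j, D.pt i ≠ D'.pt j) {p : S} (hp : ∀ j, p ≠ D'.pt j) (F : Filter S)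
    [F.NeBot] (f : ι → G) (g : κ → G) :
    (D.sum D' h).val (Sum.elim f g) p F = D.val f p F := by
  by_cases hi : ∃ i, D.Leaves i p F
  · obtain ⟨i, hi⟩ := hi
    rw [val_eq hi, val_eq (D := D.sum D' h) (i := Sum.inl i) hi]
    rfl
  · rw [val_eq_one (not_exists.1 hi), val_eq_one]
    rintro (i | j) hij
    · exact hi ⟨i, hij⟩
    · exact hp j hij.1

lemma val_sum_right (h : ∀ i j, D.pt i ≠ D'.pt j) {p : S} (hp : ∀ i, p ≠ D.pt i) (F : Filter S)
    [F.NeBot] (f : ι → G) (g : κ → G) :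
    (D.sum D' h).val (Sum.elim f g) p F = D'.val g p F := by
  by_cases hi : ∃ i, D'.Leaves i p F
  · obtain ⟨i, hi⟩ := hi
    rw [val_eq hi, val_eq (D := D.sum D' h) (i := Sum.inr i) hi]
    rfl
  · rw [val_eq_one (not_exists.1 hi), val_eq_one]
    rintro (i | j) hij
    · exact hp i hij.1
    · exact hi ⟨j, hij⟩

lemma val_of_ne {p : S} (hp : ∀ i, p ≠ D.pt i) (F : Filter S) (f : ι → G) : D.val f p F = 1 :=
  val_eq_one (fun i hi => hp i hi.1) f

lemma jump_of_ne {γ : ℝ → S} {t : ℝ} (hp : ∀ i, γ t ≠ D.pt i) (f : ι → G) :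
    D.jump f γ t = 1 := by
  rw [jump, out, into, val_of_ne hp, val_of_ne hp]; simp

end Directions

open Directions

/-- The edge leaves its midpoint through its second half and arrives through the first, which is
disjoint from the second by injectivity. Hence only the departure counts. -/
lemma Independent.jump_mids_half (h : Independent e) (i : Fin n) (g : Fin n → G) :
    h.mids.jump g (e i).par (1 / 2) = g i := by
  have h1 : h.mids.out g (e i).par (1 / 2) = g i := by
    refine val_eq ⟨rfl, ?_⟩ g
    exact Filter.mem_map.2 (Filter.mem_of_superset (Ioo_mem_nhdsGT half_mem.2)
      fun s hs => ⟨s, hs, rfl⟩)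
  have h2 : h.mids.into g (e i).par (1 / 2) = 1 := by
    refine val_eq_one ?_ g
    rintro j ⟨hj1, hj2⟩
    have hij : i = j := by
      by_contra hij
      exact h.par_notMem_image hij half_mem
        (hj1 ▸ (e j).par_mem_image (Ioo_subset_Icc_self half_mem))
    subst hij
    obtain ⟨s, hs1, t, ht, hts⟩ := (Filter.Eventually.and
      (Ioo_mem_nhdsLT half_mem.1 : ∀ᶠ s in 𝓝[<] (1 / 2 : ℝ), s ∈ Ioo (0 : ℝ) (1 / 2))
      (Filter.mem_map.1 hj2)).exists
    have := (e i).isRegularPiece_par.injOn (half_sub ht)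
      ⟨hs1.1, hs1.2.trans half_mem.2⟩ hts
    linarith [hs1.2, ht.1]
  rw [jump, h1, h2]; simp

lemma Independent.mids_pt_notMem_vertices (h : Independent e) (i : Fin n) :
    h.mids.pt i ∉ vertices e := h.par_notMem_vertices i half_mem

lemma Independent.par_ne_mids (h : Independent e) (i : Fin n) {t : ℝ} (ht : t ∈ Icc (0 : ℝ) 1)
    (ht' : t ≠ 1 / 2) (j : Fin n) : (e i).par t ≠ h.mids.pt j := by
  intro heq
  by_cases hij : i = j
  · subst hij
    exact ht' ((e i).isRegularPiece_par.eq_of_mem_Ioo ht half_mem heq)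
  · exact h.par_notMem_image (Ne.symm hij) half_mem
      (show h.mids.pt j ∈ _ from heq ▸ (e i).par_mem_image ht)

/-- Prescribes the values of a functor on independent edges. -/
noncomputable def Independent.sec (h : Independent e) (g : Fin n → G) :
    HomTo (PathGroupoid d M) G := h.mids.jumpHom d g

lemma Edge.eval_jumpHom (e : Edge d M) {ι : Type*} [Finite ι] (D : Directions ι M) (g : ι → G) :
    (D.jumpHom d g).eval e.hom = D.hol g e.par := by
  rw [← e.toHom_curve]; rfl

lemma Edge.active_subset (e : Edge d M) {ι : Type*} (D : Directions ι M) :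
    D.active e.par ⊆ Icc 0 1 := active_subset_Icc e.par_nonpos e.par_one_le

lemma Edge.finite_active (e : Edge d M) {ι : Type*} [Finite ι] (D : Directions ι M) :
    (D.active e.par).Finite := D.finite_active e.curve

lemma Edge.hol_eq_three (e : Edge d M) {ι : Type*} [Finite ι] (D : Directions ι M) (g : ι → G)
    (h : ∀ t ∈ Ioo (0 : ℝ) 1, t ≠ 1 / 2 → D.jump g e.par t = 1) :
    D.hol g e.par =
      D.jump g e.par 1 * (D.jump g e.par (1 / 2) * D.jump g e.par 0) := by
  classical
  let s : Finset ℝ := {1, 1 / 2, 0}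
  rw [hol_eq (s := (e.finite_active D).toFinset ∪ s) (fun t ht => by simp [ht]),
    oprod_eq_of_subset (s := s) Finset.subset_union_right]
  · rw [oprod_insert_max, oprod_insert_max, oprod_singleton]
    · simp
    · intro x hx
      simp only [Finset.mem_insert, Finset.mem_singleton] at hx
      rcases hx with rfl | rfl <;> norm_num
  · intro x hx hxs
    simp only [s, Finset.mem_insert, Finset.mem_singleton, not_or] at hxs
    have hx' : x ∈ D.active e.par := by
      rcases Finset.mem_union.1 hx with hx | hx
      · simpa using hx
      · simp only [s, Finset.mem_insert, Finset.mem_singleton] at hx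
        tauto
    obtain ⟨h0, h1⟩ := e.active_subset D hx'
    exact h x ⟨lt_of_le_of_ne h0 (Ne.symm hxs.2.2), lt_of_le_of_ne h1 hxs.1⟩ hxs.2.1

@[simp] lemma Independent.eval_sec (h : Independent e) (g : Fin n → G) (i : Fin n) :
    (h.sec g).eval (e i).hom = g i := by
  have key : ∀ t ∈ Icc (0 : ℝ) 1, t ≠ 1 / 2 → h.mids.jump g (e i).par t = 1 :=
    fun t ht ht' => jump_of_ne (h.par_ne_mids i ht ht') g
  rw [Independent.sec, Edge.eval_jumpHom, Edge.hol_eq_three, h.jump_mids_half,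
    key 1 (by simp) (by norm_num), key 0 (by simp) (by norm_num)]
  · simp
  · exact fun t ht ht' => key t (Ioo_subset_Icc_self ht) ht'

/-- This is the heart of the consistency proof: left translation of the values on `e` is induced by
a two-sided translation of the values on `e'`, with `a` and `b` chosen before `g`. -/
lemma Independent.exists_shift (h : Independent e) (h' : Independent e')
    (hgen : ∀ i, (e i).hom ∈ (generated e').arrows (e i).src (e i).tgt) (f : Fin n → G) :
    ∃ a b : Fin m → G, ∀ g : Fin m → G, ∀ i,
      (h'.sec (b * g * a)).eval (e i).hom = f i * (h'.sec g).eval (e i).hom := by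
  have hv : ∀ i, (e i).par 0 ∈ vertices e' ∧ (e i).par 1 ∈ vertices e' := fun i => by
    rw [Edge.par_zero, Edge.par_one]
    exact mem_vertices_of_mem_generated (hgen i)
  have hne : ∀ i j, h.ends.pt i ≠ h'.mids.pt j := fun i j heq =>
    h'.mids_pt_notMem_vertices j (heq ▸ ((e i).par_one ▸ (hv i).2 : ((e i).tgt : M) ∈ vertices e'))
  let D := h.ends.sum h'.mids hne
  -- `B g` adds to `sec g` jumps at the targets of the `e i`. The inverse `f⁻¹` is used because
  -- arriving along a direction contributes the inverse of its element.
  let B : (Fin m → G) → HomTo (PathGroupoid d M) G := fun g => D.jumpHom d (Sum.elim f⁻¹ g)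
  -- The targets of the `e i` are vertices of `e'`, hence can affect `e' j` only at its two ends.
  -- These factors involve `f` but not `g`.
  let a : Fin m → G := fun j => h.ends.out f⁻¹ (e' j).par 0
  let b : Fin m → G := fun j => (h.ends.into f⁻¹ (e' j).par 1)⁻¹
  have h1 : ∀ g j, (B g).eval (e' j).hom = (b * g * a) j := by
    intro g j
    have hint : ∀ t ∈ Ioo (0 : ℝ) 1, ∀ i, (e' j).par t ≠ h.ends.pt i := fun t ht i heq =>
      h'.par_notMem_vertices j ht (by
        rw [heq]; exact ((e i).par_one ▸ (hv i).2 : ((e i).tgt : M) ∈ vertices e'))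
    have hmid : ∀ t ∈ Ioo (0 : ℝ) 1, D.jump (Sum.elim f⁻¹ g) (e' j).par t =
        h'.mids.jump g (e' j).par t := fun t ht => by
      rw [jump, jump, out, out, into, into, val_sum_right hne (hint t ht),
        val_sum_right hne (hint t ht)]
    have j0 : D.jump (Sum.elim f⁻¹ g) (e' j).par 0 = a j := by
      rw [jump, into_zero (e' j).par_nonpos, out,
        val_sum_left hne (h'.par_ne_mids j (by simp) (by norm_num)), inv_one, mul_one]
      rfl
    have j1 : D.jump (Sum.elim f⁻¹ g) (e' j).par 1 = b j := by
      rw [jump, out_one (e' j).par_one_le, into,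
        val_sum_left hne (h'.par_ne_mids j (by simp) (by norm_num)), one_mul]
      rfl
    rw [Edge.eval_jumpHom, Edge.hol_eq_three, j0, j1, hmid _ half_mem, h'.jump_mids_half]
    · simp [mul_assoc]
    · intro t ht ht'
      rw [hmid t ht, jump_of_ne (h'.par_ne_mids j (Ioo_subset_Icc_self ht) ht')]
  have h2 : ∀ g i, (B g).eval (e i).hom = f i * (h'.sec g).eval (e i).hom := by
    classical
    intro g i
    have hnm : ∀ t ∈ ({0, 1} : Set ℝ), ∀ j, (e i).par t ≠ h'.mids.pt j := by
      rintro t (rfl | rfl) j heq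
      · exact h'.mids_pt_notMem_vertices j (heq ▸ (hv i).1)
      · exact h'.mids_pt_notMem_vertices j (heq ▸ (hv i).2)
    have j1 : D.jump (Sum.elim f⁻¹ g) (e i).par 1 = f i := by
      have : h.ends.into f⁻¹ (e i).par 1 = f⁻¹ i := by
        refine val_eq ⟨(e i).par_one, ?_⟩ _
        exact Filter.mem_map.2 (Filter.mem_of_superset (Ioo_mem_nhdsLT half_mem.2)
          fun s hs => ⟨s, hs, rfl⟩)
      rw [jump, out_one (e i).par_one_le, into, val_sum_left hne (hnm 1 (by simp))]
      rw [into] at this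
      rw [this]; simp
    have j1' : h'.mids.jump g (e i).par 1 = 1 := jump_of_ne (hnm 1 (by simp)) g
    -- Even if `e i` starts at the target of some `e k`, its initial germ does not lie in the final
    -- half of `e k`: for `k = i` by injectivity, otherwise by independence.
    have j0 : D.jump (Sum.elim f⁻¹ g) (e i).par 0 = h'.mids.jump g (e i).par 0 := by
      rw [jump_of_ne (hnm 0 (by simp)), jump, into_zero (e i).par_nonpos, out,
        val_sum_left hne (hnm 0 (by simp)), val_eq_one, inv_one, mul_one]
      rintro k ⟨-, hk⟩
      obtain ⟨s, hs1, t, ht, hts⟩ := (Filter.Eventually.and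
        (Ioo_mem_nhdsGT half_mem.1 : ∀ᶠ s in 𝓝[>] (0 : ℝ), s ∈ Ioo (0 : ℝ) (1 / 2))
        (Filter.mem_map.1 hk)).exists
      have hs2 : s ∈ Ioo (0 : ℝ) 1 := ⟨hs1.1, hs1.2.trans half_mem.2⟩
      by_cases hik : i = k
      · subst hik
        have := (e i).isRegularPiece_par.injOn (half_sub ht) hs2 hts
        linarith [hs1.2, ht.1]
      · exact h.par_notMem_image hik hs2
          (hts ▸ (e k).par_mem_image (Ioo_subset_Icc_self (half_sub ht)))
    have jt : ∀ t ∈ Ioo (0 : ℝ) 1, D.jump (Sum.elim f⁻¹ g) (e i).par t =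
        h'.mids.jump g (e i).par t := by
      intro t ht
      have : ∀ k, (e i).par t ≠ h.ends.pt k := by
        intro k hk
        by_cases hik : i = k
        · subst hik
          exact (e i).par_ne_tgt ht hk
        · exact h.par_notMem_image hik ht (hk ▸ (e k).tgt_mem_image)
      rw [jump, jump, out, out, into, into, val_sum_right hne this, val_sum_right hne this]
    let s : Finset ℝ := ((e i).finite_active D).toFinset ∪
      ((e i).finite_active h'.mids).toFinset
    -- The factor at time `1` is split off: it equals `f i` for `D` and `1` for `h'.mids`, while all
    -- earlier factors coincide.
    let s' := s.filter (fun t => t ∈ Ico (0 : ℝ) 1)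
    have hs' : ∀ x ∈ s', x < 1 := fun x hx => (Finset.mem_filter.1 hx).2.2
    have hsub : ∀ x ∈ s, x ∈ Icc (0 : ℝ) 1 → x ∈ insert 1 s' := by
      intro x hx hx'
      rcases hx'.2.lt_or_eq with h1 | h1
      · exact Finset.mem_insert_of_mem (Finset.mem_filter.2 ⟨hx, hx'.1, h1⟩)
      · rw [h1]; exact Finset.mem_insert_self _ _
    rw [Independent.sec, Edge.eval_jumpHom, Edge.eval_jumpHom, hol_eq (s := insert 1 s'),
      hol_eq (D := h'.mids) (s := insert 1 s'), oprod_insert_max hs', oprod_insert_max hs', j1, j1',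
      one_mul]
    · congr 1
      refine oprod_congr fun t ht => ?_
      obtain ⟨-, ht0, ht1⟩ := Finset.mem_filter.1 ht
      rcases ht0.eq_or_lt with rfl | ht0
      · exact j0
      · exact jt t ⟨ht0, ht1⟩
    · exact fun x hx => hsub x (by simp [s, hx]) ((e i).active_subset _ hx)
    · exact fun x hx => hsub x (by simp [s, hx]) ((e i).active_subset _ hx)
  refine ⟨a, b, fun g i => ?_⟩
  rw [← h2]
  -- `h'.sec (b * g * a)` and `B g` agree on the generators `e'`, hence on `e i`.
  refine eval_eq_of_mem_generated (fun j => ?_) (hgen i)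
  rw [h1, h'.eval_sec]

end EdgeDirections

/-! ### The image of an edge does not depend on the analytic representative -/

section EdgeImage

open Directions

variable {d : ℕ} {M : Type u} [TopologicalSpace M] [ChartedSpace (EuclideanSpace ℝ (Fin d)) M]

/-- A single direction. -/
def Directions.single {S : Type*} (p : S) (W : Set S) (h : p ∉ W) : Directions Unit S where
  pt _ := p
  nb _ := W
  pt_notMem _ := h
  disj _ _ hij := (hij rfl).elim

/-- If an analytic curve visits a point that an equivalent curve avoids, a jump functor at that
point distinguishes the two. -/
lemma Curve.image_subset_of_equiv [T2Space M] {x y : M} {c c' : Curve d x y}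
    (hc' : c'.IsAnalytic) (h : CurveEquiv c c') : c'.image ⊆ c.image := by
  by_contra hc
  have hcl : IsClosed c.image := (isCompact_range c.path.continuous).isClosed
  obtain ⟨_, ⟨s, rfl⟩, hs⟩ := not_subset.1 hc
  have hs' : c'.path.extend s ∉ c.image := by rwa [Path.extend_apply _ s.2]
  have hop : IsOpen (c'.path.extend ⁻¹' c.imageᶜ) :=
    hcl.isOpen_compl.preimage c'.path.continuous_extend
  -- The exceptional point may be an end point of `c'`; since `c.image` is closed, it can be moved
  -- to an interior parameter `t`.
  have hscl : (s : ℝ) ∈ closure (Ioo (0 : ℝ) 1) := by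
    rw [closure_Ioo zero_ne_one]; exact s.2
  obtain ⟨t, ht, ht01⟩ := mem_closure_iff.1 hscl _ hop hs'
  have ht' : c'.path.extend t ∉ c.image := ht
  let D := Directions.single (c'.path.extend t) (c'.path.extend '' Ioo t 1) (by
    rintro ⟨r, hr, hrt⟩
    exact hr.1.ne' (IsRegularPiece.injOn hc' ⟨ht01.1.trans hr.1, hr.2⟩ ht01 hrt))
  -- With values in `ℤ` the functor counts signed passages: none for `c`, exactly one for `c'`.
  let g : Unit → Multiplicative ℤ := fun _ => Multiplicative.ofAdd 1
  have h1 : D.hol g c.path.extend = 1 := by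
    rw [hol_eq (s := ∅), oprod_empty]
    rintro r ⟨i, hi⟩
    have : c.path.extend r = c'.path.extend t := by rcases hi with hi | hi <;> exact hi.1
    refine (ht' ?_).elim
    rw [← this, Curve.image, ← Path.extend_range]
    exact mem_range_self r
  have h2 : D.hol g c'.path.extend = g () := by
    rw [hol_eq (s := {t}), oprod_singleton]
    · have e1 : D.out g c'.path.extend t = g () := by
        refine val_eq (i := ()) ⟨rfl, ?_⟩ g
        exact Filter.mem_map.2 (Filter.mem_of_superset (Ioo_mem_nhdsGT ht01.2)
          fun r hr => ⟨r, hr, rfl⟩)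
      have e2 : D.into g c'.path.extend t = 1 := by
        refine val_eq_one ?_ g
        rintro _ ⟨-, hj⟩
        obtain ⟨r, hr, q, hq, hqr⟩ := (Filter.Eventually.and
          (Ioo_mem_nhdsLT ht01.1 : ∀ᶠ r in 𝓝[<] t, r ∈ Ioo (0 : ℝ) t)
          (Filter.mem_map.1 hj)).exists
        have := IsRegularPiece.injOn hc' ⟨ht01.1.trans hq.1, hq.2⟩
          ⟨hr.1, hr.2.trans ht01.2⟩ hqr
        linarith [hr.2, hq.1]
      rw [jump, e1, e2]; simp
    · intro r hr
      have hr01 := active_subset_Icc (extend_nonpos c'.path) (extend_one_le c'.path) hr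
      obtain ⟨i, hi⟩ := hr
      have : c'.path.extend r = c'.path.extend t := by rcases hi with hi | hi <;> exact hi.1
      simpa using IsRegularPiece.eq_of_mem_Ioo hc' hr01 ht01 this
  have h3 := D.hol_equiv g h
  rw [h1, h2] at h3
  exact absurd (congrArg Multiplicative.toAdd h3) (by simp [g])

lemma Edge.image_eq [T2Space M] (e : Edge d M) {c : Curve d (M := M) e.src e.tgt}
    (hc : c.IsAnalytic) (h : c.toHom = e.hom) : e.image = c.image := by
  refine Subset.antisymm ?_ fun z hz => ⟨c, hc, h, hz⟩
  rintro z ⟨c', hc', h', hz⟩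
  exact Curve.image_subset_of_equiv hc' (_root_.Quotient.exact (h.trans h'.symm)) hz

end EdgeImage

/-! ### Half-branches of analytic curves -/

section Germs

open Filter

/-- Write `u s = s ^ k * g s` with `g 0 ≠ 0`. Positivity on the right forces `g 0 > 0`, so `g` has
an analytic `k`-th root and `α s = s * (g s) ^ (1 / k)` is a local analytic coordinate with inverse
`β`. -/
lemma exists_power_normal_form {u : ℝ → ℝ} (hu : AnalyticAt ℝ u 0) (h0 : u 0 = 0)
    (hpos : ∃ᶠ s in 𝓝[>] 0, 0 < u s) :
    ∃ (k : ℕ) (α β : ℝ → ℝ), k ≠ 0 ∧ AnalyticAt ℝ β 0 ∧ β 0 = 0 ∧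
      Tendsto β (𝓝[>] 0) (𝓝[>] 0) ∧ Tendsto α (𝓝[>] 0) (𝓝[>] 0) ∧
      ∀ᶠ s in 𝓝[>] 0, β (α s) = s ∧ u s = α s ^ k := by
  have hne : ¬ ∀ᶠ s in 𝓝 0, u s = 0 := fun h =>
    hpos ((h.filter_mono nhdsWithin_le_nhds).mono fun s hs => by simp [hs])
  obtain ⟨k, g, hg, hg0, hug⟩ := hu.exists_eventuallyEq_pow_smul_nonzero_iff.2 hne
  simp only [sub_zero, smul_eq_mul] at hug
  have hk : k ≠ 0 := by
    rintro rfl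
    have := hug.self_of_nhds
    simp [h0] at this
    exact hg0 this.symm
  have hgpos : 0 < g 0 := by
    by_contra hc
    have hlt : g 0 < 0 := lt_of_le_of_ne (not_lt.1 hc) hg0
    have hev : ∀ᶠ s in 𝓝 0, g s < 0 := hg.continuousAt.eventually_lt_const hlt
    refine hpos ?_
    filter_upwards [nhdsWithin_le_nhds hev, nhdsWithin_le_nhds hug, self_mem_nhdsWithin]
      with s h1 h2 h3
    rw [h2, not_lt]
    exact mul_nonpos_of_nonneg_of_nonpos (pow_nonneg (le_of_lt h3) k) h1.le
  let w : ℝ → ℝ := fun s => Real.exp (Real.log (g s) / k)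
  have hw : AnalyticAt ℝ w 0 := (AnalyticAt.div_const (hg.log hgpos)).rexp'
  let α : ℝ → ℝ := fun s => s * w s
  have hα : AnalyticAt ℝ α 0 := analyticAt_id.mul hw
  have hα0 : α 0 = 0 := by simp [α]
  have hd : deriv α 0 ≠ 0 := by
    have := (hasDerivAt_id (0 : ℝ)).mul hw.differentiableAt.hasDerivAt
    have h2 : HasDerivAt α (w 0) 0 := by
      simp only [id, one_mul, zero_mul, add_zero] at this
      exact this
    rw [h2.deriv]
    exact (Real.exp_pos _).ne'
  let β := hα.hasStrictDerivAt.localInverse _ _ _ hd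
  have hβ : AnalyticAt ℝ β 0 := by
    have := hα.analyticAt_localInverse hd
    rwa [hα0] at this
  have hl : ∀ᶠ s in 𝓝 0, β (α s) = s := HasStrictDerivAt.eventually_left_inverse ..
  have hr : ∀ᶠ r in 𝓝 0, α (β r) = r := by
    have := HasStrictDerivAt.eventually_right_inverse hα.hasStrictDerivAt hd
    rwa [hα0] at this
  have hβ0 : β 0 = 0 := by simpa [hα0] using hl.self_of_nhds
  refine ⟨k, α, β, hk, hβ, hβ0, ?_, ?_, ?_⟩
  · refine tendsto_nhdsWithin_iff.2 ⟨?_, ?_⟩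
    · have := hβ.continuousAt.tendsto
      rw [hβ0] at this
      exact this.mono_left nhdsWithin_le_nhds
    · filter_upwards [nhdsWithin_le_nhds hr, self_mem_nhdsWithin] with r h1 h2
      have h2' : 0 < β r * w (β r) := by
        rw [show β r * w (β r) = α (β r) from rfl, h1]; exact h2
      exact (pos_iff_pos_of_mul_pos h2').2 (Real.exp_pos _)
  · refine tendsto_nhdsWithin_iff.2 ⟨?_, ?_⟩
    · have := hα.continuousAt.tendsto
      rw [hα0] at this
      exact this.mono_left nhdsWithin_le_nhds
    · filter_upwards [self_mem_nhdsWithin] with s hs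
      exact mul_pos hs (Real.exp_pos _)
  · have hev : ∀ᶠ s in 𝓝 0, 0 < g s := hg.continuousAt.eventually_const_lt hgpos
    filter_upwards [nhdsWithin_le_nhds hl, nhdsWithin_le_nhds hug, nhdsWithin_le_nhds hev]
      with s h1 h2 h3
    refine ⟨h1, ?_⟩
    rw [h2, mul_pow, ← Real.exp_nat_mul, mul_div_cancel₀ _ (by exact_mod_cast hk),
      Real.exp_log h3]

/-- Half-branches of analytic curves that meet frequently near their starting point coincide. -/
lemma exists_reparam_of_frequently_meet {d : ℕ} {f f' : ℝ → EuclideanSpace ℝ (Fin d)}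
    (hf : AnalyticAt ℝ f 0) (hf' : AnalyticAt ℝ f' 0) (hne : ∃ᶠ s in 𝓝[>] 0, f s ≠ f 0)
    (hmeet : ∃ᶠ p : ℝ × ℝ in 𝓝[>] 0 ×ˢ 𝓝[>] 0, f p.1 = f' p.2) :
    ∃ θ : ℝ → ℝ, Tendsto θ (𝓝[>] 0) (𝓝[>] 0) ∧ ∀ᶠ s in 𝓝[>] 0, f s = f' (θ s) := by
  have t1 : Tendsto (Prod.fst : ℝ × ℝ → ℝ) (𝓝[>] 0 ×ˢ 𝓝[>] 0) (𝓝[>] 0) := tendsto_fst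
  have t2 : Tendsto (Prod.snd : ℝ × ℝ → ℝ) (𝓝[>] 0 ×ˢ 𝓝[>] 0) (𝓝[>] 0) := tendsto_snd
  have h00 : f 0 = f' 0 := tendsto_nhds_unique_of_frequently_eq
    (hf.continuousAt.tendsto.comp (t1.mono_right nhdsWithin_le_nhds))
    (hf'.continuousAt.tendsto.comp (t2.mono_right nhdsWithin_le_nhds)) hmeet
  have hcoord : ∃ i, ¬ ∀ᶠ s in 𝓝 0, f s i - f 0 i = 0 := by
    by_contra hc
    push Not at hc
    refine hne (nhdsWithin_le_nhds ?_)
    filter_upwards [eventually_all.2 hc] with s hs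
    rw [not_not]
    ext i
    exact sub_eq_zero.1 (hs i)
  obtain ⟨i, hi⟩ := hcoord
  let pr : EuclideanSpace ℝ (Fin d) →L[ℝ] ℝ := EuclideanSpace.proj i
  have hv : AnalyticAt ℝ (fun s => f s i - f 0 i) 0 :=
    ((pr.analyticAt _).comp hf).sub analyticAt_const
  have hv' : AnalyticAt ℝ (fun s => f' s i - f 0 i) 0 :=
    ((pr.analyticAt _).comp hf').sub analyticAt_const
  have hnz : ∀ᶠ s in 𝓝[>] 0, f s i - f 0 i ≠ 0 :=
    (hv.eventually_eq_zero_or_eventually_ne_zero.resolve_left hi).filter_mono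
      (nhdsWithin_mono _ fun s hs => ne_of_gt hs)
  -- The chosen coordinate differs from its initial value at the meeting points near `0`. One sign
  -- occurs frequently among them and makes both normal forms available.
  obtain ⟨sg, hsg⟩ : ∃ sg : ℝ, ∃ᶠ p : ℝ × ℝ in 𝓝[>] 0 ×ˢ 𝓝[>] 0,
      0 < sg * (f p.1 i - f 0 i) ∧ f p.1 = f' p.2 := by
    have h1 : ∃ᶠ p : ℝ × ℝ in 𝓝[>] 0 ×ˢ 𝓝[>] 0,
        (0 < 1 * (f p.1 i - f 0 i) ∧ f p.1 = f' p.2) ∨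
        (0 < (-1) * (f p.1 i - f 0 i) ∧ f p.1 = f' p.2) := by
      refine (hmeet.and_eventually (t1.eventually hnz)).mono fun p hp => ?_
      rcases lt_or_gt_of_ne hp.2 with h | h
      · right; exact ⟨by linarith, hp.1⟩
      · left; exact ⟨by linarith, hp.1⟩
    rcases frequently_or_distrib.1 h1 with h | h
    exacts [⟨_, h⟩, ⟨_, h⟩]
  obtain ⟨k, α, β, hk, hβ, hβ0, hβt, hαt, hk'⟩ := exists_power_normal_form
    (u := fun s => sg * (f s i - f 0 i)) (analyticAt_const.mul hv) (by simp)
    (t1.frequently (hsg.mono fun p hp => hp.1))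
  obtain ⟨l, α', β', hl, hβ', hβ'0, hβ't, hα't, hl'⟩ := exists_power_normal_form
    (u := fun s => sg * (f' s i - f 0 i)) (analyticAt_const.mul hv') (by simp [h00])
    (t2.frequently (hsg.mono fun p hp => by rw [← hp.2]; exact hp.1))
  -- At a meeting `(s, s')` the normal forms give `α s ^ k = α' s' ^ l`. With `r = (α s) ^ (1 / l)`
  -- this means `α s = r ^ l` and `α' s' = r ^ k`, so `r` is a common parameter for both branches.
  let ρ : ℝ → ℝ := fun s => α s ^ ((l : ℝ)⁻¹)
  have hρ : Tendsto ρ (𝓝[>] 0) (𝓝[>] 0) := by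
    refine Tendsto.comp (g := fun x : ℝ => x ^ ((l : ℝ)⁻¹)) (tendsto_nhdsWithin_iff.2 ⟨?_, ?_⟩) hαt
    · have hl0 : (0 : ℝ) < (l : ℝ)⁻¹ := by positivity
      have := (Real.continuousAt_rpow_const (0 : ℝ) ((l : ℝ)⁻¹) (.inr hl0.le)).tendsto
      rw [Real.zero_rpow hl0.ne'] at this
      exact this.mono_left nhdsWithin_le_nhds
    · filter_upwards [self_mem_nhdsWithin] with s hs using Real.rpow_pos_of_pos hs _
  have hαpos : ∀ᶠ s in 𝓝[>] 0, 0 < α s := hαt.eventually self_mem_nhdsWithin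
  have hα'pos : ∀ᶠ s in 𝓝[>] 0, 0 < α' s := hα't.eventually self_mem_nhdsWithin
  have hρpos : ∀ᶠ s in 𝓝[>] 0, 0 < ρ s := hρ.eventually self_mem_nhdsWithin
  have hρl : ∀ᶠ s in 𝓝[>] 0, ρ s ^ l = α s :=
    hαpos.mono fun s hs => Real.rpow_inv_natCast_pow hs.le hl
  let F : ℝ → EuclideanSpace ℝ (Fin d) := fun r => f (β (r ^ l))
  let F' : ℝ → EuclideanSpace ℝ (Fin d) := fun r => f' (β' (r ^ k))
  have hpw : ∀ j : ℕ, AnalyticAt ℝ (fun r : ℝ => r ^ j) 0 := fun j => analyticAt_id.pow j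
  have hF : AnalyticAt ℝ F 0 := by
    refine AnalyticAt.fun_comp (f := fun r : ℝ => β (r ^ l)) ?_ (AnalyticAt.fun_comp ?_ (hpw l))
    · simpa [hl, hβ0] using hf
    · simpa [hl] using hβ
  have hF' : AnalyticAt ℝ F' 0 := by
    refine AnalyticAt.fun_comp (f := fun r : ℝ => β' (r ^ k)) ?_ (AnalyticAt.fun_comp ?_ (hpw k))
    · simpa [hk, hβ'0] using hf'
    · simpa [hk] using hβ'
  -- Meeting points become coincidences of `F` and `F'` at the same `r`, and the identity theorem
  -- then applies to these two analytic functions.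
  have hFF : ∃ᶠ r in 𝓝[≠] 0, F r = F' r := by
    have ht : Tendsto (fun p : ℝ × ℝ => ρ p.1) (𝓝[>] 0 ×ˢ 𝓝[>] 0) (𝓝[≠] 0) :=
      (hρ.comp t1).mono_right (nhdsWithin_mono _ fun s hs => ne_of_gt hs)
    refine ht.frequently ((hsg.and_eventually ((t1.eventually (hk'.and (hρl.and hρpos))).and
      (t2.eventually (hl'.and hα'pos)))).mono ?_)
    rintro ⟨s, s'⟩ ⟨⟨-, hss⟩, ⟨⟨hb, hu⟩, hρs, hρp⟩, ⟨hb', hu'⟩, hp'⟩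
    dsimp only at hss hb hu hρs hρp hb' hu' hp'
    have e1 : (ρ s ^ k) ^ l = α' s' ^ l := by
      rw [← hu', ← hss, hu, ← hρs]; ring
    have e2 : ρ s ^ k = α' s' := (pow_left_inj₀ (pow_nonneg hρp.le k) hp'.le hl).1 e1
    simp only [F, F']
    rw [hρs, e2, hb, hb', hss]
  have hFev := (hF.frequently_eq_iff_eventually_eq hF').1 hFF
  refine ⟨fun s => β' (ρ s ^ k), hβ't.comp (Tendsto.comp (tendsto_nhdsWithin_iff.2 ⟨?_, ?_⟩) hρ),
    ?_⟩
  · have := (continuous_pow (M := ℝ) k).tendsto 0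
    rw [zero_pow hk] at this
    exact this.mono_left nhdsWithin_le_nhds
  · filter_upwards [self_mem_nhdsWithin] with s hs using pow_pos (mem_Ioi.1 hs) k
  · filter_upwards [(hρ.mono_right nhdsWithin_le_nhds).eventually hFev, hk', hρl] with s h1 h2 h3
    simp only [F, F', h3, h2.1] at h1
    exact h1

end Germs

/-! ### Finitely many cuts separate coincidence from disjointness -/

section Branches

open Filter

variable {d : ℕ} {M : Type u} [TopologicalSpace M] [ChartedSpace (EuclideanSpace ℝ (Fin d)) M]

/-- Analyticity up to an end point supplies a coordinate expression that continues analytically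
beyond it. -/
lemma IsRegularPiece.exists_analyticAt [IsManifold (𝓡 d) ω M] {γ : ℝ → M} {a b t : ℝ}
    (h : IsRegularPiece d γ a b) (ht : t ∈ Icc a b) :
    ∃ f : ℝ → EuclideanSpace ℝ (Fin d), AnalyticAt ℝ f t ∧
      ∀ᶠ s in 𝓝[Icc a b] t, γ s ∈ (extChartAt (𝓡 d) (γ t)).source ∧
        extChartAt (𝓡 d) (γ t) (γ s) = f s := by
  have h1 := contMDiffWithinAt_iff_target.1 (h.analytic t ht)
  have h2 : ContDiffWithinAt ℝ ω (extChartAt (𝓡 d) (γ t) ∘ γ) (Icc a b) t :=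
    contMDiffWithinAt_iff_contDiffWithinAt.1 h1.2
  obtain ⟨f, -, hf, hfa⟩ := h2.analyticWithinAt.exists_analyticAt
  have hev : ∀ᶠ s in 𝓝[Icc a b] t, γ s ∈ (extChartAt (𝓡 d) (γ t)).source :=
    h1.1.eventually (extChartAt_source_mem_nhds _)
  refine ⟨f, hfa, ?_⟩
  filter_upwards [hev, self_mem_nhdsWithin] with s h1 h2 using ⟨h1, hf (mem_insert_of_mem _ h2)⟩

/-- The points of `[a, b]` in the frontier of `{s | P s}` serve as cuts. An accumulation point of
them would contradict the one-sided constancy there, and between cuts connectedness applies. -/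
lemma finite_changes {P : ℝ → Prop} {a b : ℝ}
    (hr : ∀ t ∈ Ico a b, (∀ᶠ s in 𝓝[>] t, P s) ∨ ∀ᶠ s in 𝓝[>] t, ¬ P s)
    (hl : ∀ t ∈ Ioc a b, (∀ᶠ s in 𝓝[<] t, P s) ∨ ∀ᶠ s in 𝓝[<] t, ¬ P s) :
    ∃ F : Set ℝ, F.Finite ∧ F ⊆ Icc a b ∧ ∀ u v, Ioo u v ⊆ Icc a b → Disjoint (Ioo u v) F →
      (∀ s ∈ Ioo u v, P s) ∨ ∀ s ∈ Ioo u v, ¬ P s := by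
  have key : ∀ (t : ℝ) (U : Set ℝ), IsOpen U →
      ((∀ᶠ s in 𝓝[U] t, P s) ∨ ∀ᶠ s in 𝓝[U] t, ¬ P s) →
      ∀ᶠ s in 𝓝[U] t, s ∉ frontier {s | P s} := by
    intro t U hU h
    rcases h with h | h
    · filter_upwards [eventually_eventually_nhdsWithin.2 h, self_mem_nhdsWithin] with s hs hsU
      rw [hU.nhdsWithin_eq hsU] at hs
      exact fun hc => hc.2 (mem_interior_iff_mem_nhds.2 hs)
    · filter_upwards [eventually_eventually_nhdsWithin.2 h, self_mem_nhdsWithin] with s hs hsU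
      rw [hU.nhdsWithin_eq hsU] at hs
      rw [← frontier_compl]
      exact fun hc => hc.2 (mem_interior_iff_mem_nhds.2 hs)
  refine ⟨frontier {s | P s} ∩ Icc a b, ?_, inter_subset_right, ?_⟩
  · by_contra hinf
    obtain ⟨x, hx, hacc⟩ := Set.Infinite.exists_accPt_of_subset_isCompact hinf isCompact_Icc
      inter_subset_right
    rw [accPt_iff_frequently_nhdsNE] at hacc
    refine hacc ?_
    rw [← Iio_union_Ioi, nhdsWithin_union, eventually_sup]
    constructor
    · by_cases hxa : a < x
      · filter_upwards [key x _ isOpen_Iio (hl x ⟨hxa, hx.2⟩)] with s hs hc using hs hc.1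
      · filter_upwards [self_mem_nhdsWithin] with s hs hc
        exact hxa (hc.2.1.trans_lt hs)
    · by_cases hxb : x < b
      · filter_upwards [key x _ isOpen_Ioi (hr x ⟨hx.1, hxb⟩)] with s hs hc using hs hc.1
      · filter_upwards [self_mem_nhdsWithin] with s hs hc
        exact hxb (lt_of_lt_of_le hs hc.2.2)
  · intro u v huv hdis
    by_contra hc
    push Not at hc
    obtain ⟨⟨s, hs, hs'⟩, s', hs2, hs2'⟩ := hc
    have hfr : ∀ x ∈ Ioo u v, x ∉ frontier {s | P s} := fun x hx hxf =>
      Set.disjoint_left.1 hdis hx ⟨hxf, huv hx⟩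
    have hmem : ∀ x ∈ Ioo u v, P x → x ∈ interior {s | P s} := fun x hx hxP => by
      by_contra hxi
      exact hfr x hx ⟨subset_closure hxP, hxi⟩
    have hmem' : ∀ x ∈ Ioo u v, ¬ P x → x ∈ interior {s | P s}ᶜ := fun x hx hxP => by
      by_contra hxi
      refine hfr x hx ?_
      rw [← frontier_compl]
      exact ⟨subset_closure hxP, hxi⟩
    obtain ⟨x, -, hx1, hx2⟩ := isPreconnected_Ioo (a := u) (b := v) _ _ isOpen_interior
      isOpen_interior (fun x hx => (em (P x)).imp (hmem x hx) (hmem' x hx))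
      ⟨s', hs2, hmem s' hs2 hs2'⟩ ⟨s, hs, hmem' s hs hs'⟩
    exact interior_subset hx2 (interior_subset hx1)

/-- The substitution `t + ε * s` turns either side of `t` into a germ at `0` from the right. The
chart is fixed at `p`, so branches of different curves through `p` can be compared. -/
lemma IsRegularPiece.exists_branch [IsManifold (𝓡 d) ω M] {γ : ℝ → M} {a b t ε : ℝ} {p : M}
    (h : IsRegularPiece d γ a b) (ht : t ∈ Icc a b) (hp : γ t = p)
    (hin : ∀ᶠ s in 𝓝[>] (0 : ℝ), t + ε * s ∈ Ioo a b) :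
    ∃ f : ℝ → EuclideanSpace ℝ (Fin d), AnalyticAt ℝ f 0 ∧ f 0 = extChartAt (𝓡 d) p p ∧
      ∀ᶠ s in 𝓝[>] (0 : ℝ), γ (t + ε * s) ∈ (extChartAt (𝓡 d) p).source ∧
        extChartAt (𝓡 d) p (γ (t + ε * s)) = f s := by
  subst hp
  obtain ⟨f, hf, hev⟩ := h.exists_analyticAt ht
  have hlin : AnalyticAt ℝ (fun s : ℝ => t + ε * s) 0 := by fun_prop
  have htend : Tendsto (fun s : ℝ => t + ε * s) (𝓝[>] 0) (𝓝[Icc a b] t) := by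
    refine tendsto_nhdsWithin_iff.2 ⟨?_, hin.mono fun s hs => Ioo_subset_Icc_self hs⟩
    have := hlin.continuousAt.tendsto
    simp only [mul_zero, add_zero] at this
    exact this.mono_left nhdsWithin_le_nhds
  refine ⟨fun s => f (t + ε * s), AnalyticAt.fun_comp (by simpa using hf) hlin, ?_,
    htend.eventually hev⟩
  simpa using ((hev.self_of_nhdsWithin ht).2).symm

/-- Seen from one side, a regular piece runs either inside or outside of the image of another. -/
lemma IsRegularPiece.eventually_mem_or_notMem [IsManifold (𝓡 d) ω M] [T2Space M] {γ γ' : ℝ → M}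
    {a b a' b' t ε : ℝ} (h : IsRegularPiece d γ a b) (h' : IsRegularPiece d γ' a' b')
    (ht : t ∈ Icc a b) (hε : ε ≠ 0) (hin : ∀ᶠ s in 𝓝[>] (0 : ℝ), t + ε * s ∈ Ioo a b) :
    (∀ᶠ s in 𝓝[>] (0 : ℝ), γ (t + ε * s) ∈ γ' '' Icc a' b') ∨
      ∀ᶠ s in 𝓝[>] (0 : ℝ), γ (t + ε * s) ∉ γ' '' Icc a' b' := by
  by_cases hout : ∀ᶠ s in 𝓝[>] (0 : ℝ), γ (t + ε * s) ∉ γ' '' Icc a' b'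
  · exact .inr hout
  left
  have hfr : ∃ᶠ s in 𝓝[>] (0 : ℝ), ∃ q, q ∈ Icc a' b' ∧ γ' q = γ (t + ε * s) := hout
  -- It remains to pass from "frequently" to "eventually". The filter `l` restricts attention to the
  -- parameters at which the image is met.
  let l : Filter ℝ := 𝓝[>] (0 : ℝ) ⊓ 𝓟 {s | ∃ q, q ∈ Icc a' b' ∧ γ' q = γ (t + ε * s)}
  have hl : l.NeBot := frequently_mem_iff_neBot.1 hfr
  have hchoice : ∀ s, ∃ q, (∃ q, q ∈ Icc a' b' ∧ γ' q = γ (t + ε * s)) →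
      q ∈ Icc a' b' ∧ γ' q = γ (t + ε * s) := fun s => by
    by_cases hs : ∃ q, q ∈ Icc a' b' ∧ γ' q = γ (t + ε * s)
    · obtain ⟨q, hq⟩ := hs
      exact ⟨q, fun _ => hq⟩
    · exact ⟨0, fun h => (hs h).elim⟩
  choose q hq using hchoice
  have hql : ∀ᶠ s in l, q s ∈ Icc a' b' ∧ γ' (q s) = γ (t + ε * s) :=
    mem_inf_of_right (mem_principal.2 hq)
  obtain ⟨t', ht', hcl⟩ := isCompact_Icc.exists_mapClusterPt (f := l) (u := q)
    (le_principal_iff.2 (hql.mono fun s hs => hs.1))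
  -- By compactness the preimages `q s` converge along an ultrafilter to a parameter `t'`, and `γ'
  -- t' = γ t` by continuity.
  obtain ⟨l2, hl2l, hqt⟩ := mapClusterPt_iff_ultrafilter.1 hcl
  have hl20 : (l2 : Filter ℝ) ≤ 𝓝[>] 0 := hl2l.trans inf_le_left
  have hpt : γ' t' = γ t := by
    have e1 : Tendsto (fun s => γ' (q s)) l2 (𝓝 (γ' t')) :=
      (h'.continuousOn t' ht').tendsto.comp (tendsto_nhdsWithin_iff.2
        ⟨hqt, hl2l (hql.mono fun s hs => hs.1)⟩)
    have e2 : Tendsto (fun s => γ (t + ε * s)) l2 (𝓝 (γ t)) := by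
      refine (h.continuousOn t ht).tendsto.comp (tendsto_nhdsWithin_iff.2
        ⟨?_, hl20 (hin.mono fun s hs => Ioo_subset_Icc_self hs)⟩)
      have : Continuous fun s : ℝ => t + ε * s := by fun_prop
      have := this.tendsto 0
      simp only [mul_zero, add_zero] at this
      exact this.mono_left (hl20.trans nhdsWithin_le_nhds)
    exact tendsto_nhds_unique e1 (e2.congr' (hl2l (hql.mono fun s hs => hs.2.symm)))
  have hinj : ∀ᶠ s in 𝓝[>] (0 : ℝ), γ (t + ε * s) ≠ γ t := by
    filter_upwards [hin, self_mem_nhdsWithin] with s hs hs0 heq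
    have := h.eq_of_mem_Ioo ht hs heq.symm
    have : ε * s = 0 := by linarith
    exact (mul_ne_zero hε (ne_of_gt hs0)) this
  have hne : ∀ᶠ s in l2, q s ≠ t' := by
    filter_upwards [hl20 hinj, hl2l hql] with s h1 h2 h3
    exact h1 (by rw [← h2.2, h3, hpt])
  -- The preimages approach `t'` without being equal to it, hence frequently from one fixed side;
  -- the sign `ε'` records which.
  obtain ⟨ε', hε', hfr2⟩ : ∃ ε' : ℝ, ε' * ε' = 1 ∧ ∃ᶠ s in l2, 0 < ε' * (q s - t') := by
    have h1 : ∃ᶠ s in l2, 0 < (1 : ℝ) * (q s - t') ∨ 0 < (-1 : ℝ) * (q s - t') := by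
      refine (hne.mono fun s hs => ?_).frequently
      rcases lt_or_gt_of_ne hs with h | h
      · right; linarith
      · left; linarith
    rcases frequently_or_distrib.1 h1 with h | h
    exacts [⟨1, by norm_num, h⟩, ⟨-1, by norm_num, h⟩]
  have hin' : ∀ᶠ s in 𝓝[>] (0 : ℝ), t' + ε' * s ∈ Ioo a' b' := by
    obtain ⟨s0, hs0, hs1, -⟩ := (hfr2.and_eventually (hl2l hql)).exists
    have hpos : 0 < ε' * (q s0 - t') := hs0
    filter_upwards [Ioo_mem_nhdsGT hpos] with s hs
    rcases mul_self_eq_one_iff.1 hε' with rfl | rfl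
    · constructor
      · linarith [hs.1, ht'.1]
      · linarith [hs.2, hs1.2]
    · constructor
      · linarith [hs.2, hs1.1]
      · linarith [hs.1, ht'.2]
  obtain ⟨f, hf, hf0, hfe⟩ := h.exists_branch ht rfl hin
  obtain ⟨f', hf', -, hfe'⟩ := h'.exists_branch ht' hpt hin'
  have hmeet : ∃ᶠ p : ℝ × ℝ in 𝓝[>] 0 ×ˢ 𝓝[>] 0, f p.1 = f' p.2 := by
    let l3 : Filter ℝ := l2 ⊓ 𝓟 {s | 0 < ε' * (q s - t')}
    have hl3 : l3.NeBot := frequently_mem_iff_neBot.1 hfr2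
    have hl32 : l3 ≤ l2 := inf_le_left
    have g1 : Tendsto (fun s : ℝ => ε' * (q s - t')) l3 (𝓝[>] 0) := by
      refine tendsto_nhdsWithin_iff.2 ⟨?_, mem_inf_of_right (mem_principal_self _)⟩
      have := (hqt.sub_const t').const_mul ε'
      rw [sub_self, mul_zero] at this
      exact this.mono_left hl32
    have g2 : Tendsto (fun s : ℝ => (s, ε' * (q s - t'))) l3 (𝓝[>] 0 ×ˢ 𝓝[>] 0) :=
      Tendsto.prodMk (hl32.trans hl20) g1
    refine g2.frequently (Eventually.frequently ?_)
    filter_upwards [hl32 (hl20 hfe), g1.eventually hfe', hl32 (hl2l hql)] with s h1 h2 h3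
    have e1 : t' + ε' * (ε' * (q s - t')) = q s := by rw [← mul_assoc, hε']; ring
    rw [e1] at h2
    rw [← h1.2, ← h2.2, h3.2]
  have hnc : ∃ᶠ s in 𝓝[>] (0 : ℝ), f s ≠ f 0 := by
    refine Eventually.frequently ?_
    filter_upwards [hinj, hfe] with s h1 h2 h3
    rw [← h2.2, hf0] at h3
    exact h1 ((extChartAt (𝓡 d) (γ t)).injOn h2.1 (mem_extChartAt_source _) h3)
  obtain ⟨θ, hθ, hfθ⟩ := exists_reparam_of_frequently_meet hf hf' hnc hmeet
  filter_upwards [hfe, hfθ, hθ.eventually hfe', hθ.eventually hin'] with s h1 h2 h3 h4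
  refine ⟨t' + ε' * θ s, Ioo_subset_Icc_self h4, ?_⟩
  exact (extChartAt (𝓡 d) (γ t)).injOn h3.1 h1.1 (by rw [h1.2, h2, h3.2])

/-- The parameter interval of a regular piece is cut by finitely many points into intervals that
are mapped either into the image of another regular piece or into its complement. -/
lemma IsRegularPiece.exists_cuts [IsManifold (𝓡 d) ω M] [T2Space M] {γ γ' : ℝ → M}
    {a b a' b' : ℝ} (h : IsRegularPiece d γ a b) (h' : IsRegularPiece d γ' a' b') :
    ∃ F : Set ℝ, F.Finite ∧ F ⊆ Icc a b ∧ ∀ u v, Ioo u v ⊆ Icc a b → Disjoint (Ioo u v) F →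
      (∀ s ∈ Ioo u v, γ s ∈ γ' '' Icc a' b') ∨ ∀ s ∈ Ioo u v, γ s ∉ γ' '' Icc a' b' := by
  have hgt : ∀ (t : ℝ), Tendsto (fun s => s - t) (𝓝[>] t) (𝓝[>] 0) := fun t => by
    refine tendsto_nhdsWithin_iff.2 ⟨?_, ?_⟩
    · have : Continuous fun s : ℝ => s - t := by fun_prop
      have := this.tendsto t
      rw [sub_self] at this
      exact this.mono_left nhdsWithin_le_nhds
    · filter_upwards [self_mem_nhdsWithin] with s hs using sub_pos.2 (by simpa using hs)
  have hlt : ∀ (t : ℝ), Tendsto (fun s => t - s) (𝓝[<] t) (𝓝[>] 0) := fun t => by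
    refine tendsto_nhdsWithin_iff.2 ⟨?_, ?_⟩
    · have : Continuous fun s : ℝ => t - s := by fun_prop
      have := this.tendsto t
      rw [sub_self] at this
      exact this.mono_left nhdsWithin_le_nhds
    · filter_upwards [self_mem_nhdsWithin] with s hs using sub_pos.2 (by simpa using hs)
  refine finite_changes (fun t ht => ?_) fun t ht => ?_
  · have hin : ∀ᶠ s in 𝓝[>] (0 : ℝ), t + 1 * s ∈ Ioo a b := by
      filter_upwards [Ioo_mem_nhdsGT (sub_pos.2 ht.2)] with s hs
      exact ⟨by linarith [hs.1, ht.1], by linarith [hs.2]⟩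
    refine (h.eventually_mem_or_notMem h' (Ico_subset_Icc_self ht) one_ne_zero hin).imp ?_ ?_
    all_goals
      intro hh
      filter_upwards [(hgt t).eventually hh] with s hs
      simpa using hs
  · have hin : ∀ᶠ s in 𝓝[>] (0 : ℝ), t + (-1) * s ∈ Ioo a b := by
      filter_upwards [Ioo_mem_nhdsGT (sub_pos.2 ht.1)] with s hs
      exact ⟨by linarith [hs.2], by linarith [hs.1, ht.2]⟩
    refine (h.eventually_mem_or_notMem h' (Ioc_subset_Icc_self ht) (by norm_num) hin).imp ?_ ?_
    all_goals
      intro hh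
      filter_upwards [(hlt t).eventually hh] with s hs
      simpa using hs

end Branches

/-! ### Analytic curves with equal images are reparametrizations of each other -/

section Reparametrization

open Filter

variable {d : ℕ} {M : Type u} [TopologicalSpace M] [ChartedSpace (EuclideanSpace ℝ (Fin d)) M]

/-- Near `t` the curve is the inverse chart after `f`, so `deriv f t = 0` would contradict the
immersion property. -/
lemma IsRegularPiece.exists_analyticAt_deriv_ne_zero [IsManifold (𝓡 d) ω M] {γ : ℝ → M}
    {a b t : ℝ} (h : IsRegularPiece d γ a b) (ht : t ∈ Ioo a b) :
    ∃ f : ℝ → EuclideanSpace ℝ (Fin d), AnalyticAt ℝ f t ∧ deriv f t ≠ 0 ∧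
      ∀ᶠ s in 𝓝 t, γ s ∈ (extChartAt (𝓡 d) (γ t)).source ∧
        extChartAt (𝓡 d) (γ t) (γ s) = f s := by
  obtain ⟨f, hf, hev⟩ := h.exists_analyticAt (Ioo_subset_Icc_self ht)
  rw [nhdsWithin_eq_nhds.2 (Icc_mem_nhds ht.1 ht.2)] at hev
  refine ⟨f, hf, fun hd => h.immersion t ht ?_, hev⟩
  have hft : f t = extChartAt (𝓡 d) (γ t) (γ t) := hev.self_of_nhds.2.symm
  have h1 : γ =ᶠ[𝓝 t] (extChartAt (𝓡 d) (γ t)).symm ∘ f := by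
    filter_upwards [hev] with s hs
    rw [Function.comp, ← hs.2, PartialEquiv.left_inv _ hs.1]
  have h2 : MDifferentiableAt 𝓘(ℝ, EuclideanSpace ℝ (Fin d)) (𝓡 d)
      (extChartAt (𝓡 d) (γ t)).symm (f t) := by
    have h0 : ContMDiffOn 𝓘(ℝ, EuclideanSpace ℝ (Fin d)) (𝓡 d) ω
        (extChartAt (𝓡 d) (γ t)).symm (extChartAt (𝓡 d) (γ t)).target :=
      contMDiffOn_extChartAt_symm (γ t)
    have := h0.contMDiffAt (x := f t) (by rw [hft]; exact extChartAt_target_mem_nhds (γ t))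
    exact this.mdifferentiableAt (by simp)
  have h3 : HasFDerivAt f (0 : ℝ →L[ℝ] EuclideanSpace ℝ (Fin d)) t := by
    have := hf.differentiableAt.hasDerivAt.hasFDerivAt
    rw [hd] at this
    simpa using this
  have h4 := (h2.hasMFDerivAt.comp t h3.hasMFDerivAt).mfderiv
  rw [h1.mfderiv_eq, h4]
  exact ContinuousLinearMap.comp_zero _

/-- A continuous change of parameter between two regular pieces is an analytic immersion. -/
lemma analyticAt_of_comp_eq [IsManifold (𝓡 d) ω M] {γ γ' : ℝ → M} {H : ℝ → ℝ}
    {a b a' b' t : ℝ} (h : IsRegularPiece d γ a b) (h' : IsRegularPiece d γ' a' b')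
    (ht : t ∈ Ioo a b) (ht' : H t ∈ Ioo a' b') (hH : ContinuousAt H t)
    (heq : ∀ᶠ s in 𝓝 t, γ s = γ' (H s)) : AnalyticAt ℝ H t ∧ deriv H t ≠ 0 := by
  obtain ⟨f, hf, hfd, hfe⟩ := h.exists_analyticAt_deriv_ne_zero ht
  obtain ⟨f', hf', hfd', hfe'⟩ := h'.exists_analyticAt_deriv_ne_zero ht'
  rw [← heq.self_of_nhds] at hfe'
  have hff : f =ᶠ[𝓝 t] f' ∘ H := by
    filter_upwards [hfe, hH.eventually hfe', heq] with s h1 h2 h3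
    rw [Function.comp, ← h1.2, ← h2.2, h3]
  -- A coordinate of `f'` with non-zero derivative has an analytic local inverse `r`, and `H` is `r`
  -- after the same coordinate of `f`.
  obtain ⟨i, hi⟩ : ∃ i, deriv f' (H t) i ≠ 0 := by
    by_contra hc
    push Not at hc
    exact hfd' (by ext i; exact hc i)
  let pr : EuclideanSpace ℝ (Fin d) →L[ℝ] ℝ := EuclideanSpace.proj i
  have hv : AnalyticAt ℝ (fun s => f' s i) (H t) := (pr.analyticAt _).comp hf'
  have hvd : deriv (fun s => f' s i) (H t) ≠ 0 := by
    have := pr.hasFDerivAt.comp_hasDerivAt (H t) hf'.differentiableAt.hasDerivAt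
    have e : deriv (fun s => f' s i) (H t) = deriv f' (H t) i := this.deriv
    rwa [e]
  let r := hv.hasStrictDerivAt.localInverse _ _ _ hvd
  have hr : AnalyticAt ℝ r (f' (H t) i) := hv.analyticAt_localInverse hvd
  have hl : ∀ᶠ s in 𝓝 (H t), r (f' s i) = s := HasStrictDerivAt.eventually_left_inverse ..
  have hHa : AnalyticAt ℝ H t := by
    have h1 : AnalyticAt ℝ (fun s => r (f s i)) t := by
      refine AnalyticAt.fun_comp (g := r) (f := fun s => f s i) ?_ ((pr.analyticAt _).comp hf)
      have : f t = f' (H t) := hff.self_of_nhds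
      rwa [this]
    refine h1.congr ?_
    filter_upwards [hff, hH.eventually hl] with s h1 h2
    rw [h1, Function.comp, h2]
  refine ⟨hHa, fun h0 => hfd ?_⟩
  have h1 := (hf'.differentiableAt.hasDerivAt).scomp t hHa.differentiableAt.hasDerivAt
  rw [hff.deriv_eq, h1.deriv, h0, zero_smul]

/-- `H` is the inverse of `γ'` after `γ`. It is continuous since `γ'` is an embedding, and a
continuous injection of an interval is strictly monotone. -/
lemma exists_transition {γ γ' : ℝ → M} (h : IsRegularPiece d γ 0 1) (h' : IsRegularPiece d γ' 0 1)
    (him : γ '' Ioo 0 1 = γ' '' Ioo 0 1) :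
    ∃ H : ℝ → ℝ, MapsTo H (Ioo 0 1) (Ioo 0 1) ∧ (∀ t ∈ Ioo (0 : ℝ) 1, γ t = γ' (H t)) ∧
      ContinuousOn H (Ioo 0 1) ∧ SurjOn H (Ioo 0 1) (Ioo 0 1) ∧
      (StrictMonoOn H (Ioo 0 1) ∨ StrictAntiOn H (Ioo 0 1)) := by
  have hch : ∀ t : ℝ, ∃ s, t ∈ Ioo (0 : ℝ) 1 → s ∈ Ioo (0 : ℝ) 1 ∧ γ t = γ' s := fun t => by
    by_cases ht : t ∈ Ioo (0 : ℝ) 1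
    · obtain ⟨s, hs, hst⟩ : γ t ∈ γ' '' Ioo 0 1 := him ▸ mem_image_of_mem γ ht
      exact ⟨s, fun _ => ⟨hs, hst.symm⟩⟩
    · exact ⟨0, fun h => (ht h).elim⟩
  choose H hH using hch
  have hmaps : MapsTo H (Ioo 0 1) (Ioo 0 1) := fun t ht => (hH t ht).1
  have hcont : ContinuousOn H (Ioo 0 1) := by
    have h1 : Continuous (hmaps.restrict) := by
      rw [h'.embedding.isInducing.continuous_iff]
      have : (Ioo (0 : ℝ) 1).domRestrict γ' ∘ hmaps.restrict = (Ioo (0 : ℝ) 1).domRestrict γ :=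
        funext fun t => ((hH t t.2).2).symm
      rw [this]
      exact h.embedding.continuous
    rw [continuousOn_iff_continuous_domRestrict]
    exact continuous_subtype_val.comp h1
  have hinj : InjOn H (Ioo 0 1) := fun s hs t ht hst =>
    h.injOn hs ht (by rw [(hH s hs).2, (hH t ht).2, hst])
  refine ⟨H, hmaps, fun t ht => (hH t ht).2, hcont, fun s hs => ?_,
    hcont.strictMonoOn_of_injOn_Ioo zero_lt_one hinj⟩
  obtain ⟨t, ht, hts⟩ : γ' s ∈ γ '' Ioo 0 1 := him ▸ mem_image_of_mem γ' hs
  exact ⟨t, ht, h'.injOn (hmaps ht) hs (by rw [← (hH t ht).2, hts])⟩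

lemma exists_isReparam [IsManifold (𝓡 d) ω M] [T2Space M] {γ γ' : ℝ → M} {H : ℝ → ℝ}
    (h : IsRegularPiece d γ 0 1)
    (h' : IsRegularPiece d γ' 0 1) (hmaps : MapsTo H (Ioo 0 1) (Ioo 0 1))
    (heq : ∀ t ∈ Ioo (0 : ℝ) 1, γ t = γ' (H t)) (hcont : ContinuousOn H (Ioo 0 1))
    (hsurj : SurjOn H (Ioo 0 1) (Ioo 0 1)) (hmono : StrictMonoOn H (Ioo 0 1)) :
    ∃ ψ, IsReparam ψ ∧ ∀ t ∈ Icc (0 : ℝ) 1, γ t = γ' (ψ t) := by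
  -- Continued by the identity, `H` is a strictly increasing surjection of `ℝ`, hence continuous;
  -- this settles the behaviour at `0` and `1`.
  let ψ : ℝ → ℝ := fun t => if t ∈ Ioo (0 : ℝ) 1 then H t else t
  have h0 : ψ 0 = 0 := by simp [ψ]
  have h1 : ψ 1 = 1 := by simp [ψ]
  have hψ : ∀ t ∈ Ioo (0 : ℝ) 1, ψ t = H t := fun t ht => if_pos ht
  have hψm : StrictMono ψ := by
    intro s t hst
    simp only [ψ]
    split_ifs with hs ht ht
    · exact hmono hs ht hst
    · have := (hmaps hs).2
      by_contra hc
      exact ht ⟨hs.1.trans hst, by linarith⟩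
    · have := (hmaps ht).1
      by_contra hc
      exact hs ⟨by linarith, hst.trans ht.2⟩
    · exact hst
  have hψs : Function.Surjective ψ := by
    intro y
    by_cases hy : y ∈ Ioo (0 : ℝ) 1
    · obtain ⟨t, ht, rfl⟩ := hsurj hy
      exact ⟨t, hψ t ht⟩
    · exact ⟨y, if_neg hy⟩
  have hψc : Continuous ψ := hψm.monotone.continuous_of_surjective hψs
  have hψM : MapsTo ψ (Icc 0 1) (Icc 0 1) := fun t ht =>
    ⟨h0 ▸ hψm.monotone ht.1, h1 ▸ hψm.monotone ht.2⟩
  refine ⟨ψ, ⟨h0, h1, hψc.continuousOn, hψm.strictMonoOn _, ∅, finite_empty, fun t ht => ?_⟩, ?_⟩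
  · have ht' : t ∈ Ioo (0 : ℝ) 1 := ht.1
    have hev : ψ =ᶠ[𝓝 t] H := by
      filter_upwards [Ioo_mem_nhds ht'.1 ht'.2] with s hs using hψ s hs
    obtain ⟨a1, a2⟩ := analyticAt_of_comp_eq h h' ht' (hmaps ht')
      (hcont.continuousAt (Ioo_mem_nhds ht'.1 ht'.2))
      (by filter_upwards [Ioo_mem_nhds ht'.1 ht'.2] with s hs using heq s hs)
    exact ⟨a1.congr hev.symm, by rwa [hev.deriv_eq]⟩
  · have : EqOn γ (γ' ∘ ψ) (Icc 0 1) := by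
      refine EqOn.of_subset_closure (s := Ioo 0 1) (fun t ht => ?_) h.continuousOn
        (h'.continuousOn.comp hψc.continuousOn hψM) Ioo_subset_Icc_self
        (by rw [closure_Ioo zero_ne_one])
      rw [Function.comp, hψ t ht, heq t ht]
    exact this

/-- Analytic curves with the same image of the open parameter interval agree up to a
reparametrization and a change of orientation. -/
lemma Curve.exists_isReparam_or [IsManifold (𝓡 d) ω M] [T2Space M] {x y x' y' : M}
    {c : Curve d x y} {c' : Curve d x' y'}
    (h : c.IsAnalytic) (h' : c'.IsAnalytic) (hr : c'.rev.IsAnalytic)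
    (him : c.path.extend '' Ioo 0 1 = c'.path.extend '' Ioo 0 1) :
    (∃ ψ, IsReparam ψ ∧ ∀ t ∈ Icc (0 : ℝ) 1, c.path.extend t = c'.path.extend (ψ t)) ∨
      ∃ ψ, IsReparam ψ ∧ ∀ t ∈ Icc (0 : ℝ) 1, c.path.extend t = c'.rev.path.extend (ψ t) := by
  obtain ⟨H, hmaps, heq, hcont, hsurj, hmono | hanti⟩ := exists_transition h h' him
  · exact .inl (exists_isReparam h h' hmaps heq hcont hsurj hmono)
  · refine .inr (exists_isReparam (H := fun t => 1 - H t) h hr (fun t ht => ?_) (fun t ht => ?_)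
      (continuousOn_const.sub hcont) (fun s hs => ?_) fun s hs t ht hst => ?_)
    · have := hmaps ht
      exact ⟨by linarith [this.2], by linarith [this.1]⟩
    · rw [heq t ht, Curve.rev, Path.extend_symm_apply]
      congr 1
      ring
    · obtain ⟨t, ht, hts⟩ := hsurj (show 1 - s ∈ Ioo (0 : ℝ) 1 from
        ⟨by linarith [hs.2], by linarith [hs.1]⟩)
      exact ⟨t, ht, by simp only [hts]; ring⟩
    · have := hanti hs ht hst
      simp only
      linarith

end Reparametrization

/-! ### Segments of curves as arrows -/

section Segments

variable {d : ℕ} {M : Type u} [TopologicalSpace M] [ChartedSpace (EuclideanSpace ℝ (Fin d)) M]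

/-- The general statement for pieces leaves a constant alternative, which injectivity excludes on an
interval of positive length. -/
lemma IsRegularPiece.affine {γ γ' : ℝ → M} {a b a' b' α β : ℝ} (h : IsRegularPiece d γ a b)
    (hα : α ≠ 0) (hab : a' < b')
    (h1 : ∀ t ∈ Icc a' b', α * t + β ∈ Icc a b) (h2 : ∀ t ∈ Ioo a' b', α * t + β ∈ Ioo a b)
    (h3 : ∀ t ∈ Icc a' b', γ' t = γ (α * t + β)) : IsRegularPiece d γ' a' b' := by
  refine (IsPiece.affine (.inl h) hα h1 h2 h3).resolve_right fun hc => ?_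
  obtain ⟨s, hs⟩ := exists_between hab
  obtain ⟨t, ht⟩ := exists_between hs.2
  have ht' : t ∈ Ioo a' b' := ⟨hs.1.trans ht.1, ht.2⟩
  have e : γ (α * s + β) = γ (α * t + β) := by
    rw [← h3 s (Ioo_subset_Icc_self hs), ← h3 t (Ioo_subset_Icc_self ht'),
      hc s (Ioo_subset_Icc_self hs), hc t (Ioo_subset_Icc_self ht')]
  have := h.injOn (h2 s hs) (h2 t ht') e
  exact ht.1.ne (mul_left_cancel₀ hα (add_right_cancel this))

lemma IsRegularPiece.mono {γ : ℝ → M} {a b a' b' : ℝ} (h : IsRegularPiece d γ a b)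
    (ha : a ≤ a') (hab : a' < b') (hb : b' ≤ b) : IsRegularPiece d γ a' b' :=
  h.affine (α := 1) (β := 0) one_ne_zero hab
    (fun t ht => by simpa using ⟨ha.trans ht.1, ht.2.trans hb⟩)
    (fun t ht => by simpa using ⟨ha.trans_lt ht.1, ht.2.trans_le hb⟩) (fun t _ => by simp)

lemma Curve.IsAnalytic.rev {x y : M} {c : Curve d x y} (h : c.IsAnalytic) :
    c.rev.IsAnalytic := by
  refine IsRegularPiece.affine (α := -1) (β := 1) h (by norm_num) zero_lt_one ?_ ?_ ?_
  · exact fun t ht => ⟨by linarith [ht.2], by linarith [ht.1]⟩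
  · exact fun t ht => ⟨by linarith [ht.2], by linarith [ht.1]⟩
  · intro t _
    rw [Curve.rev, Path.extend_symm_apply]
    congr 1
    ring

lemma partition_le {n : ℕ} {t : ℕ → ℝ} (h : ∀ k < n, t k < t (k + 1)) {i j : ℕ} (hij : i ≤ j)
    (hj : j ≤ n) : t i ≤ t j := by
  induction j, hij using Nat.le_induction with
  | base => exact le_rfl
  | succ j hij ih => exact (ih (by omega)).trans (h j (by omega)).le

/-- `γ` is continuous on `[a, b]` and consists of finitely many pieces there. -/
structure IsPiecewise (d : ℕ) {M : Type u} [TopologicalSpace M]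
    [ChartedSpace (EuclideanSpace ℝ (Fin d)) M] (γ : ℝ → M) (a b : ℝ) : Prop where
  lt : a < b
  cont : ContinuousOn γ (Icc a b)
  pieces : ∃ (n : ℕ) (t : ℕ → ℝ), t 0 = a ∧ t n = b ∧
    ∀ k < n, t k < t (k + 1) ∧ IsPiece d γ (t k) (t (k + 1))

lemma IsPiece.isPiecewise {γ : ℝ → M} {a b : ℝ} (h : IsPiece d γ a b) (hab : a < b) :
    IsPiecewise d γ a b := by
  refine ⟨hab, ?_, 1, fun k => if k = 0 then a else b, by simp, by simp, fun k hk => ?_⟩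
  · rcases h with h | h
    · exact h.continuousOn
    · exact continuousOn_const.congr h
  · obtain rfl : k = 0 := by omega
    exact ⟨by simpa using hab, by simpa using h⟩

lemma IsRegularPiece.isPiecewise {γ : ℝ → M} {a b : ℝ} (h : IsRegularPiece d γ a b)
    (hab : a < b) : IsPiecewise d γ a b := IsPiece.isPiecewise (.inl h) hab

variable {γ : ℝ → M} {a b c : ℝ} {x y z : M}

lemma seg_mem (hab : a < b) {t : ℝ} (ht : t ∈ Icc (0 : ℝ) 1) : (b - a) * t + a ∈ Icc a b := by
  have h1 := mul_nonneg (sub_nonneg.2 hab.le) ht.1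
  have h2 := mul_le_of_le_one_right (sub_nonneg.2 hab.le) ht.2
  constructor <;> linarith

lemma seg_mem_Ioo (hab : a < b) {t : ℝ} (ht : t ∈ Ioo (0 : ℝ) 1) :
    (b - a) * t + a ∈ Ioo a b := by
  have h1 := mul_pos (sub_pos.2 hab) ht.1
  have h2 := mul_lt_of_lt_one_right (sub_pos.2 hab) ht.2
  constructor <;> linarith

/-- The path that runs through `γ` from `a` to `b`. -/
noncomputable def segPath (hab : a < b) (h : ContinuousOn γ (Icc a b)) (hx : γ a = x)
    (hy : γ b = y) : Path x y where
  toFun s := γ ((b - a) * s + a)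
  continuous_toFun := h.comp_continuous (by fun_prop) fun s => seg_mem hab s.2
  source' := by simp [hx]
  target' := by simp [hy]

lemma segPath_extend (hab : a < b) (h : ContinuousOn γ (Icc a b)) (hx : γ a = x)
    (hy : γ b = y) {t : ℝ} (ht : t ∈ Icc (0 : ℝ) 1) :
    (segPath hab h hx hy).extend t = γ ((b - a) * t + a) := by
  rw [Path.extend_apply _ ht]; rfl

/-- The curve that runs through `γ` from `a` to `b`. -/
noncomputable def seg (h : IsPiecewise d γ a b) (hx : γ a = x) (hy : γ b = y) : Curve d x y :=
  ⟨segPath h.lt h.cont hx hy, by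
    obtain ⟨n, t, h0, h1, hp⟩ := h.pieces
    have hba := sub_pos.2 h.lt
    refine ⟨n, fun k => (t k - a) / (b - a), by simp [h0], by simp [h1, hba.ne'], fun k hk => ?_⟩
    have hlt := (hp k hk).1
    have hge : a ≤ t k := h0 ▸ partition_le (fun k hk => (hp k hk).1) (Nat.zero_le _) hk.le
    have hle : t (k + 1) ≤ b := h1 ▸ partition_le (fun k hk => (hp k hk).1) hk le_rfl
    refine ⟨div_lt_div_of_pos_right (by linarith) hba,
      (hp k hk).2.affine (α := b - a) (β := a) hba.ne' ?_ ?_ ?_⟩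
    · rintro s ⟨hs1, hs2⟩
      rw [div_le_iff₀ hba] at hs1
      rw [le_div_iff₀ hba] at hs2
      constructor <;> linarith
    · rintro s ⟨hs1, hs2⟩
      rw [div_lt_iff₀ hba] at hs1
      rw [lt_div_iff₀ hba] at hs2
      constructor <;> linarith
    · rintro s ⟨hs1, hs2⟩
      refine segPath_extend _ _ _ _ ⟨le_trans (div_nonneg (by linarith) hba.le) hs1,
        hs2.trans ?_⟩
      rw [div_le_one hba]; linarith⟩

lemma seg_extend (h : IsPiecewise d γ a b) (hx : γ a = x) (hy : γ b = y) {t : ℝ}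
    (ht : t ∈ Icc (0 : ℝ) 1) : (seg h hx hy).path.extend t = γ ((b - a) * t + a) :=
  segPath_extend h.lt h.cont hx hy ht

lemma image_seg_Ioo (h : IsPiecewise d γ a b) (hx : γ a = x) (hy : γ b = y) :
    (seg h hx hy).path.extend '' Ioo 0 1 = γ '' Ioo a b := by
  have h1 : (seg h hx hy).path.extend '' Ioo 0 1 =
      (γ ∘ fun t => (b - a) * t + a) '' Ioo 0 1 :=
    image_congr fun t ht => seg_extend h hx hy (Ioo_subset_Icc_self ht)
  have hba := sub_pos.2 h.lt
  rw [h1, image_comp]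
  congr 1
  refine Subset.antisymm ?_ fun s hs => ?_
  · rintro _ ⟨t, ht, rfl⟩
    exact seg_mem_Ioo h.lt ht
  · refine ⟨(s - a) / (b - a), ⟨div_pos (by linarith [hs.1]) hba, ?_⟩, ?_⟩
    · rw [div_lt_one hba]; linarith [hs.2]
    · simp only; field_simp; ring

lemma image_seg_subset (h : IsPiecewise d γ a b) (hx : γ a = x) (hy : γ b = y) :
    (seg h hx hy).image ⊆ γ '' Icc a b := by
  rintro _ ⟨s, rfl⟩
  exact ⟨_, seg_mem h.lt s.2, rfl⟩

lemma isAnalytic_seg (h : IsRegularPiece d γ a b) (hab : a < b) (hx : γ a = x) (hy : γ b = y) :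
    (seg (h.isPiecewise hab) hx hy).IsAnalytic :=
  h.affine (sub_pos.2 hab).ne' zero_lt_one (fun _ ht => seg_mem hab ht)
    (fun _ ht => seg_mem_Ioo hab ht) fun _ ht => seg_extend _ _ _ ht

/-- Concatenation runs through both parts in equal times, whereas the cut of a segment sits at the
fraction `r`; this change of speed reconciles them. -/
lemma isReparam_two_speeds {r : ℝ} (hr : r ∈ Ioo (0 : ℝ) 1) :
    IsReparam (fun t => if t ≤ 1 / 2 then 2 * r * t else r + (2 * t - 1) * (1 - r)) := by
  have hr1 := sub_pos.2 hr.2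
  refine ⟨by norm_num, by norm_num, ?_, ?_, {1 / 2}, by simp, ?_⟩
  · apply Continuous.continuousOn
    refine Continuous.if_le (by fun_prop) (by fun_prop) continuous_id continuous_const ?_
    intro t ht; subst ht; ring
  · intro s _ t _ hst
    simp only
    have hr0 := hr.1
    split_ifs with h1 h2 h2
    · nlinarith
    · nlinarith
    · linarith
    · nlinarith
  · rintro t ⟨_, htF⟩
    have key : ∀ (f : ℝ → ℝ) (m : ℝ), m ≠ 0 → AnalyticAt ℝ f t → HasDerivAt f m t →
        (fun t : ℝ => if t ≤ 1 / 2 then 2 * r * t else r + (2 * t - 1) * (1 - r)) =ᶠ[𝓝 t] f →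
        AnalyticAt ℝ (fun t : ℝ => if t ≤ 1 / 2 then 2 * r * t
          else r + (2 * t - 1) * (1 - r)) t ∧
        deriv (fun t : ℝ => if t ≤ 1 / 2 then 2 * r * t
          else r + (2 * t - 1) * (1 - r)) t ≠ 0 := by
      intro f m hm hf hd he
      exact ⟨hf.congr he.symm, by rw [he.deriv_eq, hd.deriv]; exact hm⟩
    rcases lt_or_gt_of_ne htF with h | h
    · refine key (fun t => 2 * r * t) (2 * r) (by linarith [hr.1]) (by fun_prop)
        (by simpa using (hasDerivAt_id t).const_mul (2 * r)) ?_
      filter_upwards [Iio_mem_nhds h] with q hq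
      rw [if_pos (le_of_lt hq)]
    · refine key (fun t => r + (2 * t - 1) * (1 - r)) (2 * (1 - r)) (by linarith) (by fun_prop)
        (by simpa using ((((hasDerivAt_id t).const_mul 2).sub_const 1).mul_const
          (1 - r)).const_add r) ?_
      filter_upwards [Ioi_mem_nhds h] with q hq
      rw [if_neg (not_le.2 hq)]

lemma seg_comp_equiv (h : IsPiecewise d γ a b) (h1 : IsPiecewise d γ a c)
    (h2 : IsPiecewise d γ c b) (hx : γ a = x) (hz : γ c = z) (hy : γ b = y) :
    CurveEquiv ((seg h1 hx hz).comp (seg h2 hz hy)) (seg h hx hy) := by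
  have hba := sub_pos.2 h.lt
  have hr : (c - a) / (b - a) ∈ Ioo (0 : ℝ) 1 :=
    ⟨div_pos (sub_pos.2 h1.lt) hba, by rw [div_lt_one hba]; linarith [h2.lt]⟩
  have hψ := isReparam_two_speeds hr
  refine .reparam _ _ _ hψ fun t ht => ?_
  rw [seg_extend]
  · simp only [Curve.comp]
    split_ifs with hle
    · rw [Path.extend_trans_of_le_half _ _ hle, seg_extend _ _ _ ⟨by linarith [ht.1], by linarith⟩]
      congr 1
      field_simp
    · rw [Path.extend_trans_of_half_le _ _ (by linarith),
        seg_extend _ _ _ ⟨by linarith, by linarith [ht.2]⟩]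
      congr 1
      field_simp
      ring
  · refine ⟨?_, ?_⟩
    · have := hψ.mono.monotoneOn (⟨le_rfl, zero_le_one⟩ : (0 : ℝ) ∈ Icc (0 : ℝ) 1) ht ht.1
      rwa [hψ.zero] at this
    · have := hψ.mono.monotoneOn ht (⟨zero_le_one, le_rfl⟩ : (1 : ℝ) ∈ Icc (0 : ℝ) 1) ht.2
      rwa [hψ.one] at this

lemma toHom_seg (h : IsPiecewise d γ a b) (h1 : IsPiecewise d γ a c)
    (h2 : IsPiecewise d γ c b) (hx : γ a = x) (hz : γ c = z) (hy : γ b = y) :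
    (seg h hx hy).toHom = (seg h1 hx hz).toHom ≫ (seg h2 hz hy).toHom :=
  (_root_.Quotient.sound (seg_comp_equiv h h1 h2 hx hz hy)).symm

lemma HomTo.eval_seg {G : Type v} [Group G] (A : HomTo (PathGroupoid d M) G)
    (h : IsPiecewise d γ a b) (h1 : IsPiecewise d γ a c)
    (h2 : IsPiecewise d γ c b) (hx : γ a = x) (hz : γ c = z) (hy : γ b = y) :
    A.eval (seg h hx hy).toHom = A.eval (seg h2 hz hy).toHom * A.eval (seg h1 hx hz).toHom :=
  (congrArg _ (toHom_seg h h1 h2 hx hz hy)).trans (A.eval_comp (C := PathGroupoid d M) _ _)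

lemma Curve.eq_seg (c : Curve d x y) :
    ∃ h : IsPiecewise d c.path.extend 0 1, c = seg h (Path.extend_zero _) (Path.extend_one _) := by
  refine ⟨⟨zero_lt_one, c.path.continuous_extend.continuousOn, c.piecewiseAnalytic⟩,
    Curve.ext_path (Path.ext (funext fun t => ?_))⟩
  change _ = c.path.extend ((1 - 0) * t + 0)
  rw [sub_zero, one_mul, add_zero, Path.extend_apply _ t.2]

/-- The edge that runs through the regular piece `γ` from `a` to `b`. -/
noncomputable def segEdge (h : IsRegularPiece d γ a b) (hab : a < b) : Edge d M where
  src := γ a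
  tgt := γ b
  hom := (seg (h.isPiecewise hab) rfl rfl).toHom
  isEdge := ⟨_, isAnalytic_seg h hab rfl rfl, rfl⟩

lemma image_segEdge_subset [T2Space M] (h : IsRegularPiece d γ a b) (hab : a < b) :
    (segEdge h hab).image ⊆ γ '' Icc a b := by
  rw [Edge.image_eq (segEdge h hab) (isAnalytic_seg h hab rfl rfl) rfl]
  exact image_seg_subset _ _ _

/-- A functor on the groupoid of paths is determined by its values on edges. -/
lemma HomTo.ext_edge {G : Type v} [Group G] {A B : HomTo (PathGroupoid d M) G}
    (h : ∀ e : Edge d M, A.eval e.hom = B.eval e.hom) : A = B := by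
  have hpiece : ∀ {γ : ℝ → M} {a b : ℝ} {x y : M} (hp : IsPiece d γ a b)
      (hw : IsPiecewise d γ a b) (hx : γ a = x) (hy : γ b = y),
      A.eval (seg hw hx hy).toHom = B.eval (seg hw hx hy).toHom := by
    intro γ a b x y hp hw hx hy
    rcases hp with hp | hp
    · subst hx hy
      exact h (segEdge hp hw.lt)
    -- A constant piece represents an identity, on which all functors agree.
    · have hxy : x = y := by rw [← hx, ← hy, hp b ⟨hw.lt.le, le_rfl⟩]
      subst hxy
      have hc : seg hw hx hy = Curve.const d x :=
        Curve.ext_path (Path.ext (funext fun t => (hp _ (seg_mem hw.lt t.2)).trans hx))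
      rw [hc]
      exact (A.eval_id (C := PathGroupoid d M) x).trans (B.eval_id (C := PathGroupoid d M) x).symm
  -- Induction on the number of pieces, splitting off the last one.
  have hall : ∀ (n : ℕ) {γ : ℝ → M} {a b : ℝ} {x y : M} (t : ℕ → ℝ) (_ : t 0 = a) (_ : t n = b)
      (_ : ∀ k < n, t k < t (k + 1) ∧ IsPiece d γ (t k) (t (k + 1)))
      (hw : IsPiecewise d γ a b) (hx : γ a = x) (hy : γ b = y),
      A.eval (seg hw hx hy).toHom = B.eval (seg hw hx hy).toHom := by
    intro n
    induction n with
    | zero =>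
      intro γ a b x y t h0 h1 _ hw
      exact absurd hw.lt (by rw [← h0, ← h1]; exact lt_irrefl _)
    | succ n ih =>
      intro γ a b x y t h0 h1 hp hw hx hy
      rcases Nat.eq_zero_or_pos n with rfl | hn
      · have := (hp 0 (by omega)).2
        rw [h0, h1] at this
        exact hpiece this hw hx hy
      · have hp' : ∀ k < n, t k < t (k + 1) ∧ IsPiece d γ (t k) (t (k + 1)) :=
          fun k hk => hp k (by omega)
        have hlt : a < t n := by
          rw [← h0]
          exact (hp 0 (by omega)).1.trans_le
            (partition_le (fun k hk => (hp' k hk).1) hn le_rfl)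
        have hlt' : t n < b := h1 ▸ (hp n (by omega)).1
        have hlast : IsPiece d γ (t n) b := h1 ▸ (hp n (by omega)).2
        have w1 : IsPiecewise d γ a (t n) :=
          ⟨hlt, hw.cont.mono (Icc_subset_Icc_right hlt'.le), n, t, h0, rfl, hp'⟩
        have w2 : IsPiecewise d γ (t n) b := hlast.isPiecewise hlt'
        rw [A.eval_seg hw w1 w2 hx rfl hy, B.eval_seg hw w1 w2 hx rfl hy,
          ih t h0 rfl hp' w1 hx rfl, hpiece hlast w2 rfl hy]
  refine HomTo.ext_eval fun x y p => ?_
  obtain ⟨c, rfl⟩ := _root_.Quotient.exists_rep p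
  obtain ⟨hw, hc⟩ := Curve.eq_seg c
  obtain ⟨n, t, h0, h1, hp⟩ := c.piecewiseAnalytic
  have := hall n t h0 h1 hp hw (Path.extend_zero _) (Path.extend_one _)
  rw [← hc] at this
  exact this

end Segments

/-! ### Directedness of the tame subgroupoids -/

section Directed

variable {d : ℕ} {M : Type u} [TopologicalSpace M] [ChartedSpace (EuclideanSpace ℝ (Fin d)) M]

lemma IsRegularPiece.finite_preimage {γ : ℝ → M} {a b : ℝ} (h : IsRegularPiece d γ a b)
    {V : Set M} (hV : V.Finite) : {t | t ∈ Icc a b ∧ γ t ∈ V}.Finite := by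
  have hsub : {t | t ∈ Icc a b ∧ γ t ∈ V} ⊆ {a, b} ∪ (Ioo a b ∩ γ ⁻¹' V) := by
    rintro t ⟨ht, htV⟩
    rcases ht.1.eq_or_lt with h1 | h1
    · left; left; exact h1.symm
    · rcases ht.2.eq_or_lt with h2 | h2
      · left; right; exact h2
      · right; exact ⟨⟨h1, h2⟩, htV⟩
  refine Set.Finite.subset (((finite_singleton _).insert _).union ?_) hsub
  refine Set.Finite.of_finite_image (hV.subset ?_) (h.injOn.mono inter_subset_left)
  rintro _ ⟨t, ht, rfl⟩
  exact ht.2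

/-- The equal images force the same arrow up to inversion, and subgroupoids are closed under
inverses. -/
lemma mem_arrows_of_image_eq [IsManifold (𝓡 d) ω M] [T2Space M]
    {L : Subgroupoid (PathGroupoid d M)} {x y x' y' : M} {c : Curve d x y} {c' : Curve d x' y'}
    (h : c.IsAnalytic) (h' : c'.IsAnalytic)
    (him : c.path.extend '' Ioo 0 1 = c'.path.extend '' Ioo 0 1)
    (hmem : c'.toHom ∈ L.arrows x' y') : c.toHom ∈ L.arrows x y := by
  rcases Curve.exists_isReparam_or h h' h'.rev him with ⟨ψ, hψ, he⟩ | ⟨ψ, hψ, he⟩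
  · have hx := he 0 (by simp)
    have hy := he 1 (by simp)
    rw [hψ.zero, Path.extend_zero, Path.extend_zero] at hx
    rw [hψ.one, Path.extend_one, Path.extend_one] at hy
    subst hx hy
    have : c.toHom = c'.toHom := _root_.Quotient.sound (CurveEquiv.reparam c' c ψ hψ he)
    rwa [this]
  · have hx := he 0 (by simp)
    have hy := he 1 (by simp)
    rw [hψ.zero, Path.extend_zero, Path.extend_zero] at hx
    rw [hψ.one, Path.extend_one, Path.extend_one] at hy
    subst hx hy
    have : c.toHom = c'.rev.toHom := _root_.Quotient.sound (CurveEquiv.reparam c'.rev c ψ hψ he)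
    rw [this]
    exact L.inv hmem

/-- The images of two segments that contain no vertices are disjoint or comparable. -/
lemma image_subset_of_inter_nonempty [T2Space M] {γ γ' : ℝ → M} {V : Set M} {a b a' b' : ℝ}
    (h : IsRegularPiece d γ 0 1) (h' : IsRegularPiece d γ' 0 1)
    (hab : Icc a b ⊆ Icc 0 1) (hab' : Icc a' b' ⊆ Icc 0 1)
    (hV : ∀ t ∈ Ioo a b, γ t ∉ V) (ha' : γ' a' ∈ V) (hb' : γ' b' ∈ V)
    (h0 : γ' 0 ∈ V) (h1 : γ' 1 ∈ V)
    (hin : (∀ s ∈ Ioo a b, γ s ∈ γ' '' Icc 0 1) ∨ ∀ s ∈ Ioo a b, γ s ∉ γ' '' Icc 0 1)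
    (hne : (γ '' Ioo a b ∩ γ' '' Ioo a' b').Nonempty) :
    γ '' Ioo a b ⊆ γ' '' Ioo a' b' := by
  obtain ⟨_, ⟨s0, hs0, rfl⟩, t0, ht0, hst0⟩ := hne
  have ht0' : t0 ∈ Icc a' b' := Ioo_subset_Icc_self ht0
  replace hin := hin.resolve_right fun hc => hc s0 hs0 ⟨t0, hab' ht0', hst0⟩
  have hle' : a' ≤ b' := ht0'.1.trans ht0'.2
  have hlt : a < b := hs0.1.trans hs0.2
  have hconn : IsPreconnected (γ '' Ioo a b) := isPreconnected_Ioo.image _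
    (h.continuousOn.mono (Ioo_subset_Icc_self.trans hab))
  have hc1 : IsClosed (γ' '' Icc a' b') :=
    (isCompact_Icc.image_of_continuousOn (h'.continuousOn.mono hab')).isClosed
  have hA : Icc 0 a' ⊆ Icc (0 : ℝ) 1 := Icc_subset_Icc_right ((hab' ⟨le_rfl, hle'⟩).2)
  have hB : Icc b' 1 ⊆ Icc (0 : ℝ) 1 := Icc_subset_Icc_left ((hab' ⟨hle', le_rfl⟩).1)
  have hc2 : IsClosed (γ' '' (Icc 0 a' ∪ Icc b' 1)) :=
    ((isCompact_Icc.union isCompact_Icc).image_of_continuousOn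
      (h'.continuousOn.mono (union_subset hA hB))).isClosed
  -- The connected set `γ '' Ioo a b` is covered by the closed image of `[a', b']` and that of the
  -- rest of `[0, 1]`. These overlap only in points of `V`, which it avoids, so it lies in one of
  -- them.
  have hcov : γ '' Ioo a b ⊆ γ' '' Icc a' b' ∪ γ' '' (Icc 0 a' ∪ Icc b' 1) := by
    rintro _ ⟨s, hs, rfl⟩
    obtain ⟨t, ht, hts⟩ := hin s hs
    rw [← hts]
    rcases le_total t a' with hta | hta
    · right; exact ⟨t, .inl ⟨ht.1, hta⟩, rfl⟩
    · rcases le_total t b' with htb | htb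
      · left; exact ⟨t, ⟨hta, htb⟩, rfl⟩
      · right; exact ⟨t, .inr ⟨htb, ht.2⟩, rfl⟩
  have hsub : γ '' Ioo a b ⊆ γ' '' Icc a' b' := by
    by_contra hc
    obtain ⟨z, hz, hz'⟩ := not_subset.1 hc
    obtain ⟨_, ⟨s, hs, rfl⟩, ⟨t, ht, hts⟩, q, hq, hqs⟩ :=
      isPreconnected_closed_iff.1 hconn _ _ hc1 hc2 hcov ⟨γ s0, ⟨s0, hs0, rfl⟩, t0, ht0', hst0⟩
        ⟨z, hz, (hcov hz).resolve_left hz'⟩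
    have hne1 : ∀ r, γ' r = γ s → r ≠ 0 ∧ r ≠ 1 ∧ r ≠ a' ∧ r ≠ b' := by
      intro r hr
      refine ⟨?_, ?_, ?_, ?_⟩ <;> rintro rfl <;> exact hV s hs (hr ▸ ‹_›)
    have hq01 : q ∈ Icc (0 : ℝ) 1 := union_subset hA hB hq
    obtain ⟨q0, q1, qa, qb⟩ := hne1 q hqs
    have hqI : q ∈ Ioo (0 : ℝ) 1 := ⟨lt_of_le_of_ne hq01.1 q0.symm, lt_of_le_of_ne hq01.2 q1⟩
    have htq : t = q := h'.eq_of_mem_Ioo (hab' ht) hqI (hts.trans hqs.symm)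
    subst htq
    rcases hq with hq | hq
    · exact qa (le_antisymm hq.2 ht.1)
    · exact qb (le_antisymm ht.2 hq.1)
  rintro _ ⟨s, hs, rfl⟩
  obtain ⟨t, ht, hts⟩ := hsub ⟨s, hs, rfl⟩
  refine ⟨t, ⟨lt_of_le_of_ne ht.1 ?_, lt_of_le_of_ne ht.2 ?_⟩, hts⟩
  · rintro rfl; exact hV s hs (hts ▸ ha')
  · rintro rfl; exact hV s hs (hts ▸ hb')

/-- Every finite family of edges is contained in a groupoid with finitely many independent
generators. -/
theorem exists_independent_generating [IsManifold (𝓡 d) ω M] [T2Space M] {ι : Type*} [Finite ι]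
    (E : ι → Edge d M) :
    ∃ (m : ℕ) (e : Fin m → Edge d M), Independent e ∧
      ∀ i, (E i).hom ∈ (generated e).arrows (E i).src (E i).tgt := by
  classical
  have hreg : ∀ i, IsRegularPiece d (E i).par 0 1 := fun i => (E i).isRegularPiece_par
  choose F hFfin hFsub hF using fun i j => (hreg i).exists_cuts (hreg j)
  -- The vertices are all end points together with the cut points of every edge relative to every
  -- edge.
  let V : Set M := ⋃ i, ((E i).par '' {0, 1} ∪ ⋃ j, (E i).par '' F i j)
  have hVfin : V.Finite := Set.finite_iUnion fun i =>
    (((finite_singleton _).insert _).image _).union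
      (Set.finite_iUnion fun j => (hFfin i j).image _)
  have hV0 : ∀ i, (E i).par 0 ∈ V := fun i => mem_iUnion.2 ⟨i, .inl ⟨0, by simp, rfl⟩⟩
  have hV1 : ∀ i, (E i).par 1 ∈ V := fun i => mem_iUnion.2 ⟨i, .inl ⟨1, by simp, rfl⟩⟩
  have hVF : ∀ i j, ∀ t ∈ F i j, (E i).par t ∈ V := fun i j t ht =>
    mem_iUnion.2 ⟨i, .inr (mem_iUnion.2 ⟨j, t, ht, rfl⟩)⟩
  -- Each edge is subdivided wherever it meets `V`, including at points that became vertices because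
  -- of another edge.
  let T : ι → Set ℝ := fun i => {t | t ∈ Icc (0 : ℝ) 1 ∧ (E i).par t ∈ V}
  have hTfin : ∀ i, (T i).Finite := fun i => (hreg i).finite_preimage hVfin
  -- The atomic segments: between consecutive parameters of `T i`.
  let Q : Set (ι × ℝ × ℝ) := {q | q.2.1 ∈ T q.1 ∧ q.2.2 ∈ T q.1 ∧ q.2.1 < q.2.2 ∧
    ∀ t ∈ Ioo q.2.1 q.2.2, t ∉ T q.1}
  have hQfin : Q.Finite := by
    refine Set.Finite.subset (Set.finite_iUnion fun i =>
      ((hTfin i).prod (hTfin i)).image fun p => (i, p)) fun q hq => ?_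
    exact mem_iUnion.2 ⟨q.1, q.2, ⟨hq.1, hq.2.1⟩, rfl⟩
  let im : ι × ℝ × ℝ → Set M := fun q => (E q.1).par '' Ioo q.2.1 q.2.2
  have hQI : ∀ q ∈ Q, Icc q.2.1 q.2.2 ⊆ Icc (0 : ℝ) 1 := fun q hq =>
    Icc_subset_Icc hq.1.1.1 hq.2.1.1.2
  have hQV : ∀ q ∈ Q, ∀ t ∈ Ioo q.2.1 q.2.2, (E q.1).par t ∉ V := fun q hq t ht hc =>
    hq.2.2.2 t ht ⟨hQI q hq (Ioo_subset_Icc_self ht), hc⟩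
  have hsub : ∀ q ∈ Q, ∀ q' ∈ Q, (im q ∩ im q').Nonempty → im q ⊆ im q' := by
    intro q hq q' hq' hne
    refine image_subset_of_inter_nonempty (hreg q.1) (hreg q'.1) (hQI q hq) (hQI q' hq')
      (hQV q hq) hq'.1.2 hq'.2.1.2 (hV0 _) (hV1 _) ?_ hne
    refine hF q.1 q'.1 _ _ (Ioo_subset_Icc_self.trans (hQI q hq)) ?_
    rw [Set.disjoint_left]
    exact fun t ht htF => hQV q hq t ht (hVF _ _ t htF)
  have heq : ∀ q ∈ Q, ∀ q' ∈ Q, (im q ∩ im q').Nonempty → im q = im q' := fun q hq q' hq' hne =>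
    (hsub q hq q' hq' hne).antisymm (hsub q' hq' q hq (by rwa [inter_comm]))
  have hRfin : Finite (im '' Q) := (hQfin.image im).to_subtype
  -- Several atomic segments may have the same open image; one generator is kept for each image.
  obtain ⟨m, ⟨φ⟩⟩ := Finite.exists_equiv_fin (im '' Q)
  have hrep : ∀ k : Fin m, ∃ q ∈ Q, im q = φ.symm k := fun k => (φ.symm k).2
  choose q hqQ hqim using hrep
  have hr : ∀ k, IsRegularPiece d (E (q k).1).par (q k).2.1 (q k).2.2 := fun k =>
    (hreg _).mono (hqQ k).1.1.1 (hqQ k).2.2.1 (hqQ k).2.1.1.2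
  let e : Fin m → Edge d M := fun k => segEdge (hr k) (hqQ k).2.2.1
  have hsrcV : ∀ k, ((e k).src : M) ∈ V := fun k => (hqQ k).1.2
  have htgtV : ∀ k, ((e k).tgt : M) ∈ V := fun k => (hqQ k).2.1.2
  have himg : ∀ k z, z ∈ (e k).image → z = (e k).src ∨ z = (e k).tgt ∨ z ∈ im (q k) := by
    intro k z hz
    obtain ⟨t, ht, rfl⟩ := image_segEdge_subset _ _ hz
    rcases ht.1.eq_or_lt with h1 | h1
    · left; rw [← h1]; rfl
    · rcases ht.2.eq_or_lt with h2 | h2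
      · right; left; rw [h2]; rfl
      · right; right; exact ⟨t, ⟨h1, h2⟩, rfl⟩
  have himV : ∀ k z, z ∈ im (q k) → z ∉ V := by
    rintro k _ ⟨t, ht, rfl⟩
    exact hQV _ (hqQ k) t ht
  refine ⟨m, e, ?_, fun i => ?_⟩
  · rintro k k' hkk z ⟨hz, hz'⟩
    rcases himg k z hz with h | h | h
    · exact .inl h
    · exact .inr h
    · exfalso
      rcases himg k' z hz' with h' | h' | h'
      · exact himV k z h (h' ▸ hsrcV k')
      · exact himV k z h (h' ▸ htgtV k')
      · refine hkk (φ.symm.injective (Subtype.ext ?_))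
        rw [← hqim k, ← hqim k']
        exact heq _ (hqQ k) _ (hqQ k') ⟨z, h, h'⟩
  -- Induction on the number of vertices strictly inside the segment. With none, the segment is
  -- atomic and agrees with a chosen generator up to orientation; otherwise it splits at such a
  -- vertex.
  · have key : ∀ (N : ℕ) (i : ι) (a b : ℝ), (T i ∩ Ioo a b).ncard = N → a ∈ T i → b ∈ T i →
        a < b → ∀ (x y : M) (hw : IsPiecewise d (E i).par a b) (hx : (E i).par a = x)
        (hy : (E i).par b = y), (seg hw hx hy).toHom ∈ (generated e).arrows x y := by
      intro N
      induction N using Nat.strong_induction_on with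
      | _ N ih =>
        intro i a b hN ha hb hab x y hw hx hy
        rcases (T i ∩ Ioo a b).eq_empty_or_nonempty with hemp | ⟨t, htT, ht⟩
        · have hq : (i, a, b) ∈ Q := ⟨ha, hb, hab, fun t ht htT =>
            (Set.eq_empty_iff_forall_notMem.1 hemp t) ⟨htT, ht⟩⟩
          let k := φ ⟨im (i, a, b), mem_image_of_mem im hq⟩
          have hk : im (q k) = im (i, a, b) := by rw [hqim]; simp [k]
          refine mem_arrows_of_image_eq (isAnalytic_seg ((hreg i).mono ha.1.1 hab hb.1.2) hab hx hy)
            (isAnalytic_seg (hr k) (hqQ k).2.2.1 rfl rfl) ?_ (mem_generated e k)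
          rw [image_seg_Ioo, image_seg_Ioo]
          exact hk.symm
        · have w1 : IsPiecewise d (E i).par a t :=
            ((hreg i).mono ha.1.1 ht.1 htT.1.2).isPiecewise ht.1
          have w2 : IsPiecewise d (E i).par t b :=
            ((hreg i).mono htT.1.1 ht.2 hb.1.2).isPiecewise ht.2
          have hfin : (T i ∩ Ioo a b).Finite := (hTfin i).subset inter_subset_left
          have hcard : ∀ S : Set ℝ, S ⊆ T i ∩ Ioo a b → t ∉ S → S.ncard < N := fun S hS htS =>
            hN ▸ Set.ncard_lt_ncard ⟨hS, fun hc => htS (hc ⟨htT, ht⟩)⟩ hfin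
          rw [toHom_seg hw w1 w2 hx rfl hy]
          refine (generated e).mul
            (ih _ (hcard (T i ∩ Ioo a t) ?_ ?_) i a t rfl ha htT ht.1 _ _ w1 hx rfl)
            (ih _ (hcard (T i ∩ Ioo t b) ?_ ?_) i t b rfl htT hb ht.2 _ _ w2 rfl hy)
          · exact inter_subset_inter_right _ (Ioo_subset_Ioo_right ht.2.le)
          · exact fun hc => lt_irrefl _ hc.2.2
          · exact inter_subset_inter_right _ (Ioo_subset_Ioo_left ht.1.le)
          · exact fun hc => lt_irrefl _ hc.2.1
    obtain ⟨hw, hc⟩ := Curve.eq_seg (E i).curve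
    rw [← (E i).toHom_curve, hc]
    exact key _ i 0 1 rfl ⟨by simp, hV0 i⟩ ⟨by simp, hV1 i⟩ zero_lt_one _ _ hw _ _

end Directed

/-! ### The spaces of functors are compact Hausdorff spaces -/

section HomTopology

variable {C : Type u} [Groupoid.{u} C] {G : Type v} [Group G]

/-- The family of all values of a functor. -/
def HomTo.evalAll (A : HomTo C G) : (Σ (x : C) (y : C), x ⟶ y) → G := fun q => A.eval q.2.2

/-- The functor laws are closed conditions on the values, which exhibits the space of functors as a
closed subset of a power of `G`. -/
lemma HomTo.range_evalAll :
    range (HomTo.evalAll : HomTo C G → (Σ (x : C) (y : C), x ⟶ y) → G) =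
      (⋂ x : C, {f | f ⟨x, x, 𝟙 x⟩ = 1}) ∩
      ⋂ (x : C) (y : C) (z : C) (p : x ⟶ y) (q : y ⟶ z),
        {f | f ⟨x, z, p ≫ q⟩ = f ⟨y, z, q⟩ * f ⟨x, y, p⟩} := by
  ext f
  simp only [mem_inter_iff, mem_iInter, mem_ofPred_eq]
  constructor
  · rintro ⟨A, rfl⟩
    exact ⟨A.eval_id, fun x y z p q => A.eval_comp p q⟩
  · rintro ⟨h1, h2⟩
    let A : C ⥤ SingleObj G :=
      { obj := fun _ => SingleObj.star G
        map := fun {x y} p => (f ⟨x, y, p⟩ : G)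
        map_id := h1
        map_comp := fun {x y z} p q => h2 x y z p q }
    exact ⟨A, rfl⟩

variable [TopologicalSpace G]

lemma HomTo.continuous_eval {x y : C} (p : x ⟶ y) : Continuous fun A : HomTo C G => A.eval p :=
  continuous_iInf_dom (i := x) <| continuous_iInf_dom (i := y) <| continuous_iInf_dom (i := p)
    continuous_induced_dom

lemma HomTo.continuous_of_eval {X : Type*} [TopologicalSpace X] {f : X → HomTo C G}
    (h : ∀ (x y : C) (p : x ⟶ y), Continuous fun a => (f a).eval p) : Continuous f :=
  continuous_iInf_rng.2 fun x => continuous_iInf_rng.2 fun y => continuous_iInf_rng.2 fun p =>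
    continuous_induced_rng.2 (h x y p)

lemma HomTo.isEmbedding_evalAll :
    Topology.IsEmbedding (HomTo.evalAll : HomTo C G → (Σ (x : C) (y : C), x ⟶ y) → G) := by
  refine ⟨⟨le_antisymm ?_ ?_⟩, fun A B h => HomTo.ext_eval fun x y p => congrFun h ⟨x, y, p⟩⟩
  · exact continuous_iff_le_induced.1 (continuous_pi fun q => HomTo.continuous_eval q.2.2)
  · refine le_iInf fun x => le_iInf fun y => le_iInf fun p => ?_
    have h : Continuous fun f : (Σ (x : C) (y : C), x ⟶ y) → G => f ⟨x, y, p⟩ :=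
      continuous_apply _
    exact (induced_mono (continuous_iff_le_induced.1 h)).trans_eq induced_compose

instance HomTo.instT2Space [T2Space G] : T2Space (HomTo C G) :=
  HomTo.isEmbedding_evalAll.t2Space

instance HomTo.instCompactSpace [T2Space G] [ContinuousMul G] [CompactSpace G] :
    CompactSpace (HomTo C G) := by
  refine Topology.IsClosedEmbedding.compactSpace
    (f := (HomTo.evalAll : HomTo C G → (Σ (x : C) (y : C), x ⟶ y) → G))
    ⟨HomTo.isEmbedding_evalAll, ?_⟩
  rw [HomTo.range_evalAll]
  refine (isClosed_iInter fun x => isClosed_eq (continuous_apply _) continuous_const).inter ?_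
  refine isClosed_iInter fun x => isClosed_iInter fun y => isClosed_iInter fun z =>
    isClosed_iInter fun p => isClosed_iInter fun q => isClosed_eq (continuous_apply _) ?_
  exact (continuous_apply _).mul (continuous_apply _)

lemma continuous_restr (L : Subgroupoid C) :
    Continuous (restr G L : HomTo C G → HomTo L.objs G) :=
  HomTo.continuous_of_eval fun _ _ p => HomTo.continuous_eval p.1

lemma continuous_restrOfLE {L L' : Subgroupoid C} (h : L ≤ L') :
    Continuous (restrOfLE G h : HomTo L'.objs G → HomTo L.objs G) :=
  HomTo.continuous_of_eval fun _ _ p =>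
    HomTo.continuous_eval ((Subgroupoid.inclusion h).map p)

end HomTopology

/-! ### Coordinates given by independent edges -/

section Rho

variable {d : ℕ} {M : Type u} [TopologicalSpace M] [ChartedSpace (EuclideanSpace ℝ (Fin d)) M]
  {G : Type v} [Group G] {n : ℕ} {e : Fin n → Edge d M}

/-- The values of a functor on a family of edges. -/
noncomputable def evalEdges {ι : Type*} (e : ι → Edge d M) (A : HomTo (PathGroupoid d M) G) :
    ι → G :=
  fun i => A.eval (e i).hom

lemma rho_restr {L : Subgroupoid (PathGroupoid d M)} (h : IsGeneratedBy L e)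
    (A : HomTo (PathGroupoid d M) G) : rho G h (restr G L A) = evalEdges e A := rfl

lemma evalEdges_sec (h : Independent e) (g : Fin n → G) : evalEdges e (h.sec g) = g :=
  funext fun i => h.eval_sec g i

/-- The inverse of `rho` thereby factors through functors on the whole groupoid, where the laws of
different subgroupoids can be compared. -/
lemma invFun_rho {L : Subgroupoid (PathGroupoid d M)} (h : IsGeneratedBy L e) (g : Fin n → G) :
    Function.invFun (rho G h) g = restr G L (h.independent.sec g) := by
  have h1 : rho G h (restr G L (h.independent.sec g)) = g := by
    rw [rho_restr, evalEdges_sec]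
  exact rho_injective h ((Function.invFun_eq ⟨_, h1⟩).trans h1.symm)

lemma restr_eq_of_evalEdges_eq {L : Subgroupoid (PathGroupoid d M)} (h : IsGeneratedBy L e)
    {A B : HomTo (PathGroupoid d M) G} (hAB : evalEdges e A = evalEdges e B) :
    restr G L A = restr G L B :=
  rho_injective h hAB

variable [TopologicalSpace G]

lemma continuous_rho {L : Subgroupoid (PathGroupoid d M)} (h : IsGeneratedBy L e) :
    Continuous (rho G h) :=
  continuous_pi fun _ => HomTo.continuous_eval _

lemma continuous_evalEdges {ι : Type*} (e : ι → Edge d M) :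
    Continuous (evalEdges e : HomTo (PathGroupoid d M) G → ι → G) :=
  continuous_pi fun i => HomTo.continuous_eval (e i).hom

/-- The value on a fixed curve is a finite ordered product of coordinates of `g` and their inverses.
-/
lemma continuous_sec [IsTopologicalGroup G] (h : Independent e) :
    Continuous (h.sec : (Fin n → G) → HomTo (PathGroupoid d M) G) := by
  refine HomTo.continuous_of_eval fun x y p => ?_
  obtain ⟨c, rfl⟩ := _root_.Quotient.exists_rep p
  exact h.mids.continuous_hol c.path.extend

lemma isHomeomorph_rho [IsTopologicalGroup G] [CompactSpace G] [T2Space G]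
    {L : Subgroupoid (PathGroupoid d M)} (h : IsGeneratedBy L e) : IsHomeomorph (rho G h) :=
  isHomeomorph_iff_continuous_bijective.2 ⟨continuous_rho h, rho_injective h, fun g =>
    ⟨restr G L (h.independent.sec g), by rw [rho_restr, evalEdges_sec]⟩⟩

lemma continuous_diffeoAct (φ : M ≃ₘ^ω⟮𝓡 d, 𝓡 d⟯ M) :
    Continuous (diffeoAct φ : HomTo (PathGroupoid d M) G → HomTo (PathGroupoid d M) G) :=
  HomTo.continuous_of_eval fun _ _ p => HomTo.continuous_eval ((diffeoFunctor φ.symm).map p)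

lemma HomTo.continuous_gauge {C : Type u} [Groupoid.{u} C] [ContinuousMul G] (g : C → G) :
    Continuous (HomTo.gauge g : HomTo C G → HomTo C G) :=
  HomTo.continuous_of_eval fun _ _ p =>
    (continuous_const.mul (HomTo.continuous_eval p)).mul continuous_const

variable [SecondCountableTopology G] [MeasurableSpace G] [BorelSpace G]

lemma measurable_evalEdges (e : Fin n → Edge d M) :
    Measurable (evalEdges e : HomTo (PathGroupoid d M) G → Fin n → G) :=
  (continuous_evalEdges e).measurable

lemma measurable_restr_sec [IsTopologicalGroup G] (L : Subgroupoid (PathGroupoid d M))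
    (h : Independent e) :
    Measurable fun g : Fin n → G => restr G L (h.sec g) :=
  ((continuous_restr L).comp (continuous_sec h)).measurable

end Rho

/-! ### Invariance and uniqueness of Haar measure on compact groups -/

section Haar

variable {G : Type v} [Group G] [TopologicalSpace G] [IsTopologicalGroup G] [CompactSpace G]
  [MeasurableSpace G] [BorelSpace G]

instance haar.instIsHaarMeasure : (haar G).IsHaarMeasure := Measure.isHaarMeasure_haarMeasure _

instance haar.instIsProbabilityMeasure : IsProbabilityMeasure (haar G) :=
  ⟨Measure.haarMeasure_self (K₀ := (⊤ : TopologicalSpace.PositiveCompacts G))⟩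

/-- A left invariant probability measure on a compact group is the Haar probability measure. -/
lemma eq_of_isMulLeftInvariant_of_isProbabilityMeasure (μ ν : Measure G) [μ.IsHaarMeasure]
    [IsProbabilityMeasure μ] [ν.IsMulLeftInvariant] [IsProbabilityMeasure ν] : ν = μ := by
  have h := Measure.isMulInvariant_eq_smul_of_compactSpace ν μ
  have h1 := congrArg (fun m : Measure G => m univ) h
  simp only [measure_univ, Measure.smul_apply] at h1
  have h2 : Measure.haarScalarFactor ν μ = 1 := by
    rw [ENNReal.smul_def, smul_eq_mul, mul_one] at h1
    exact_mod_cast h1.symm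
  rw [h, h2, one_smul]

/-- Right translation commutes with left translations, so the translated measure is again a left
invariant probability measure. -/
lemma map_mul_right_eq (μ : Measure G) [μ.IsHaarMeasure] [IsProbabilityMeasure μ] (a : G) :
    μ.map (· * a) = μ := by
  have hm : Measurable (fun x : G => x * a) := (continuous_mul_const a).measurable
  have h2 : IsProbabilityMeasure (μ.map (· * a)) :=
    Measure.isProbabilityMeasure_map hm.aemeasurable
  have h1 : (μ.map (· * a)).IsMulLeftInvariant := by
    refine ⟨fun g => ?_⟩
    have hg : Measurable (fun x : G => g * x) := (continuous_const_mul g).measurable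
    have h4 : (fun x : G => g * x) ∘ (fun x => x * a) = (fun x => x * a) ∘ (fun x => g * x) :=
      funext fun x => (mul_assoc _ _ _).symm
    rw [Measure.map_map hg hm, h4, ← Measure.map_map hm hg, map_mul_left_eq_self]
  exact eq_of_isMulLeftInvariant_of_isProbabilityMeasure μ _

lemma map_mul_mul_eq (μ : Measure G) [μ.IsHaarMeasure] [IsProbabilityMeasure μ] (b a : G) :
    μ.map (fun x => b * x * a) = μ := by
  have hm : Measurable (fun x : G => x * a) := (continuous_mul_const a).measurable
  have hg : Measurable (fun x : G => b * x) := (continuous_const_mul b).measurable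
  have h : (fun x : G => b * x * a) = (fun x => x * a) ∘ (fun x => b * x) := rfl
  rw [h, ← Measure.map_map hm hg, map_mul_left_eq_self, map_mul_right_eq]

end Haar

/-! ### Consistency of the Haar measures on tame subgroupoids -/

section EdgeMeasures

variable {d : ℕ} {M : Type u} [TopologicalSpace M] [ChartedSpace (EuclideanSpace ℝ (Fin d)) M]
  {G : Type v} [Group G] [TopologicalSpace G] [IsTopologicalGroup G] [CompactSpace G]
  [MeasurableSpace G] [BorelSpace G] {n m : ℕ}
  {e : Fin n → Edge d M} {e' : Fin m → Edge d M}

/-- The product of the Haar probability measures. -/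
noncomputable abbrev haarPi (G : Type v) [Group G] [TopologicalSpace G] [IsTopologicalGroup G]
    [CompactSpace G] [MeasurableSpace G] [BorelSpace G] (n : ℕ) : Measure (Fin n → G) :=
  Measure.pi fun _ => haar G

lemma haarPush_eq {L : Subgroupoid (PathGroupoid d M)} (h : IsGeneratedBy L e) :
    haarPush G h = (haarPi G n).map (fun g => restr G L (h.independent.sec g)) := by
  rw [haarPush]
  congr 1
  exact funext (invFun_rho h)

variable [SecondCountableTopology G]

/-- By `exists_shift`, a left translation of the image measure comes from a two-sided translation of
Haar measure on the source, which changes nothing. Uniqueness of Haar measure on the product group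
finishes the proof. -/
lemma map_evalEdges_sec (h : Independent e) (h' : Independent e')
    (hgen : ∀ i, (e i).hom ∈ (generated e').arrows (e i).src (e i).tgt) :
    (haarPi G m).map (fun g => evalEdges e (h'.sec g)) = haarPi G n := by
  have hc : Continuous (fun g : Fin m → G => evalEdges e (h'.sec g)) :=
    (continuous_evalEdges e).comp (continuous_sec h')
  have hp : IsProbabilityMeasure ((haarPi G m).map (fun g => evalEdges e (h'.sec g))) :=
    Measure.isProbabilityMeasure_map hc.measurable.aemeasurable
  have hi : ((haarPi G m).map (fun g => evalEdges e (h'.sec g))).IsMulLeftInvariant := by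
    refine ⟨fun f => ?_⟩
    obtain ⟨a, b, hab⟩ := h.exists_shift h' hgen f
    have hf : Measurable (fun x : Fin n → G => f * x) := (continuous_const_mul f).measurable
    have hba : Measurable (fun g : Fin m → G => b * g * a) :=
      ((continuous_const_mul b).mul continuous_const).measurable
    have h1 : (fun x : Fin n → G => f * x) ∘ (fun g => evalEdges e (h'.sec g)) =
        (fun g => evalEdges e (h'.sec g)) ∘ fun g => b * g * a :=
      funext fun g => funext fun i => (hab g i).symm
    rw [Measure.map_map hf hc.measurable, h1, ← Measure.map_map hc.measurable hba,
      map_mul_mul_eq]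
  exact eq_of_isMulLeftInvariant_of_isProbabilityMeasure _ _

/-- A functor on `L` is determined by its values on `e`, so the restriction to `L` factors through
these values, whose law is Haar measure. -/
lemma map_restr_sec {L L' : Subgroupoid (PathGroupoid d M)} (h : IsGeneratedBy L e)
    (h' : IsGeneratedBy L' e') (hle : L ≤ L') :
    (haarPi G m).map (fun g => restr G L (h'.independent.sec g)) = haarPush G h := by
  have hgen : ∀ i, (e i).hom ∈ (generated e').arrows (e i).src (e i).tgt := fun i => by
    rw [← h'.eq_generated]
    exact (Subgroupoid.le_iff _ _).1 hle (h.mem i)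
  have h1 : (fun g : Fin m → G => restr G L (h'.independent.sec g)) =
      (fun g => restr G L (h.independent.sec g)) ∘
        fun g => evalEdges e (h'.independent.sec g) :=
    funext fun g => restr_eq_of_evalEdges_eq h (evalEdges_sec _ _).symm
  have hc : Continuous (fun g : Fin m → G => evalEdges e (h'.independent.sec g)) :=
    (continuous_evalEdges e).comp (continuous_sec _)
  rw [h1, ← Measure.map_map (measurable_restr_sec L _) hc.measurable,
    map_evalEdges_sec h.independent h'.independent hgen, haarPush_eq]

lemma haarPush_eq_haarPush {L : Subgroupoid (PathGroupoid d M)} (h : IsGeneratedBy L e)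
    (h' : IsGeneratedBy L e') : haarPush G h = haarPush G h' := by
  rw [← map_restr_sec h h' le_rfl, haarPush_eq h']

lemma map_restrOfLE_haarPush {L L' : Subgroupoid (PathGroupoid d M)} (h : IsGeneratedBy L e)
    (h' : IsGeneratedBy L' e') (hle : L ≤ L') :
    (haarPush G h').map (restrOfLE G hle) = haarPush G h := by
  rw [haarPush_eq h', Measure.map_map (continuous_restrOfLE hle).measurable
    (measurable_restr_sec L' _), ← map_restr_sec h h' hle]
  rfl

instance isProbabilityMeasure_haarPush {L : Subgroupoid (PathGroupoid d M)}
    (h : IsGeneratedBy L e) : IsProbabilityMeasure (haarPush G h) := by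
  rw [haarPush_eq]
  exact Measure.isProbabilityMeasure_map (measurable_restr_sec L _).aemeasurable

lemma regular_haarPush [T2Space G] {L : Subgroupoid (PathGroupoid d M)} (h : IsGeneratedBy L e) :
    (haarPush G h).Regular := by
  let Φ : HomTo L.objs G ≃ₜ (Fin n → G) := (isHomeomorph_rho (G := G) h).homeomorph
  have h1 : haarPush G h = (haarPi G n).map Φ.symm := by
    rw [haarPush_eq]
    congr 1
    funext g
    rw [Homeomorph.eq_symm_apply]
    exact evalEdges_sec _ _
  rw [h1]
  exact Measure.Regular.map Φ.symm

/-- A measure with the right marginals on tame subgroupoids is one with the right joint laws on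
independent edges. -/
lemma map_restr_eq_haarPush_iff {L : Subgroupoid (PathGroupoid d M)} (h : IsGeneratedBy L e)
    (ν : Measure (HomTo (PathGroupoid d M) G)) :
    ν.map (restr G L) = haarPush G h ↔ ν.map (evalEdges e) = haarPi G n := by
  have hr := (continuous_restr (G := G) L).measurable
  have hrho := (continuous_rho (G := G) h).measurable
  constructor
  · intro h1
    have h2 : (evalEdges e : HomTo (PathGroupoid d M) G → Fin n → G) = rho G h ∘ restr G L := rfl
    rw [h2, ← Measure.map_map hrho hr, h1, haarPush_eq,
      Measure.map_map hrho (measurable_restr_sec L _)]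
    have h3 : rho G h ∘ (fun g => restr G L (h.independent.sec g)) = id :=
      funext fun g => evalEdges_sec _ g
    rw [h3, Measure.map_id]
  · intro h1
    have h2 : (restr G L : HomTo (PathGroupoid d M) G → _) =
        (fun g => restr G L (h.independent.sec g)) ∘ evalEdges e :=
      funext fun A => restr_eq_of_evalEdges_eq h (evalEdges_sec _ _).symm
    rw [h2, ← Measure.map_map (measurable_restr_sec L _) (measurable_evalEdges e), h1,
      haarPush_eq]

end EdgeMeasures

/-! ### Functions of finitely many edge values -/

section Cylinder

/-- The continuous functions that depend only on the values on finitely many edges. -/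
def cylinderFunctions (d : ℕ) (M : Type u) [TopologicalSpace M]
    [ChartedSpace (EuclideanSpace ℝ (Fin d)) M] (G : Type v) [Group G] [TopologicalSpace G] :
    Subalgebra ℝ C(HomTo (PathGroupoid d M) G, ℝ) where
  carrier := {f | ∃ E : Set (Edge d M), E.Finite ∧ ∀ A B : HomTo (PathGroupoid d M) G,
    (∀ e ∈ E, A.eval e.hom = B.eval e.hom) → f A = f B}
  mul_mem' := by
    rintro f g ⟨E, hE, hf⟩ ⟨E', hE', hg⟩
    refine ⟨E ∪ E', hE.union hE', fun A B h => ?_⟩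
    rw [ContinuousMap.mul_apply, ContinuousMap.mul_apply, hf A B fun e he => h e (.inl he),
      hg A B fun e he => h e (.inr he)]
  add_mem' := by
    rintro f g ⟨E, hE, hf⟩ ⟨E', hE', hg⟩
    refine ⟨E ∪ E', hE.union hE', fun A B h => ?_⟩
    rw [ContinuousMap.add_apply, ContinuousMap.add_apply, hf A B fun e he => h e (.inl he),
      hg A B fun e he => h e (.inr he)]
  algebraMap_mem' r := ⟨∅, finite_empty, fun _ _ _ => rfl⟩

/-- Distinct functors differ on some edge by `HomTo.ext_edge`, and a Urysohn function of that single
value separates them. -/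
lemma separatesPoints_cylinderFunctions {d : ℕ} {M : Type u} [TopologicalSpace M]
    [ChartedSpace (EuclideanSpace ℝ (Fin d)) M] {G : Type v} [Group G] [TopologicalSpace G]
    [IsTopologicalGroup G] [T2Space G] [NormalSpace G] :
    (cylinderFunctions d M G).SeparatesPoints := by
  intro A B hAB
  obtain ⟨e, he⟩ : ∃ e : Edge d M, A.eval e.hom ≠ B.eval e.hom := by
    by_contra! h
    exact hAB (HomTo.ext_edge h)
  obtain ⟨f, h0, h1, -⟩ := exists_continuous_zero_one_of_isClosed
    (isClosed_singleton (x := A.eval e.hom)) (isClosed_singleton (x := B.eval e.hom))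
    (by simpa using he)
  refine ⟨_, ⟨f.comp ⟨_, HomTo.continuous_eval e.hom⟩,
    ⟨{e}, finite_singleton e, fun A' B' h => ?_⟩, rfl⟩, ?_⟩
  · exact congrArg f (h e rfl)
  · have h0' : f (A.eval e.hom) = 0 := h0 rfl
    have h1' : f (B.eval e.hom) = 1 := h1 rfl
    change f (A.eval e.hom) ≠ f (B.eval e.hom)
    rw [h0', h1']
    exact zero_ne_one

end Cylinder

/-! ### Existence and uniqueness of the measure with Haar laws -/

section EdgeLaws

variable {d : ℕ} {M : Type u} [TopologicalSpace M] [ChartedSpace (EuclideanSpace ℝ (Fin d)) M]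
  {G : Type v} [Group G] [TopologicalSpace G] [IsTopologicalGroup G] [CompactSpace G]
  [MeasurableSpace G] [BorelSpace G]

/-- The joint law of the values of a random functor on independent edges is the product of the
Haar probability measures. -/
def HasHaarLaws (ν : Measure (HomTo (PathGroupoid d M) G)) : Prop :=
  ∀ (n : ℕ) (e : Fin n → Edge d M), Independent e → ν.map (evalEdges e) = haarPi G n

variable [SecondCountableTopology G]

lemma exists_hasHaarLaws [T2Space G] [IsManifold (𝓡 d) ω M] [T2Space M] :
    ∃ μ : Measure (HomTo (PathGroupoid d M) G),
      IsProbabilityMeasure μ ∧ μ.Regular ∧ HasHaarLaws μ := by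
  classical
  choose m e he hgen using fun F : Finset (Edge d M) =>
    exists_independent_generating (fun i : F => i.1)
  -- By consistency, `ν F` already has the right joint law on every independent family contained in
  -- `F`.
  let ν : Finset (Edge d M) → ProbabilityMeasure (HomTo (PathGroupoid d M) G) := fun F =>
    ⟨(haarPi G (m F)).map (he F).sec, Measure.isProbabilityMeasure_map
      (continuous_sec (he F)).measurable.aemeasurable⟩
  -- The probability measures on the compact space of functors form a compact space, so an
  -- ultrafilter finer than `atTop` yields a weak limit.
  let U : Ultrafilter (Finset (Edge d M)) := Ultrafilter.of Filter.atTop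
  have hU : (U : Filter (Finset (Edge d M))) ≤ Filter.atTop := Ultrafilter.of_le _
  have hlim : Filter.Tendsto ν U (𝓝 (U.map ν).lim) := (U.map ν).le_nhds_lim
  rw [ProbabilityMeasure.tendsto_iff_forall_integral_tendsto] at hlim
  -- The weak limit is replaced by a regular measure with the same integrals of continuous
  -- functions.
  obtain ⟨μ, hreg, hfin, hμ⟩ := Measure.exists_regular_eq_of_compactSpace
    ((U.map ν).lim : Measure (HomTo (PathGroupoid d M) G))
  have hprob : IsProbabilityMeasure μ := by
    have h1 := hμ (BoundedContinuousFunction.const _ 1)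
    simp only [BoundedContinuousFunction.const_apply, integral_const, probReal_univ, smul_eq_mul,
      mul_one] at h1
    refine ⟨?_⟩
    rw [measureReal_def] at h1
    rw [← ENNReal.ofReal_toReal (measure_ne_top μ univ), ← h1, ENNReal.ofReal_one]
  refine ⟨μ, hprob, hreg, fun n e' he' => ?_⟩
  have hc := continuous_evalEdges (G := G) e'
  have hp : IsProbabilityMeasure (μ.map (evalEdges e')) :=
    Measure.isProbabilityMeasure_map hc.measurable.aemeasurable
  refine ext_of_forall_integral_eq_of_IsFiniteMeasure fun f => ?_
  rw [integral_map hc.measurable.aemeasurable f.continuous.aestronglyMeasurable]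
  have h1 := hlim (f.compContinuous ⟨_, hc⟩)
  rw [hμ] at h1
  refine tendsto_nhds_unique h1 (tendsto_const_nhds.congr' ?_)
  -- As soon as `F` contains all the edges `e' i`, the integral is constant in `F`.
  filter_upwards [hU (Filter.Ici_mem_atTop (Finset.univ.image e'))] with F hF
  have hg : ∀ i, (e' i).hom ∈ (generated (e F)).arrows (e' i).src (e' i).tgt := fun i =>
    hgen F ⟨e' i, hF (Finset.mem_image_of_mem _ (Finset.mem_univ i))⟩
  have hs := continuous_sec (G := G) (he F)
  have h3 : ∫ A, f (evalEdges e' A) ∂(haarPi G (m F)).map (he F).sec =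
      ∫ g, f (evalEdges e' ((he F).sec g)) ∂haarPi G (m F) :=
    integral_map hs.measurable.aemeasurable (f.continuous.comp hc).aestronglyMeasurable
  change _ = ∫ A, f (evalEdges e' A) ∂(haarPi G (m F)).map (he F).sec
  rw [h3, ← map_evalEdges_sec he' (he F) hg]
  exact integral_map (hc.comp hs).measurable.aemeasurable f.continuous.aestronglyMeasurable

variable [IsManifold (𝓡 d) ω M] [T2Space M] {μ ν : Measure (HomTo (PathGroupoid d M) G)}

/-- By directedness a cylinder function is a function of the values on one independent family, whose
law is prescribed. -/
lemma HasHaarLaws.integral_eq (hμ : HasHaarLaws μ) (hν : HasHaarLaws ν)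
    {f : C(HomTo (PathGroupoid d M) G, ℝ)} (hf : f ∈ cylinderFunctions d M G) :
    ∫ A, f A ∂μ = ∫ A, f A ∂ν := by
  obtain ⟨E, hE, hf⟩ := hf
  have := hE.to_subtype
  obtain ⟨m, e, he, hgen⟩ := exists_independent_generating (fun i : E => i.1)
  have hfe : ∀ A, f A = f (he.sec (evalEdges e A)) := fun A => hf _ _ fun e' he' =>
    eval_eq_of_mem_generated (fun i => (he.eval_sec (evalEdges e A) i).symm) (hgen ⟨e', he'⟩)
  have key : ∀ {κ : Measure (HomTo (PathGroupoid d M) G)}, HasHaarLaws κ →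
      ∫ A, f A ∂κ = ∫ g, f (he.sec g) ∂haarPi G m := by
    intro κ hκ
    rw [← hκ m e he]
    exact (integral_congr_ae (.of_forall hfe)).trans
      (integral_map (measurable_evalEdges e).aemeasurable
        (f.continuous.comp (continuous_sec he)).aestronglyMeasurable).symm
  rw [key hμ, key hν]

/-- By Stone-Weierstrass the equality of integrals passes from cylinder functions to all continuous
functions, and these determine a regular measure. -/
lemma HasHaarLaws.eq [T2Space G] [IsProbabilityMeasure μ] [IsProbabilityMeasure ν]
    [μ.Regular] [ν.Regular] (hμ : HasHaarLaws μ) (hν : HasHaarLaws ν) : μ = ν := by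
  refine Measure.ext_of_integral_eq_on_compactlySupported fun f => ?_
  refine eq_of_forall_dist_le fun ε hε => ?_
  obtain ⟨⟨g, hg⟩, hgf⟩ := ContinuousMap.exists_mem_subalgebra_near_continuous_of_separatesPoints
    _ (separatesPoints_cylinderFunctions (d := d) (M := M) (G := G)) f f.continuous (ε / 2)
    (half_pos hε)
  have key : ∀ (κ : Measure (HomTo (PathGroupoid d M) G)) [IsProbabilityMeasure κ],
      dist (∫ A, g A ∂κ) (∫ A, f A ∂κ) ≤ ε / 2 := by
    intro κ _
    have h1 : Integrable (fun A => g A) κ :=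
      (BoundedContinuousFunction.mkOfCompact g).integrable κ
    have h2 : Integrable (fun A => f A) κ := f.continuous.integrable_of_hasCompactSupport
      f.hasCompactSupport
    rw [dist_eq_norm, ← integral_sub h1 h2]
    simpa using norm_integral_le_of_norm_le_const (μ := κ) (.of_forall fun A => (hgf A).le)
  calc dist (∫ A, f A ∂μ) (∫ A, f A ∂ν)
      ≤ dist (∫ A, f A ∂μ) (∫ A, g A ∂μ) + dist (∫ A, g A ∂μ) (∫ A, f A ∂ν) := dist_triangle _ _ _
    _ ≤ ε / 2 + ε / 2 := by
      rw [dist_comm]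
      refine add_le_add (key μ) ?_
      rw [hμ.integral_eq hν hg]
      exact key ν
    _ = ε := add_halves ε

end EdgeLaws

/-! ### Invariance under diffeomorphisms and gauge transformations -/

section Invariance

variable {d : ℕ} {M : Type u} [TopologicalSpace M] [ChartedSpace (EuclideanSpace ℝ (Fin d)) M]

lemma Curve.IsAnalytic.map {x y : M} {c : Curve d x y} (hc : c.IsAnalytic)
    (φ : M ≃ₘ^ω⟮𝓡 d, 𝓡 d⟯ M) : (c.map φ).IsAnalytic := by
  refine (IsPiece.diffeo φ (Or.inl hc)).resolve_right fun h => ?_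
  have h1 := φ.injective (h (1 / 2) (by norm_num))
  have := IsRegularPiece.eq_of_mem_Ioo hc (by simp) half_mem h1.symm
  norm_num at this

/-- The image of an edge under an analytic diffeomorphism. -/
noncomputable def Edge.map (φ : M ≃ₘ^ω⟮𝓡 d, 𝓡 d⟯ M) (e : Edge d M) : Edge d M where
  src := (diffeoFunctor φ).obj e.src
  tgt := (diffeoFunctor φ).obj e.tgt
  hom := (diffeoFunctor φ).map e.hom
  isEdge := ⟨e.curve.map φ, e.isAnalytic_curve.map φ,
    congrArg (fun p => (diffeoFunctor φ).map p) e.toHom_curve⟩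

lemma Edge.image_map [T2Space M] (φ : M ≃ₘ^ω⟮𝓡 d, 𝓡 d⟯ M) (e : Edge d M) :
    (e.map φ).image = φ '' e.image := by
  rw [Edge.image_eq (e.map φ) (c := e.curve.map φ) (e.isAnalytic_curve.map φ)
    (congrArg (fun p => (diffeoFunctor φ).map p) e.toHom_curve),
    e.image_eq e.isAnalytic_curve e.toHom_curve]
  exact range_comp φ _

lemma Independent.map [T2Space M] {n : ℕ} {e : Fin n → Edge d M} (h : Independent e)
    (φ : M ≃ₘ^ω⟮𝓡 d, 𝓡 d⟯ M) : Independent fun i => (e i).map φ := by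
  intro i j hij z hz
  rw [Edge.image_map, Edge.image_map, ← image_inter (f := φ) φ.injective] at hz
  obtain ⟨a, ha, rfl⟩ := hz
  exact (h i j hij ha).imp (congrArg φ) (congrArg φ)

variable {G : Type v} [Group G] [TopologicalSpace G] [IsTopologicalGroup G] [CompactSpace G]
  [MeasurableSpace G] [BorelSpace G] [SecondCountableTopology G]
  {μ : Measure (HomTo (PathGroupoid d M) G)}

/-- Evaluating the transformed functor on `e` is evaluating the original one on the family moved by
`φ.symm`, which is again independent. -/
lemma HasHaarLaws.map_diffeoAct [T2Space M] (hμ : HasHaarLaws μ) (φ : M ≃ₘ^ω⟮𝓡 d, 𝓡 d⟯ M) :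
    HasHaarLaws (μ.map (diffeoAct φ)) := fun n e he => by
  rw [Measure.map_map (measurable_evalEdges e) (continuous_diffeoAct φ).measurable,
    ← hμ n _ (he.map φ.symm)]
  rfl

/-- On the edge values a gauge transformation is left translation by its values at the targets and
right translation by the inverses of those at the sources. -/
lemma HasHaarLaws.map_gauge (hμ : HasHaarLaws μ) (g : PathGroupoid d M → G) :
    HasHaarLaws (μ.map (HomTo.gauge g)) := fun n e he => by
  have h1 : evalEdges e ∘ HomTo.gauge g =
      (fun x : Fin n → G => (fun i => g (e i).tgt) * x * fun i => (g (e i).src)⁻¹) ∘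
        evalEdges e := rfl
  have hm : Measurable (fun x : Fin n → G =>
      (fun i => g (e i).tgt) * x * fun i => (g (e i).src)⁻¹) :=
    ((continuous_const_mul _).mul continuous_const).measurable
  rw [Measure.map_map (measurable_evalEdges e) (HomTo.continuous_gauge g).measurable, h1,
    ← Measure.map_map hm (measurable_evalEdges e), hμ n e he, map_mul_mul_eq]

/-- Inner regularity with respect to compact sets survives continuous images, and a finite inner
regular measure on a compact Hausdorff space is regular. -/
lemma regular_map_of_continuous {X Y : Type*} [TopologicalSpace X] [CompactSpace X]
    [MeasurableSpace X] [BorelSpace X] [TopologicalSpace Y] [CompactSpace Y] [T2Space Y]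
    [MeasurableSpace Y] [BorelSpace Y] {μ : Measure X} [IsFiniteMeasure μ] [μ.Regular]
    {f : X → Y} (hf : Continuous f) : (μ.map f).Regular := by
  have : (μ.map f).InnerRegular := Measure.InnerRegular.map_of_continuous hf
  infer_instance

end Invariance

end GenConn

/-! ### The main theorem -/

open GenConn
theorem mainTheorem6 {d k : ℕ}
    (S : Type*) [TopologicalSpace S] [ChartedSpace (EuclideanSpace ℝ (Fin d)) S]
    [IsManifold (𝓡 d) ω S] [T2Space S] [ParacompactSpace S] [ConnectedSpace S]
    (G : Type*) [Group G] [TopologicalSpace G] [ChartedSpace (EuclideanSpace ℝ (Fin k)) G]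
    [LieGroup (𝓡 k) ∞ G] [IsTopologicalGroup G] [T2Space G] [CompactSpace G] [ConnectedSpace G]
    [MeasurableSpace G] [BorelSpace G] :
    -- each `ρ_{e_1,…,e_n}` is a homeomorphism from `𝒜_L` onto `Gⁿ`
    (∀ (L : Tame d S) (n : ℕ) (e : Fin n → Edge d S) (h : IsGeneratedBy L.1 e),
      IsHomeomorph (rho G h)) ∧
    -- the push-forward of Haar measure to `𝒜_L` does not depend on the choice of generators
    (∀ (L : Tame d S) (n m : ℕ) (e : Fin n → Edge d S) (e' : Fin m → Edge d S)
      (h : IsGeneratedBy L.1 e) (h' : IsGeneratedBy L.1 e'), haarPush G h = haarPush G h') ∧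
    ∃ μL : ∀ L : Tame d S, Measure (HomTo L.1.objs G),
      (∀ (L : Tame d S) (n : ℕ) (e : Fin n → Edge d S) (h : IsGeneratedBy L.1 e),
        μL L = haarPush G h) ∧
      -- the `μL` are a consistent family of regular Borel probability measures
      (∀ L : Tame d S, IsProbabilityMeasure (μL L) ∧ (μL L).Regular) ∧
      (∀ (L L' : Tame d S) (h : L.1 ≤ L'.1), (μL L').map (restrOfLE G h) = μL L) ∧
      -- which defines a unique regular Borel probability measure `μ₀` on the generalized connections
      ∃ μ₀ : Measure (HomTo (PathGroupoid d S) G),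
        IsProbabilityMeasure μ₀ ∧ μ₀.Regular ∧
        (∀ L : Tame d S, μ₀.map (restr G L.1) = μL L) ∧
        (∀ ν : Measure (HomTo (PathGroupoid d S) G), IsProbabilityMeasure ν → ν.Regular →
          (∀ L : Tame d S, ν.map (restr G L.1) = μL L) → ν = μ₀) ∧
        -- and `μ₀` is invariant under analytic diffeomorphisms and gauge transformations
        (∀ φ : S ≃ₘ^ω⟮𝓡 d, 𝓡 d⟯ S, μ₀.map (diffeoAct φ) = μ₀) ∧
        (∀ g : S → G, μ₀.map (HomTo.gauge (C := PathGroupoid d S) g) = μ₀) := by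
  -- Second countability identifies the Borel sets of `Fin n → G` with the product σ-algebra, on
  -- which the product Haar measure lives.
  have hG : SecondCountableTopology G :=
    ChartedSpace.secondCountable_of_sigmaCompact (EuclideanSpace ℝ (Fin k)) G
  refine ⟨fun L n e h => isHomeomorph_rho h, fun L n m e e' h h' => haarPush_eq_haarPush h h',
    fun L => haarPush G L.2.choose_spec.choose_spec, fun L n e h => haarPush_eq_haarPush _ _,
    fun L => ⟨inferInstance, regular_haarPush _⟩, fun L L' h => map_restrOfLE_haarPush _ _ h, ?_⟩
  obtain ⟨μ, hprob, hreg, hμ⟩ := exists_hasHaarLaws (d := d) (M := S) (G := G)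
  refine ⟨μ, hprob, hreg, fun L => ?_, fun ν hν hν' h => ?_, fun φ => ?_, fun g => ?_⟩
  · exact (map_restr_eq_haarPush_iff _ μ).2 (hμ _ _ L.2.choose_spec.choose_spec.independent)
  -- Every independent family generates a tame subgroupoid, so the marginals of `ν` determine all of
  -- its Haar laws.
  · refine HasHaarLaws.eq (fun n e he => ?_) hμ
    rw [← map_restr_eq_haarPush_iff (isGeneratedBy_generated he),
      h ⟨generated e, n, e, isGeneratedBy_generated he⟩]
    exact haarPush_eq_haarPush _ _
  · have hc := continuous_diffeoAct (G := G) φ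
    have := Measure.isProbabilityMeasure_map (μ := μ) hc.measurable.aemeasurable
    have := regular_map_of_continuous (μ := μ) hc
    exact (hμ.map_diffeoAct φ).eq hμ
  · have hc := HomTo.continuous_gauge (C := PathGroupoid d S) g
    have := Measure.isProbabilityMeasure_map (μ := μ) hc.measurable.aemeasurable
    have := regular_map_of_continuous (μ := μ) hc
    exact (hμ.map_gauge g).eq hμ
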